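/- Let $\tilde A$ be an abelian group, $A\subset\tilde A$ a subgroup, and $V$ a strongly $A$-graded Möbius or conformal vertex algebra. Here $V=\coprod_{n\in\mathbb Z}V_{(n)}$ ($V_{(n)}$ the $L(0)$-eigenspace of eigenvalue $n$) carries a vertex operator map $Y(v,x)=\sum_n v_nx^{-n-1}$ and a vacuum $\mathbf 1$ satisfying lower truncation, the vacuum and creation properties, the Jacobi identity and $\frac{d}{dx}Y(v,x)=Y(L(-1)v,x)$. In the conformal case there is $\omega\in V_{(2)}$ such that the operators $L(n)=\omega_{n+1}$ satisfy the Virasoro relations; in the Möbius case there is a representation $L(-1),L(0),L(1)$ of $\mathfrak{sl}(2)$ with $[L(-1),Y(v,x)]=Y(L(-1)v,x)$, $[L(0),Y(v,x)]=Y(L(0)v,x)+xY(L(-1)v,x)$ and $[L(1),Y(v,x)]=Y(L(1)v,x)+2xY(L(0)v,x)+x^2Y(L(-1)v,x)$. Moreover $V=\coprod_{\alpha\in A}V^{(\alpha)}$ is a second grading, compatible with the first, such that $V_{(n)}^{(\alpha)}=V_{(n)}\cap V^{(\alpha)}$ is finite dimensional and vanishes for $n$ sufficiently negative, $\mathbf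 1\in V^{(0)}_{(0)}$ (and $\omega\in V^{(0)}_{(2)}$), $v_nV^{(\beta)}\subset V^{(\alpha+\beta)}$ for $v\in V^{(\alpha)}$, and each $V^{(\alpha)}$ is stable under $L(0),L(\pm1)$. Let $W_1,W_2$ be strongly $\tilde A$-graded generalized $V$-modules, with vertex operator maps $Y_1,Y_2$: these satisfy the analogous axioms, with $W=\coprod_{n\in\mathbb C}W_{[n]}$ graded by generalized $L(0)$-eigenspaces, $W=\coprod_{\beta\in\tilde A}W^{(\beta)}$ a compatible grading, $\dim W^{(\beta)}_{[n]}<\infty$, $W^{(\beta)}_{[n+k]}=0$ for $k\in\mathbb Z$ sufficiently negative, $v_nW^{(\beta)}\subset W^{(\alpha+\beta)}$ for $v\in V^{(\alpha)}$, and $L(j)W^{(\beta)}\subset W^{(\beta)}$ for $j=0,\pm1$. Let $z\in\mathbb C^\times$. For a rational function $f$ in $\mathbb C[t,t^{-1},(z^{-1}-t)^{-1}]$ and $v\in V_{(h)}$ put $(v\otimes f(t))^o=v^of(t^{-1})$, where $v^o=(-1)^h\sum_{m\ge0}\frac1{m!}L(1)^mv\otimes t^{2h-2-m}$, extended linearly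 in $v$; let $T_zf(t)=f(t+z)$, let $\iota_+$ denote expansion in $\mathbb C((t))$, and let $\tau_{W}(v\otimes\sum a_nt^n)=\sum a_nv_n$ be the action of $V\otimes\mathbb C((t))$ on a module $W$. Define operators $\tau_{P(z)}(\xi)$ on $(W_1\otimes W_2)^*$ by $$(\tau_{P(z)}(\xi)\lambda)(w_1\otimes w_2)=\lambda\big(\tau_{W_1}(\iota_+T_z\xi^o)w_1\otimes w_2\big)+\lambda\big(w_1\otimes\tau_{W_2}(\iota_+\xi^o)w_2\big)$$ and $Y'_{P(z)}(v,x)=\sum_n\tau_{P(z)}(v\otimes t^n)x^{-n-1}$. In the conformal case let $Y'_{P(z)}(\omega,x)=\sum_nL'_{P(z)}(n)x^{-n-2}$; in the Möbius case let, for $j=-1,0,1$, $$(L'_{P(z)}(j)\lambda)(w_1\otimes w_2)=\lambda\Big(w_1\otimes L(-j)w_2+\sum_{i=0}^{1-j}\tbinom{1-j}iz^iL(-j-i)w_1\otimes w_2\Big).$$ Let $\mathrm{COMP}_{P(z)}((W_1\otimes W_2)^*)$ be the space of $\lambda\in(W_1\otimes W_2)^*$ such that, for all $v\in V$, (a) $Y'_{P(z)}(v,x)\lambda$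 involves only finitely many negative powers of $x$, and (b) for all $m,n\in\mathbb Z$, $$\tau_{P(z)}\big(v\otimes(t^{-1}-z)^nt^m\big)\lambda=\sum_{i\ge0}\tbinom ni(-z)^i\,\tau_{P(z)}(v\otimes t^{m-n+i})\lambda ,$$ that is, $\tau_{P(z)}\big(x_0^{-1}\delta\big(\tfrac{x_1^{-1}-z}{x_0}\big)Y_t(v,x_1)\big)\lambda=x_0^{-1}\delta\big(\tfrac{x_1^{-1}-z}{x_0}\big)Y'_{P(z)}(v,x_1)\lambda$, where $Y_t(v,x)=\sum_n(v\otimes t^n)x^{-n-1}$. For $\beta\in\tilde A$ and $n\in\mathbb C$ let $((W_1\otimes W_2)^*)^{(\beta)}$ be the space of functionals vanishing on $(W_1\otimes W_2)^{(\gamma)}$ for all $\gamma\ne-\beta$, and let $((W_1\otimes W_2)^*)^{(\beta)}_{[n]}$ (respectively $((W_1\otimes W_2)^*)^{(\beta)}_{(n)}$) be its intersection with the generalized (respectively ordinary) $L'_{P(z)}(0)$-eigenspace of eigenvalue $n$. Let $\mathrm{LGR}_{[\mathbb C];P(z)}((W_1\otimes W_2)^*)$ be the space of $\lambda\in\coprod_{n,\beta}((W_1\otimes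 W_2)^*)^{(\beta)}_{[n]}$ such that the smallest subspace $W_\lambda$ of this sum that is doubly graded, contains $\lambda$ and is stable under all $\tau_{P(z)}(v\otimes t^m)$ and under $L'_{P(z)}(-1),L'_{P(z)}(0),L'_{P(z)}(1)$ satisfies $\dim(W_\lambda)^{(\beta)}_{[n]}<\infty$ and $(W_\lambda)^{(\beta)}_{[n+k]}=0$ for $k\in\mathbb Z$ sufficiently negative, for all $n\in\mathbb C$, $\beta\in\tilde A$. Let $\mathrm{LGR}_{(\mathbb C);P(z)}((W_1\otimes W_2)^*)$ be defined in the same way with ordinary eigenspaces $(\,\cdot\,)_{(n)}$ in place of $(\,\cdot\,)_{[n]}$. Then each of the three subspaces $\mathrm{COMP}_{P(z)}((W_1\otimes W_2)^*)$, $\mathrm{LGR}_{[\mathbb C];P(z)}((W_1\otimes W_2)^*)$ and $\mathrm{LGR}_{(\mathbb C);P(z)}((W_1\otimes W_2)^*)$ of $(W_1\otimes W_2)^*$ is stable under the operators $\tau_{P(z)}(v\otimes t^n)$ for all $v\in V$ and $n\in\mathbb Z$ and, in both the Möbius and the conformal case, under $L'_{P(z)}(-1)$, $L'_{P(z)}(0)$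 and $L'_{P(z)}(1)$. -/

import Mathlib

open scoped TensorProduct

namespace PzTensor

noncomputable section

/-! ### Vertex algebras and their modules -/

/-- A linear map `V → (End W)[[x, x⁻¹]]`, `v ↦ Y(v, x) = ∑ₙ vₙ x^{-n-1}`, given by its modes:
`Y v n` is the component operator `vₙ`. -/
abbrev VertexMap (V W : Type*) [AddCommGroup V] [Module ℂ V] [AddCommGroup W] [Module ℂ W] :=
  V →ₗ[ℂ] ℤ → Module.End ℂ W

section Basic

variable {V W : Type*} [AddCommGroup V] [Module ℂ V] [AddCommGroup W] [Module ℂ W]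

/-- Lower truncation: `Y(v, x)w ∈ W((x))`. -/
def LowerTruncated (Y : VertexMap V W) : Prop :=
  ∀ v w, ∃ N : ℤ, ∀ n, N ≤ n → Y v n w = 0

/-- `Y(𝟏, x) = 1`. -/
def VacuumProperty (vac : V) (Y : VertexMap V W) : Prop :=
  ∀ n : ℤ, Y vac n = if n = -1 then 1 else 0

/-- The Jacobi identity
`x₀⁻¹δ((x₁-x₂)/x₀) Y(u,x₁)Y(v,x₂) - x₀⁻¹δ((x₂-x₁)/(-x₀)) Y(v,x₂)Y(u,x₁)
  = x₂⁻¹δ((x₁-x₀)/x₂) Y(Y(u,x₀)v,x₂)`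
applied to `w`; this is the equality of the coefficients of `x₀^{-l-1} x₁^{-m-1} x₂^{-n-1}`.
All sums are finite by lower truncation. -/
def JacobiIdentity (Y : VertexMap V V) (YW : VertexMap V W) : Prop :=
  ∀ (u v : V) (w : W) (l m n : ℤ),
    (∑ᶠ i : ℕ, ((-1 : ℂ) ^ i * (Ring.choose l i : ℤ)) • YW u (m + l - i) (YW v (n + i) w))
      - (-1 : ℂ) ^ l • ∑ᶠ i : ℕ,
          ((-1 : ℂ) ^ i * (Ring.choose l i : ℤ)) • YW v (n + l - i) (YW u (m + i) w)
      = ∑ᶠ i : ℕ, ((Ring.choose m i : ℤ) : ℂ) • YW (Y u (l + i) v) (m + n - i) w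

/-- `d/dx Y(v, x) = Y(D v, x)`. -/
def DerivativeProperty (D : Module.End ℂ V) (Y : VertexMap V W) : Prop :=
  ∀ (v : V) (n : ℤ), Y (D v) n = (-(n : ℂ)) • Y v (n - 1)

variable (W) in
/-- Operators `L(-1)`, `L(0)`, `L(1)` on `W` giving a representation of `𝔰𝔩(2)`. -/
structure Sl2Rep where
  Lm1 : Module.End ℂ W
  L0 : Module.End ℂ W
  L1 : Module.End ℂ W
  bracket_L0_Lm1 : ⁅L0, Lm1⁆ = Lm1
  bracket_L0_L1 : ⁅L0, L1⁆ = -L1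
  bracket_Lm1_L1 : ⁅Lm1, L1⁆ = (-2 : ℂ) • L0

/-- The commutator formulas
`[L(-1), Y(v,x)] = Y(L(-1)v,x)`, `[L(0), Y(v,x)] = Y(L(0)v,x) + xY(L(-1)v,x)` and
`[L(1), Y(v,x)] = Y(L(1)v,x) + 2xY(L(0)v,x) + x²Y(L(-1)v,x)`. -/
def Sl2Covariant (ρV : Sl2Rep V) (ρW : Sl2Rep W) (Y : VertexMap V W) : Prop :=
  ∀ (v : V) (n : ℤ),
    ⁅ρW.Lm1, Y v n⁆ = Y (ρV.Lm1 v) n ∧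
    ⁅ρW.L0, Y v n⁆ = Y (ρV.L0 v) n + Y (ρV.Lm1 v) (n + 1) ∧
    ⁅ρW.L1, Y v n⁆ =
      Y (ρV.L1 v) n + (2 : ℂ) • Y (ρV.L0 v) (n + 1) + Y (ρV.Lm1 v) (n + 2)

/-- The Virasoro relations for `L(n) = ωₙ₊₁`, with central charge `c`. -/
def VirasoroRelations (ω : V) (c : ℂ) (Y : VertexMap V W) : Prop :=
  ∀ m n : ℤ, ⁅Y ω (m + 1), Y ω (n + 1)⁆ =
    ((m : ℂ) - n) • Y ω (m + n + 1)
      + (if m + n = 0 then (((m : ℂ) ^ 3 - m) / 12 * c) else 0) • (1 : Module.End ℂ W)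

variable (V) in
/-- The data and axioms concerning only `V`, `Y` and the vacuum. -/
structure VertexAlgebra where
  Y : VertexMap V V
  vac : V
  truncated : LowerTruncated Y
  vacuum : VacuumProperty vac Y
  creation_regular : ∀ (v : V) (n : ℤ), 0 ≤ n → Y v n vac = 0
  creation : ∀ v : V, Y v (-1) vac = v
  jacobi : JacobiIdentity Y Y

variable (W) in
/-- The data and axioms concerning only the vertex operator map of a module. -/
structure VertexModule (𝕍 : VertexAlgebra V) where
  Y : VertexMap V W
  truncated : LowerTruncated Y
  vacuum : VacuumProperty 𝕍.vac Y
  jacobi : JacobiIdentity 𝕍.Y Y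

/-- Strong `A`-gradedness of a vertex algebra, `V = ∐_{α ∈ A} V^{(α)}`.  The weight
grading is `V = ∐_{n ∈ ℤ} V_{(n)}`, `V_{(n)}` being the `L(0)`-eigenspace of eigenvalue `n`
(the sum of eigenspaces is automatically direct). -/
structure IsStronglyGradedAlgebra {A : Type*} [AddCommGroup A] (𝕍 : VertexAlgebra V)
    (L0 : Module.End ℂ V) (gr : A → Submodule ℂ V) : Prop where
  weight_span : ⨆ n : ℤ, L0.eigenspace (n : ℂ) = ⊤
  indep : iSupIndep gr
  span : ⨆ α, gr α = ⊤
  compatible : ∀ α, gr α = ⨆ n : ℤ, gr α ⊓ L0.eigenspace (n : ℂ)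
  lower : ∀ α, ∃ N : ℤ, ∀ n : ℤ, n < N → gr α ⊓ L0.eigenspace (n : ℂ) = ⊥
  finite : ∀ α (n : ℤ), FiniteDimensional ℂ ↥(gr α ⊓ L0.eigenspace (n : ℂ))
  vac_mem : 𝕍.vac ∈ gr 0 ⊓ L0.eigenspace 0
  mode_mem : ∀ α β, ∀ v ∈ gr α, ∀ u ∈ gr β, ∀ n : ℤ, 𝕍.Y v n u ∈ gr (α + β)

/-- Strong `Ã`-gradedness of a generalized module, `W = ∐_{β ∈ Ã} W^{(β)}`, where `A` is a
subgroup of `Ã`.  The weight grading is `W = ∐_{n ∈ ℂ} W_{[n]}`, `W_{[n]}` being the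
generalized `L(0)`-eigenspace of eigenvalue `n`. -/
structure IsStronglyGradedModule {G : Type*} [AddCommGroup G] {A : AddSubgroup G}
    {𝕍 : VertexAlgebra V} (grV : A → Submodule ℂ V) (𝕄 : VertexModule W 𝕍)
    (L0 : Module.End ℂ W) (gr : G → Submodule ℂ W) : Prop where
  weight_span : ⨆ n : ℂ, L0.maxGenEigenspace n = ⊤
  indep : iSupIndep gr
  span : ⨆ β, gr β = ⊤
  compatible : ∀ β, gr β = ⨆ n : ℂ, gr β ⊓ L0.maxGenEigenspace n
  lower : ∀ β (n : ℂ), ∃ K : ℤ, ∀ k : ℤ, k < K → gr β ⊓ L0.maxGenEigenspace (n + k) = ⊥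
  finite : ∀ β (n : ℂ), FiniteDimensional ℂ ↥(gr β ⊓ L0.maxGenEigenspace n)
  mode_mem : ∀ (α : A) (β : G), ∀ v ∈ grV α, ∀ w ∈ gr β, ∀ n : ℤ,
    𝕄.Y v n w ∈ gr ((α : G) + β)

end Basic

/-- A strongly `A`-graded Möbius vertex algebra. -/
structure MobiusVertexAlgebra (A V : Type*) [AddCommGroup A] [AddCommGroup V] [Module ℂ V]
    extends VertexAlgebra V where
  sl2 : Sl2Rep V
  covariant : Sl2Covariant sl2 sl2 Y
  derivative : DerivativeProperty sl2.Lm1 Y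
  gr : A → Submodule ℂ V
  graded : IsStronglyGradedAlgebra toVertexAlgebra sl2.L0 gr
  Lm1_mem : ∀ α, ∀ v ∈ gr α, sl2.Lm1 v ∈ gr α
  L0_mem : ∀ α, ∀ v ∈ gr α, sl2.L0 v ∈ gr α
  L1_mem : ∀ α, ∀ v ∈ gr α, sl2.L1 v ∈ gr α

/-- A strongly `A`-graded conformal vertex algebra; `L(n) = ωₙ₊₁`. -/
structure ConformalVertexAlgebra (A V : Type*) [AddCommGroup A] [AddCommGroup V] [Module ℂ V]
    extends VertexAlgebra V where
  ω : V
  c : ℂ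
  virasoro : VirasoroRelations ω c Y
  derivative : DerivativeProperty (Y ω 0) Y
  gr : A → Submodule ℂ V
  graded : IsStronglyGradedAlgebra toVertexAlgebra (Y ω 1) gr
  ω_mem : ω ∈ gr 0 ⊓ (Y ω 1).eigenspace 2

/-- A strongly `Ã`-graded generalized module for a strongly `A`-graded Möbius vertex
algebra, `A` being a subgroup of `Ã`. -/
structure MobiusModule {G V : Type*} [AddCommGroup G] {A : AddSubgroup G} [AddCommGroup V]
    [Module ℂ V] (𝕍 : MobiusVertexAlgebra A V) (W : Type*) [AddCommGroup W] [Module ℂ W]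
    extends VertexModule W 𝕍.toVertexAlgebra where
  sl2 : Sl2Rep W
  covariant : Sl2Covariant 𝕍.sl2 sl2 Y
  derivative : DerivativeProperty 𝕍.sl2.Lm1 Y
  gr : G → Submodule ℂ W
  graded : IsStronglyGradedModule 𝕍.gr toVertexModule sl2.L0 gr
  Lm1_mem : ∀ β, ∀ w ∈ gr β, sl2.Lm1 w ∈ gr β
  L0_mem : ∀ β, ∀ w ∈ gr β, sl2.L0 w ∈ gr β
  L1_mem : ∀ β, ∀ w ∈ gr β, sl2.L1 w ∈ gr β

/-- A strongly `Ã`-graded generalized module for a strongly `A`-graded conformal vertex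
algebra; `L(n) = ωₙ₊₁` on `W`. -/
structure ConformalModule {G V : Type*} [AddCommGroup G] {A : AddSubgroup G} [AddCommGroup V]
    [Module ℂ V] (𝕍 : ConformalVertexAlgebra A V) (W : Type*) [AddCommGroup W] [Module ℂ W]
    extends VertexModule W 𝕍.toVertexAlgebra where
  virasoro : VirasoroRelations 𝕍.ω 𝕍.c Y
  derivative : DerivativeProperty (𝕍.Y 𝕍.ω 0) Y
  gr : G → Submodule ℂ W
  graded : IsStronglyGradedModule 𝕍.gr toVertexModule (Y 𝕍.ω 1) gr

/-! ### A conformal vertex algebra is a Möbius vertex algebra -/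

section ConformalToMobius

variable {V W : Type*} [AddCommGroup V] [Module ℂ V] [AddCommGroup W] [Module ℂ W]

/-- The commutator formula for `[uₘ, vₙ]`, `m ≥ 0`. -/
theorem commutator_formula {Y : VertexMap V V} {YW : VertexMap V W} (h : JacobiIdentity Y YW)
    (u v : V) (m : ℕ) (n : ℤ) :
    ⁅YW u m, YW v n⁆ =
      ∑ i ∈ Finset.range (m + 1), (m.choose i : ℂ) • YW (Y u i v) (m + n - i) := by
  ext w
  have key := h u v w 0 m n
  have e1 : ∀ (a b : ℤ) (p q : V), (∑ᶠ i : ℕ, ((-1 : ℂ) ^ i * (Ring.choose (0 : ℤ) i : ℤ)) •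
      YW p (a + 0 - i) (YW q (b + i) w)) = YW p a (YW q b w) := by
    intro a b p q
    rw [finsum_eq_single _ 0]
    · simp
    · intro i hi
      rw [Ring.choose_zero_pos ℤ (Nat.pos_of_ne_zero hi)]; simp
  rw [e1, e1, finsum_eq_sum_of_support_subset (s := Finset.range (m + 1))] at key
  · simp only [Ring.choose_natCast, zero_add, zpow_zero, one_smul] at key
    simpa [Ring.lie_def, LinearMap.sum_apply] using key
  · intro i hi
    simp only [Function.mem_support, Ring.choose_natCast] at hi
    by_contra hc
    simp only [Finset.coe_range, Set.mem_Iio, not_lt] at hc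
    apply hi
    rw [Nat.choose_eq_zero_of_lt (by omega)]; simp

/-- `L(-1), L(0), L(1)` inside the Virasoro algebra. -/
def VirasoroRelations.sl2 {ω : V} {c : ℂ} {Y : VertexMap V W} (h : VirasoroRelations ω c Y) :
    Sl2Rep W where
  Lm1 := Y ω 0
  L0 := Y ω 1
  L1 := Y ω 2
  bracket_L0_Lm1 := by have := h 0 (-1); norm_num at this; exact this
  bracket_L0_L1 := by have := h 0 1; norm_num at this; exact this
  bracket_Lm1_L1 := by have := h (-1) 1; norm_num at this ⊢; exact this

theorem VirasoroRelations.covariant {ω : V} {c : ℂ} {Y : VertexMap V V} {YW : VertexMap V W}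
    (h : VirasoroRelations ω c Y) (hW : VirasoroRelations ω c YW) (hJ : JacobiIdentity Y YW) :
    Sl2Covariant h.sl2 hW.sl2 YW := by
  intro v n
  have h0 := commutator_formula hJ ω v 0 n
  have h1 := commutator_formula hJ ω v 1 n
  have h2 := commutator_formula hJ ω v 2 n
  simp only [Finset.sum_range_succ, Finset.sum_range_zero] at h0 h1 h2
  norm_num at h0 h1 h2
  refine ⟨h0, ?_, ?_⟩
  · change ⁅YW ω 1, YW v n⁆ = YW (Y ω 1 v) n + YW (Y ω 0 v) (n + 1)
    rw [h1, add_comm, add_comm 1 n]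
  · change ⁅YW ω 2, YW v n⁆ = YW (Y ω 2 v) n + (2 : ℂ) • YW (Y ω 1 v) (n + 1)
      + YW (Y ω 0 v) (n + 2)
    rw [h2, show (2 : ℤ) + n - 1 = n + 1 by ring, add_comm 2 n]
    abel

/-- The Möbius vertex algebra underlying a conformal vertex algebra. -/
def ConformalVertexAlgebra.toMobius {A : Type*} [AddCommGroup A]
    (𝕍 : ConformalVertexAlgebra A V) : MobiusVertexAlgebra A V where
  toVertexAlgebra := 𝕍.toVertexAlgebra
  sl2 := 𝕍.virasoro.sl2
  covariant := 𝕍.virasoro.covariant 𝕍.virasoro 𝕍.jacobi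
  derivative := 𝕍.derivative
  gr := 𝕍.gr
  graded := 𝕍.graded
  Lm1_mem α v hv := by
    have := 𝕍.graded.mode_mem 0 α _ 𝕍.ω_mem.1 v hv 0
    rwa [zero_add] at this
  L0_mem α v hv := by
    have := 𝕍.graded.mode_mem 0 α _ 𝕍.ω_mem.1 v hv 1
    rwa [zero_add] at this
  L1_mem α v hv := by
    have := 𝕍.graded.mode_mem 0 α _ 𝕍.ω_mem.1 v hv 2
    rwa [zero_add] at this

/-- A generalized module for a conformal vertex algebra, as a generalized module for the
underlying Möbius vertex algebra. -/
def ConformalModule.toMobius {G : Type*} [AddCommGroup G] {A : AddSubgroup G}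
    {𝕍 : ConformalVertexAlgebra A V} (𝕄 : ConformalModule 𝕍 W) :
    MobiusModule 𝕍.toMobius W where
  toVertexModule := 𝕄.toVertexModule
  sl2 := 𝕄.virasoro.sl2
  covariant := 𝕍.virasoro.covariant 𝕄.virasoro 𝕄.jacobi
  derivative := 𝕄.derivative
  gr := 𝕄.gr
  graded := 𝕄.graded
  Lm1_mem β w hw := by
    have := 𝕄.graded.mode_mem 0 β _ 𝕍.ω_mem.1 w hw 0
    rwa [ZeroMemClass.coe_zero, zero_add] at this
  L0_mem β w hw := by
    have := 𝕄.graded.mode_mem 0 β _ 𝕍.ω_mem.1 w hw 1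
    rwa [ZeroMemClass.coe_zero, zero_add] at this
  L1_mem β w hw := by
    have := 𝕄.graded.mode_mem 0 β _ 𝕍.ω_mem.1 w hw 2
    rwa [ZeroMemClass.coe_zero, zero_add] at this

end ConformalToMobius

/-! ### Rational functions of `t` -/

section Rational

/-- `f(t) ↦ f(a)` for a non-constant rational function `a`. -/
def substitute (a : RatFunc ℂ) (ha : ¬∃ c, a = RatFunc.C c) : RatFunc ℂ →ₐ[ℂ] RatFunc ℂ :=
  RatFunc.liftAlgHom (Polynomial.aeval a)
    (nonZeroDivisors_le_comap_nonZeroDivisors_of_injective _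
      (transcendental_iff_injective.mp (a.transcendental_of_ne_C ha)))

theorem X_ne_C (c : ℂ) : (RatFunc.X : RatFunc ℂ) ≠ RatFunc.C c := by
  intro h
  rw [← RatFunc.algebraMap_X, ← RatFunc.algebraMap_C] at h
  exact Polynomial.X_ne_C c (RatFunc.algebraMap_injective ℂ h)

/-- `f(t) ↦ f(t⁻¹)`. -/
def invert : RatFunc ℂ →ₐ[ℂ] RatFunc ℂ :=
  substitute RatFunc.X⁻¹ (by
    rintro ⟨c, hc⟩
    exact X_ne_C c⁻¹ (by rw [map_inv₀, ← hc, inv_inv]))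

/-- The translation `T_z : f(t) ↦ f(t + z)`. -/
def translate (z : ℂ) : RatFunc ℂ →ₐ[ℂ] RatFunc ℂ :=
  substitute (RatFunc.X + RatFunc.C z) (by
    rintro ⟨c, hc⟩
    exact X_ne_C (c - z) (by rw [map_sub, ← hc, add_sub_cancel_right]))

/-- Expansion of a polynomial in `t` as an element of `ℂ((t))`. -/
def polyExpand : Polynomial ℂ →+* LaurentSeries ℂ :=
  (HahnSeries.ofPowerSeries ℤ ℂ).comp Polynomial.coeToPowerSeries.ringHom

theorem polyExpand_injective : Function.Injective polyExpand := by
  intro p q h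
  exact Polynomial.coe_injective ℂ (HahnSeries.ofPowerSeries_injective h)

/-- `ι₊`: expansion of a rational function in `ℂ((t))`. -/
def iotaPlus : RatFunc ℂ →+* LaurentSeries ℂ :=
  RatFunc.liftRingHom polyExpand
    (nonZeroDivisors_le_comap_nonZeroDivisors_of_injective _ polyExpand_injective)

theorem iotaPlus_coeff_smul (c : ℂ) (f : RatFunc ℂ) (n : ℤ) :
    (iotaPlus (c • f)).coeff n = c * (iotaPlus f).coeff n := by
  have h : iotaPlus (RatFunc.C c) = HahnSeries.C c := by
    rw [← RatFunc.algebraMap_C, iotaPlus, RatFunc.liftRingHom_algebraMap]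
    simp [polyExpand]
  rw [RatFunc.smul_eq_C_mul, map_mul, h, HahnSeries.C_mul_eq_smul, HahnSeries.coeff_smul,
    smul_eq_mul]

end Rational

/-! ### The actions `τ_W`, the opposite-operator map and `τ_{P(z)}` -/

section Tau

variable {V W : Type*} [AddCommGroup V] [Module ℂ V] [AddCommGroup W] [Module ℂ W]

theorem tauW_support {Y : VertexMap V W} (hY : LowerTruncated Y) (v : V) (f : RatFunc ℂ) (w : W) :
    (Function.support fun n : ℤ => (iotaPlus f).coeff n • Y v n w).Finite := by
  obtain ⟨N, hN⟩ := hY v w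
  refine (Set.finite_Ico (iotaPlus f).order N).subset fun n hn => ?_
  rw [Function.mem_support] at hn
  refine ⟨?_, ?_⟩
  · by_contra h
    exact hn (by rw [HahnSeries.coeff_eq_zero_of_lt_order (not_le.mp h), zero_smul])
  · by_contra h
    exact hn (by rw [hN n (not_lt.mp h), smul_zero])

/-- The action `τ_W` of `V ⊗ ℂ((t))` on `W`, `v ⊗ ∑ aₙtⁿ ↦ ∑ aₙvₙ`, restricted to the expansions
of rational functions; that is, the map `τ_W ∘ ι₊` on `V ⊗ ℂ(t)`. -/
def tauW (Y : VertexMap V W) (hY : LowerTruncated Y) :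
    V ⊗[ℂ] RatFunc ℂ →ₗ[ℂ] Module.End ℂ W :=
  TensorProduct.lift <| LinearMap.mk₂ ℂ
    (fun v f =>
      { toFun := fun w => ∑ᶠ n : ℤ, (iotaPlus f).coeff n • Y v n w
        map_add' := fun w w' => by
          rw [← finsum_add_distrib (tauW_support hY v f w) (tauW_support hY v f w')]
          simp only [map_add, smul_add]
        map_smul' := fun c w => by
          rw [RingHom.id_apply, smul_finsum]
          refine finsum_congr fun n => ?_
          rw [map_smul, smul_comm] })
    (fun v v' f => by
      ext w
      simp only [LinearMap.coe_mk, AddHom.coe_mk, LinearMap.add_apply]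
      rw [← finsum_add_distrib (tauW_support hY v f w) (tauW_support hY v' f w)]
      simp only [map_add, Pi.add_apply, LinearMap.add_apply, smul_add])
    (fun c v f => by
      ext w
      simp only [LinearMap.coe_mk, AddHom.coe_mk, LinearMap.smul_apply]
      rw [smul_finsum]
      refine finsum_congr fun n => ?_
      rw [map_smul, Pi.smul_apply, LinearMap.smul_apply, smul_comm])
    (fun v f f' => by
      ext w
      simp only [LinearMap.coe_mk, AddHom.coe_mk, LinearMap.add_apply]
      rw [← finsum_add_distrib (tauW_support hY v f w) (tauW_support hY v f' w)]
      simp only [map_add, HahnSeries.coeff_add, add_smul])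
    (fun c v f => by
      ext w
      simp only [LinearMap.coe_mk, AddHom.coe_mk, LinearMap.smul_apply]
      rw [smul_finsum]
      refine finsum_congr fun n => ?_
      rw [iotaPlus_coeff_smul, mul_smul])

variable {A : Type*} [AddCommGroup A]

/-- `L(1)` is locally nilpotent on `V`. -/
theorem L1_locally_nilpotent (𝕍 : MobiusVertexAlgebra A V) (v : V) :
    ∃ K : ℕ, ∀ k, K ≤ k → (𝕍.sl2.L1 ^ k) v = 0 := by
  have hv : v ∈ ⨆ α, 𝕍.gr α := by rw [𝕍.graded.span]; trivial
  induction hv using Submodule.iSup_induction' with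
  | zero => exact ⟨0, fun k _ => map_zero _⟩
  | add x y _ _ hx hy =>
    obtain ⟨K, hK⟩ := hx
    obtain ⟨K', hK'⟩ := hy
    refine ⟨max K K', fun k hk => ?_⟩
    rw [map_add, hK k (le_trans (le_max_left _ _) hk), hK' k (le_trans (le_max_right _ _) hk),
      add_zero]
  | mem α x hx =>
    rw [𝕍.graded.compatible α] at hx
    induction hx using Submodule.iSup_induction' with
    | zero => exact ⟨0, fun k _ => map_zero _⟩
    | add x y _ _ hx hy =>
      obtain ⟨K, hK⟩ := hx
      obtain ⟨K', hK'⟩ := hy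
      refine ⟨max K K', fun k hk => ?_⟩
      rw [map_add, hK k (le_trans (le_max_left _ _) hk), hK' k (le_trans (le_max_right _ _) hk),
        add_zero]
    | mem n x hx =>
      have step : ∀ k : ℕ, (𝕍.sl2.L1 ^ k) x ∈
          𝕍.gr α ⊓ 𝕍.sl2.L0.eigenspace ((n - k : ℤ) : ℂ) := by
        intro k
        induction k with
        | zero => simpa using hx
        | succ k ih =>
          rw [pow_succ', Module.End.mul_apply]
          refine ⟨𝕍.L1_mem α _ ih.1, ?_⟩
          have h1 := Module.End.mem_eigenspace_iff.mp ih.2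
          have h2 := LinearMap.congr_fun 𝕍.sl2.bracket_L0_L1 ((𝕍.sl2.L1 ^ k) x)
          rw [Ring.lie_def, LinearMap.sub_apply, Module.End.mul_apply, Module.End.mul_apply, h1,
            map_smul, LinearMap.neg_apply, sub_eq_iff_eq_add] at h2
          refine Module.End.mem_eigenspace_iff.mpr ?_
          rw [h2]
          push_cast
          module
      obtain ⟨N, hN⟩ := 𝕍.graded.lower α
      refine ⟨(n - N + 1).toNat, fun k hk => ?_⟩
      have := step k
      rw [hN (n - k) (by have := Int.self_le_toNat (n - N + 1); omega)] at this
      exact (Submodule.mem_bot ℂ).mp this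

theorem oppHom_support (𝕍 : MobiusVertexAlgebra A V) (h : ℤ) (v : V) :
    (Function.support fun k : ℕ => ((-1 : ℂ) ^ h * (k.factorial : ℂ)⁻¹) •
      ((𝕍.sl2.L1 ^ k) v ⊗ₜ[ℂ] ((RatFunc.X : RatFunc ℂ) ^ (2 * h - 2 - (k : ℤ))))).Finite := by
  obtain ⟨K, hK⟩ := L1_locally_nilpotent 𝕍 v
  refine (Set.finite_Iio K).subset fun k hk => ?_
  by_contra hc
  exact hk (by simp [hK k (not_lt.mp hc)])

/-- `v ↦ (-1)^h ∑ₖ (1/k!) L(1)ᵏv ⊗ t^{2h-2-k}`. -/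
def oppHom (𝕍 : MobiusVertexAlgebra A V) (h : ℤ) : V →ₗ[ℂ] V ⊗[ℂ] RatFunc ℂ where
  toFun v := ∑ᶠ k : ℕ, ((-1 : ℂ) ^ h * (k.factorial : ℂ)⁻¹) •
    ((𝕍.sl2.L1 ^ k) v ⊗ₜ[ℂ] ((RatFunc.X : RatFunc ℂ) ^ (2 * h - 2 - (k : ℤ))))
  map_add' v v' := by
    rw [← finsum_add_distrib (oppHom_support 𝕍 h v) (oppHom_support 𝕍 h v')]
    simp only [map_add, TensorProduct.add_tmul, smul_add]
  map_smul' c v := by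
    rw [RingHom.id_apply, smul_finsum]
    refine finsum_congr fun k => ?_
    rw [map_smul, ← TensorProduct.smul_tmul', smul_comm]

theorem weight_isInternal (𝕍 : MobiusVertexAlgebra A V) :
    DirectSum.IsInternal fun n : ℤ => 𝕍.sl2.L0.eigenspace (n : ℂ) :=
  DirectSum.isInternal_submodule_of_iSupIndep_of_iSup_eq_top
    (𝕍.sl2.L0.eigenspaces_iSupIndep.comp Int.cast_injective) 𝕍.graded.weight_span

/-- `v ↦ vᵒ`: on `V_{(h)}` it is `oppHom 𝕍 h`, extended linearly to `V = ∐ V_{(h)}`. -/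
def oppVec (𝕍 : MobiusVertexAlgebra A V) : V →ₗ[ℂ] V ⊗[ℂ] RatFunc ℂ :=
  (DirectSum.toModule ℂ ℤ _ fun h : ℤ =>
      oppHom 𝕍 h ∘ₗ (𝕍.sl2.L0.eigenspace (h : ℂ)).subtype) ∘ₗ
    (LinearEquiv.ofBijective
      (DirectSum.coeLinearMap fun n : ℤ => 𝕍.sl2.L0.eigenspace (n : ℂ))
      (weight_isInternal 𝕍)).symm.toLinearMap

/-- The opposite-operator map `o : v ⊗ f(t) ↦ vᵒ f(t⁻¹)`. -/
def opp (𝕍 : MobiusVertexAlgebra A V) : V ⊗[ℂ] RatFunc ℂ →ₗ[ℂ] V ⊗[ℂ] RatFunc ℂ :=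
  TensorProduct.lift <| LinearMap.mk₂ ℂ
    (fun v f => LinearMap.lTensor V (LinearMap.mul ℂ (RatFunc ℂ) (invert f)) (oppVec 𝕍 v))
    (fun v v' f => by rw [map_add, map_add])
    (fun c v f => by rw [map_smul, map_smul])
    (fun v f f' => by rw [map_add, map_add, LinearMap.lTensor_add, LinearMap.add_apply])
    (fun c v f => by
      have h : invert (c • f) = c • invert f := invert.toLinearMap.map_smul c f
      rw [h, map_smul, LinearMap.lTensor_smul, LinearMap.smul_apply])

end Tau

/-! ### Subspaces graded by an independent family, and the local grading restriction -/

section Graded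

variable {D ι : Type*} [AddCommGroup D] [Module ℂ D]

/-- `P` is graded by the family `E`: `P = ∐ᵢ P ∩ Eᵢ` (for independent `E`). -/
def IsGradedBy (E : ι → Submodule ℂ D) (P : Submodule ℂ D) : Prop :=
  P = ⨆ i, P ⊓ E i

/-- `W_λ`: the smallest subspace that is graded by `E` (in particular contained in `∐ᵢ Eᵢ`),
contains `lam` and is stable under the operators in `T`. -/
def gradedSpan (E : ι → Submodule ℂ D) (T : Set (Module.End ℂ D)) (lam : D) : Submodule ℂ D :=
  sInf {P | IsGradedBy E P ∧ lam ∈ P ∧ ∀ f ∈ T, ∀ x ∈ P, f x ∈ P}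

theorem finsupp_eq_of_sum_eq {E : ι → Submodule ℂ D} (hE : iSupIndep E) (f g : ι →₀ D)
    (hf : ∀ i, f i ∈ E i) (hg : ∀ i, g i ∈ E i)
    (h : (f.sum fun _ x => x) = g.sum fun _ x => x) : f = g := by
  classical
  have key : ∀ k : ι →₀ D, (∀ i, k i ∈ E i) → (k.sum fun _ x => x) = 0 → k = 0 := by
    intro k hk h0
    ext i
    rw [Finsupp.zero_apply]
    by_cases hi : i ∈ k.support
    · rw [Finsupp.sum, ← Finset.add_sum_erase _ _ hi] at h0
      refine (Submodule.disjoint_def.mp (hE i)) _ (hk i) ?_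
      rw [eq_neg_of_add_eq_zero_left h0]
      refine Submodule.neg_mem _ (Submodule.sum_mem _ fun j hj => ?_)
      exact Submodule.mem_iSup_of_mem j
        (Submodule.mem_iSup_of_mem (Finset.ne_of_mem_erase hj) (hk j))
    · exact Finsupp.notMem_support_iff.mp hi
  refine sub_eq_zero.mp (key (f - g) (fun i => ?_) ?_)
  · exact Submodule.sub_mem _ (hf i) (hg i)
  · rw [Finsupp.sum_sub_index (fun _ _ _ => rfl), h, sub_self]

theorem IsGradedBy.exists_finsupp {E : ι → Submodule ℂ D} {P : Submodule ℂ D}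
    (hP : IsGradedBy E P) {x : D} (hx : x ∈ P) :
    ∃ f : ι →₀ D, (∀ i, f i ∈ P ⊓ E i) ∧ (f.sum fun _ x => x) = x := by
  rw [hP] at hx
  exact (Submodule.mem_iSup_iff_exists_finsupp _ _).mp hx

theorem isGradedBy_of_exists_finsupp {E : ι → Submodule ℂ D} {P : Submodule ℂ D}
    (h : ∀ x ∈ P, ∃ f : ι →₀ D, (∀ i, f i ∈ P ⊓ E i) ∧ (f.sum fun _ x => x) = x) :
    IsGradedBy E P :=
  le_antisymm (fun x hx => (Submodule.mem_iSup_iff_exists_finsupp _ _).mpr (h x hx))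
    (iSup_le fun _ => inf_le_left)

theorem IsGradedBy.sInf {E : ι → Submodule ℂ D} (hE : iSupIndep E) {S : Set (Submodule ℂ D)}
    (hne : S.Nonempty) (hS : ∀ P ∈ S, IsGradedBy E P) : IsGradedBy E (sInf S) := by
  obtain ⟨P₀, hP₀⟩ := hne
  refine isGradedBy_of_exists_finsupp fun x hx => ?_
  obtain ⟨f, hf, hfx⟩ := (hS P₀ hP₀).exists_finsupp ((Submodule.mem_sInf.mp hx) P₀ hP₀)
  refine ⟨f, fun i => ⟨Submodule.mem_sInf.mpr fun P hP => ?_, (hf i).2⟩, hfx⟩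
  obtain ⟨g, hg, hgx⟩ := (hS P hP).exists_finsupp ((Submodule.mem_sInf.mp hx) P hP)
  rw [finsupp_eq_of_sum_eq hE f g (fun i => (hf i).2) (fun i => (hg i).2) (hfx.trans hgx.symm)]
  exact (hg i).1

theorem IsGradedBy.sup {E : ι → Submodule ℂ D} {P Q : Submodule ℂ D} (hP : IsGradedBy E P)
    (hQ : IsGradedBy E Q) : IsGradedBy E (P ⊔ Q) := by
  refine le_antisymm (sup_le ?_ ?_) (iSup_le fun _ => inf_le_left)
  · conv_lhs => rw [hP]
    exact iSup_mono fun i => inf_le_inf_right _ le_sup_left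
  · conv_lhs => rw [hQ]
    exact iSup_mono fun i => inf_le_inf_right _ le_sup_right

theorem IsGradedBy.sup_inf {E : ι → Submodule ℂ D} (hE : iSupIndep E) {P Q : Submodule ℂ D}
    (hP : IsGradedBy E P) (hQ : IsGradedBy E Q) (i : ι) :
    (P ⊔ Q) ⊓ E i ≤ (P ⊓ E i) ⊔ (Q ⊓ E i) := by
  classical
  rintro x ⟨hx, hxi⟩
  obtain ⟨a, ha, b, hb, rfl⟩ := Submodule.mem_sup.mp hx
  obtain ⟨f, hf, hfa⟩ := hP.exists_finsupp ha
  obtain ⟨g, hg, hgb⟩ := hQ.exists_finsupp hb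
  have h : f + g = Finsupp.single i (a + b) := by
    refine finsupp_eq_of_sum_eq hE _ _ (fun j => Submodule.add_mem _ (hf j).2 (hg j).2)
      (fun j => ?_) ?_
    · by_cases hj : i = j
      · subst hj; simpa using hxi
      · simp [Finsupp.single_eq_of_ne' hj]
    · rw [Finsupp.sum_add_index' (fun _ => rfl) (fun _ _ _ => rfl), hfa, hgb,
        Finsupp.sum_single_index rfl]
  have := DFunLike.congr_fun h i
  rw [Finsupp.add_apply, Finsupp.single_eq_same] at this
  rw [← this]
  exact Submodule.add_mem_sup (hf i) (hg i)

/-- The subspace of those `lam ∈ ∐ᵢ Eᵢ` for which every homogeneous subspace of `W_λ` is finite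
dimensional and vanishes when its weight is shifted by a sufficiently negative integer.  Here
`E (n, β)` is the homogeneous subspace of weight `n` and `Ã`-degree `β`. -/
def lgr {G : Type*} (E : ℂ × G → Submodule ℂ D) (hE : iSupIndep E) (T : Set (Module.End ℂ D)) :
    Submodule ℂ D where
  carrier := {lam | lam ∈ (⨆ i, E i) ∧ ∀ (n : ℂ) (β : G),
    FiniteDimensional ℂ ↥(gradedSpan E T lam ⊓ E (n, β)) ∧
    ∃ K : ℤ, ∀ k : ℤ, k < K → gradedSpan E T lam ⊓ E (n + k, β) = ⊥}
  zero_mem' := by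
    refine ⟨Submodule.zero_mem _, fun n β => ?_⟩
    have h : gradedSpan E T 0 = ⊥ := by
      refine le_bot_iff.mp (sInf_le ⟨?_, Submodule.zero_mem _, ?_⟩)
      · simp [IsGradedBy]
      · rintro f - x hx
        rw [(Submodule.mem_bot ℂ).mp hx, map_zero]
        exact Submodule.zero_mem _
    rw [h]
    refine ⟨?_, 0, fun k _ => bot_inf_eq _⟩
    rw [bot_inf_eq]
    infer_instance
  add_mem' := by
    rintro x y ⟨hx, hx'⟩ ⟨hy, hy'⟩
    refine ⟨Submodule.add_mem _ hx hy, fun n β => ?_⟩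
    obtain ⟨hxf, K, hK⟩ := hx' n β
    obtain ⟨hyf, K', hK'⟩ := hy' n β
    suffices h : ∀ i, gradedSpan E T (x + y) ⊓ E i ≤
        (gradedSpan E T x ⊓ E i) ⊔ (gradedSpan E T y ⊓ E i) by
      refine ⟨?_, min K K', fun k hk => ?_⟩
      · exact Submodule.finiteDimensional_of_le (h (n, β))
      · have := h (n + k, β)
        rwa [hK k (lt_of_lt_of_le hk (min_le_left _ _)),
          hK' k (lt_of_lt_of_le hk (min_le_right _ _)), bot_sup_eq, le_bot_iff] at this
    intro i
    by_cases hnx : {P | IsGradedBy E P ∧ x ∈ P ∧ ∀ f ∈ T, ∀ u ∈ P, f u ∈ P}.Nonempty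
    · by_cases hny : {P | IsGradedBy E P ∧ y ∈ P ∧ ∀ f ∈ T, ∀ u ∈ P, f u ∈ P}.Nonempty
      · have gx : IsGradedBy E (gradedSpan E T x) := IsGradedBy.sInf hE hnx fun P hP => hP.1
        have gy : IsGradedBy E (gradedSpan E T y) := IsGradedBy.sInf hE hny fun P hP => hP.1
        refine le_trans (inf_le_inf_right _ (sInf_le ⟨gx.sup gy, ?_, ?_⟩)) (gx.sup_inf hE gy i)
        · exact Submodule.add_mem_sup (Submodule.mem_sInf.mpr fun P hP => hP.2.1)
            (Submodule.mem_sInf.mpr fun P hP => hP.2.1)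
        · intro f hf u hu
          obtain ⟨a, ha, b, hb, rfl⟩ := Submodule.mem_sup.mp hu
          rw [map_add]
          refine Submodule.add_mem_sup (Submodule.mem_sInf.mpr fun P hP => ?_)
            (Submodule.mem_sInf.mpr fun P hP => ?_)
          · exact hP.2.2 f hf _ ((Submodule.mem_sInf.mp ha) P hP)
          · exact hP.2.2 f hf _ ((Submodule.mem_sInf.mp hb) P hP)
      · have : gradedSpan E T y = ⊤ := by
          rw [gradedSpan, Set.not_nonempty_iff_eq_empty.mp hny, sInf_empty]
        rw [this]
        exact le_trans (inf_le_inf_right _ le_top) le_sup_right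
    · have : gradedSpan E T x = ⊤ := by
        rw [gradedSpan, Set.not_nonempty_iff_eq_empty.mp hnx, sInf_empty]
      rw [this]
      exact le_trans (inf_le_inf_right _ le_top) le_sup_left
  smul_mem' := by
    rintro c x ⟨hx, hx'⟩
    have hle : gradedSpan E T (c • x) ≤ gradedSpan E T x :=
      sInf_le_sInf fun P hP => ⟨hP.1, Submodule.smul_mem _ c hP.2.1, hP.2.2⟩
    refine ⟨Submodule.smul_mem _ c hx, fun n β => ⟨?_, ?_⟩⟩
    · have := (hx' n β).1
      exact Submodule.finiteDimensional_of_le (inf_le_inf_right _ hle)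
    · obtain ⟨K, hK⟩ := (hx' n β).2
      exact ⟨K, fun k hk => le_bot_iff.mp (le_trans (inf_le_inf_right _ hle) (hK k hk).le)⟩

theorem iSupIndep_inf {κ : Type*} {F : ι → Submodule ℂ D} {H : κ → Submodule ℂ D}
    (hF : iSupIndep F) (hH : iSupIndep H) :
    iSupIndep fun p : ι × κ => F p.1 ⊓ H p.2 := by
  rintro ⟨n, b⟩
  rw [Submodule.disjoint_def]
  rintro x ⟨hxF, hxH⟩ hx
  have hle : (⨆ (p : ι × κ) (_ : p ≠ (n, b)), F p.1 ⊓ H p.2) ≤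
      (⨆ (j) (_ : j ≠ n), F j) ⊔ (F n ⊓ ⨆ (j) (_ : j ≠ b), H j) := by
    refine iSup_le fun p => iSup_le fun hp => ?_
    by_cases h : p.1 = n
    · refine le_sup_of_le_right (le_inf (h ▸ inf_le_left) ?_)
      have hb : p.2 ≠ b := fun hb => hp (Prod.ext h hb)
      exact inf_le_right.trans (le_iSup₂_of_le p.2 hb le_rfl)
    · exact le_sup_of_le_left (inf_le_left.trans (le_iSup₂_of_le p.1 h le_rfl))
  obtain ⟨p, hp, q, hq, rfl⟩ := Submodule.mem_sup.mp (hle hx)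
  have hp0 : p = 0 := by
    refine (Submodule.disjoint_def.mp (hF n)) p ?_ hp
    have := Submodule.sub_mem _ hxF hq.1
    rwa [add_sub_cancel_right] at this
  subst hp0
  rw [zero_add] at hxH ⊢
  exact (Submodule.disjoint_def.mp (hH b)) q hxH hq.2

end Graded

/-! ### The `P(z)`-structure on `(W₁ ⊗ W₂)*` -/

section Pz

variable {G V W₁ W₂ : Type*} [AddCommGroup G] {A : AddSubgroup G}
  [AddCommGroup V] [Module ℂ V] [AddCommGroup W₁] [Module ℂ W₁] [AddCommGroup W₂] [Module ℂ W₂]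
  {𝕍 : MobiusVertexAlgebra A V}

/-- The action `τ_{P(z)}` on `(W₁ ⊗ W₂)*`:
`(τ_{P(z)}(ξ)λ)(w₁ ⊗ w₂) = λ(τ_{W₁}((ι₊ ∘ T_z ∘ ι₋⁻¹ ∘ o)ξ)w₁ ⊗ w₂)
  + λ(w₁ ⊗ τ_{W₂}((ι₊ ∘ ι₋⁻¹ ∘ o)ξ)w₂)`.
An element of `V ⊗ ι₊ℂ[t, t⁻¹, (z⁻¹ - t)⁻¹]` is represented by the rational function of which it
is the expansion, so that no `ι₋⁻¹` appears; the formula makes sense on all of `V ⊗ ℂ(t)`. -/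
def tauP (z : ℂ) (M₁ : MobiusModule 𝕍 W₁) (M₂ : MobiusModule 𝕍 W₂) :
    V ⊗[ℂ] RatFunc ℂ →ₗ[ℂ] Module.End ℂ (Module.Dual ℂ (W₁ ⊗[ℂ] W₂)) :=
  Module.Dual.transpose ∘ₗ
    (LinearMap.rTensorHom W₂ ∘ₗ tauW M₁.Y M₁.truncated ∘ₗ
        LinearMap.lTensor V (translate z).toLinearMap ∘ₗ opp 𝕍
      + LinearMap.lTensorHom W₁ ∘ₗ tauW M₂.Y M₂.truncated ∘ₗ opp 𝕍)

/-- `τ_{P(z)}(v ⊗ tⁿ)`, the coefficient of `x^{-n-1}` in `Y'_{P(z)}(v, x)`. -/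
def tauMode (z : ℂ) (M₁ : MobiusModule 𝕍 W₁) (M₂ : MobiusModule 𝕍 W₂) (v : V) (n : ℤ) :
    Module.End ℂ (Module.Dual ℂ (W₁ ⊗[ℂ] W₂)) :=
  tauP z M₁ M₂ (v ⊗ₜ[ℂ] ((RatFunc.X : RatFunc ℂ) ^ n))

/-- The subspace `COMP_{P(z)}((W₁ ⊗ W₂)*)` of elements satisfying the `P(z)`-compatibility
condition: lower truncation of `Y'_{P(z)}(v, x)λ`, and
`τ_{P(z)}(x₀⁻¹δ((x₁⁻¹ - z)/x₀) Y_t(v, x₁))λ = x₀⁻¹δ((x₁⁻¹ - z)/x₀) Y'_{P(z)}(v, x₁)λ`,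
an equality of the coefficients of `x₀^{-n-1} x₁^{-m-1}`.  On the left this coefficient is
`τ_{P(z)}(v ⊗ (t⁻¹ - z)ⁿ tᵐ)λ`. -/
def COMP (z : ℂ) (M₁ : MobiusModule 𝕍 W₁) (M₂ : MobiusModule 𝕍 W₂) :
    Submodule ℂ (Module.Dual ℂ (W₁ ⊗[ℂ] W₂)) where
  carrier := {lam |
    (∀ v : V, ∃ N : ℤ, ∀ n, N ≤ n → tauMode z M₁ M₂ v n lam = 0) ∧
    ∀ (v : V) (m n : ℤ),
      tauP z M₁ M₂
          (v ⊗ₜ[ℂ] (((RatFunc.X : RatFunc ℂ)⁻¹ - RatFunc.C z) ^ n * RatFunc.X ^ m)) lam =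
        ∑ᶠ i : ℕ, (((Ring.choose n i : ℤ) : ℂ) * (-z) ^ i) •
          tauMode z M₁ M₂ v (m - n + i) lam}
  zero_mem' := ⟨fun v => ⟨0, fun n _ => map_zero _⟩, fun v m n => by simp⟩
  add_mem' := by
    rintro x y ⟨hx, hx'⟩ ⟨hy, hy'⟩
    refine ⟨fun v => ?_, fun v m n => ?_⟩
    · obtain ⟨N, hN⟩ := hx v
      obtain ⟨N', hN'⟩ := hy v
      refine ⟨max N N', fun n hn => ?_⟩
      rw [map_add, hN n (le_trans (le_max_left _ _) hn), hN' n (le_trans (le_max_right _ _) hn),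
        add_zero]
    · have fin : ∀ u : Module.Dual ℂ (W₁ ⊗[ℂ] W₂),
          (∃ N : ℤ, ∀ n, N ≤ n → tauMode z M₁ M₂ v n u = 0) →
          (Function.support fun i : ℕ => (((Ring.choose n i : ℤ) : ℂ) * (-z) ^ i) •
            tauMode z M₁ M₂ v (m - n + i) u).Finite := by
        rintro u ⟨N, hN⟩
        refine (Set.finite_Iio (N - m + n).toNat).subset fun i hi => ?_
        by_contra hc
        rw [Set.mem_Iio, not_lt] at hc
        have := Int.self_le_toNat (N - m + n)
        refine hi ?_
        simp only
        rw [hN _ (by omega), smul_zero]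
      rw [map_add, hx', hy', ← finsum_add_distrib (fin x (hx v)) (fin y (hy v))]
      refine finsum_congr fun i => ?_
      rw [map_add, smul_add]
  smul_mem' := by
    rintro c x ⟨hx, hx'⟩
    refine ⟨fun v => ?_, fun v m n => ?_⟩
    · obtain ⟨N, hN⟩ := hx v
      exact ⟨N, fun n hn => by rw [map_smul, hN n hn, smul_zero]⟩
    · rw [map_smul, hx', smul_finsum]
      refine finsum_congr fun i => ?_
      rw [map_smul, smul_comm]

/-- The homogeneous subspace `(W₁ ⊗ W₂)^{(γ)}` of the tensor product grading. -/
def tensorGr (M₁ : MobiusModule 𝕍 W₁) (M₂ : MobiusModule 𝕍 W₂) (γ : G) :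
    Submodule ℂ (W₁ ⊗[ℂ] W₂) :=
  Submodule.span ℂ {t | ∃ β₁ β₂ : G, β₁ + β₂ = γ ∧
    ∃ w₁ ∈ M₁.gr β₁, ∃ w₂ ∈ M₂.gr β₂, t = w₁ ⊗ₜ[ℂ] w₂}

/-- `((W₁ ⊗ W₂)*)^{(β)}`: the functionals vanishing on `(W₁ ⊗ W₂)^{(γ)}` for all `γ ≠ -β`. -/
def dualGr (M₁ : MobiusModule 𝕍 W₁) (M₂ : MobiusModule 𝕍 W₂) (β : G) :
    Submodule ℂ (Module.Dual ℂ (W₁ ⊗[ℂ] W₂)) where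
  carrier := {lam | ∀ γ : G, γ ≠ -β → ∀ t ∈ tensorGr M₁ M₂ γ, lam t = 0}
  zero_mem' _ _ _ _ := rfl
  add_mem' hx hy γ hγ t ht := by rw [LinearMap.add_apply, hx γ hγ t ht, hy γ hγ t ht, add_zero]
  smul_mem' c x hx γ hγ t ht := by rw [LinearMap.smul_apply, hx γ hγ t ht, smul_zero]

theorem iSup_tensorGr (M₁ : MobiusModule 𝕍 W₁) (M₂ : MobiusModule 𝕍 W₂) :
    ⨆ γ, tensorGr M₁ M₂ γ = ⊤ := by
  rw [eq_top_iff]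
  rintro t -
  induction t using TensorProduct.induction_on with
  | zero => exact Submodule.zero_mem _
  | add x y hx hy => exact Submodule.add_mem _ hx hy
  | tmul w₁ w₂ =>
    have h₁ : w₁ ∈ ⨆ β, M₁.gr β := by rw [M₁.graded.span]; trivial
    have h₂ : w₂ ∈ ⨆ β, M₂.gr β := by rw [M₂.graded.span]; trivial
    induction h₁ using Submodule.iSup_induction' with
    | zero => rw [TensorProduct.zero_tmul]; exact Submodule.zero_mem _
    | add x y _ _ hx hy => rw [TensorProduct.add_tmul]; exact Submodule.add_mem _ hx hy
    | mem β₁ x hx =>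
      induction h₂ using Submodule.iSup_induction' with
      | zero => rw [TensorProduct.tmul_zero]; exact Submodule.zero_mem _
      | add x y _ _ hx hy => rw [TensorProduct.tmul_add]; exact Submodule.add_mem _ hx hy
      | mem β₂ y hy =>
        exact Submodule.mem_iSup_of_mem (β₁ + β₂)
          (Submodule.subset_span ⟨β₁, β₂, rfl, x, hx, y, hy, rfl⟩)

theorem iSupIndep_dualGr (M₁ : MobiusModule 𝕍 W₁) (M₂ : MobiusModule 𝕍 W₂) :
    iSupIndep (dualGr M₁ M₂) := by
  intro β
  rw [Submodule.disjoint_def]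
  intro lam h h'
  have hz : ∀ t ∈ tensorGr M₁ M₂ (-β), lam t = 0 := by
    intro t ht
    have hle : (⨆ (j) (_ : j ≠ β), dualGr M₁ M₂ j) ≤
        LinearMap.ker (Module.Dual.eval ℂ (W₁ ⊗[ℂ] W₂) t) := by
      refine iSup_le fun j => iSup_le fun hj μ hμ => ?_
      exact hμ (-β) (fun e => hj (neg_injective e).symm) t ht
    exact hle h'
  have hker : (⊤ : Submodule ℂ (W₁ ⊗[ℂ] W₂)) ≤ LinearMap.ker lam := by
    rw [← iSup_tensorGr M₁ M₂]
    refine iSup_le fun γ t ht => ?_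
    by_cases hγ : γ = -β
    · subst hγ; exact hz t ht
    · exact h γ hγ t ht
  exact LinearMap.ker_eq_top.mp (top_le_iff.mp hker)

/-- `((W₁ ⊗ W₂)*)_{[n]}^{(β)}`, for an operator `L0` playing the role of `L'_{P(z)}(0)`. -/
def genHomogeneous (M₁ : MobiusModule 𝕍 W₁) (M₂ : MobiusModule 𝕍 W₂)
    (L0 : Module.End ℂ (Module.Dual ℂ (W₁ ⊗[ℂ] W₂))) (p : ℂ × G) :
    Submodule ℂ (Module.Dual ℂ (W₁ ⊗[ℂ] W₂)) :=
  L0.maxGenEigenspace p.1 ⊓ dualGr M₁ M₂ p.2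

/-- `((W₁ ⊗ W₂)*)_{(n)}^{(β)}`, for an operator `L0` playing the role of `L'_{P(z)}(0)`. -/
def homogeneous (M₁ : MobiusModule 𝕍 W₁) (M₂ : MobiusModule 𝕍 W₂)
    (L0 : Module.End ℂ (Module.Dual ℂ (W₁ ⊗[ℂ] W₂))) (p : ℂ × G) :
    Submodule ℂ (Module.Dual ℂ (W₁ ⊗[ℂ] W₂)) :=
  L0.eigenspace p.1 ⊓ dualGr M₁ M₂ p.2

theorem iSupIndep_genHomogeneous (M₁ : MobiusModule 𝕍 W₁) (M₂ : MobiusModule 𝕍 W₂)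
    (L0 : Module.End ℂ (Module.Dual ℂ (W₁ ⊗[ℂ] W₂))) : iSupIndep (genHomogeneous M₁ M₂ L0) :=
  iSupIndep_inf L0.independent_maxGenEigenspace (iSupIndep_dualGr M₁ M₂)

theorem iSupIndep_homogeneous (M₁ : MobiusModule 𝕍 W₁) (M₂ : MobiusModule 𝕍 W₂)
    (L0 : Module.End ℂ (Module.Dual ℂ (W₁ ⊗[ℂ] W₂))) : iSupIndep (homogeneous M₁ M₂ L0) :=
  iSupIndep_inf L0.eigenspaces_iSupIndep (iSupIndep_dualGr M₁ M₂)

/-- The three operators `L'_{P(z)}(-1)`, `L'_{P(z)}(0)`, `L'_{P(z)}(1)` on a space. -/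
structure SlOps (D : Type*) [AddCommGroup D] [Module ℂ D] where
  Lm1 : Module.End ℂ D
  L0 : Module.End ℂ D
  L1 : Module.End ℂ D

/-- The operators `L'_{P(z)}(j)`, `j = -1, 0, 1`, in the Möbius case:
`(L'_{P(z)}(j)λ)(w₁ ⊗ w₂) = λ(w₁ ⊗ L(-j)w₂ + (∑_{i=0}^{1-j} (1-j choose i) zⁱ L(-j-i))w₁ ⊗ w₂)`. -/
def mobiusOps (z : ℂ) (M₁ : MobiusModule 𝕍 W₁) (M₂ : MobiusModule 𝕍 W₂) :
    SlOps (Module.Dual ℂ (W₁ ⊗[ℂ] W₂)) where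
  Lm1 := Module.Dual.transpose
    (LinearMap.lTensor W₁ M₂.sl2.L1 +
      LinearMap.rTensor W₂ (M₁.sl2.L1 + (2 * z) • M₁.sl2.L0 + (z ^ 2) • M₁.sl2.Lm1))
  L0 := Module.Dual.transpose
    (LinearMap.lTensor W₁ M₂.sl2.L0 + LinearMap.rTensor W₂ (M₁.sl2.L0 + z • M₁.sl2.Lm1))
  L1 := Module.Dual.transpose
    (LinearMap.lTensor W₁ M₂.sl2.Lm1 + LinearMap.rTensor W₂ M₁.sl2.Lm1)

/-- The operators `L'_{P(z)}(j)`, `j = -1, 0, 1`, in the conformal case: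
`Y'_{P(z)}(ω, x) = ∑ L'_{P(z)}(n) x^{-n-2}`, so that `L'_{P(z)}(j) = τ_{P(z)}(ω ⊗ t^{j+1})`. -/
def conformalOps {𝕌 : ConformalVertexAlgebra A V} (z : ℂ) (M₁ : ConformalModule 𝕌 W₁)
    (M₂ : ConformalModule 𝕌 W₂) : SlOps (Module.Dual ℂ (W₁ ⊗[ℂ] W₂)) where
  Lm1 := tauMode z M₁.toMobius M₂.toMobius 𝕌.ω 0
  L0 := tauMode z M₁.toMobius M₂.toMobius 𝕌.ω 1
  L1 := tauMode z M₁.toMobius M₂.toMobius 𝕌.ω 2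

/-- The operators under which `W_λ` has to be stable: all `τ_{P(z)}(v ⊗ tᵐ)` and the three
operators `L'_{P(z)}(j)`. -/
def pzOperators (z : ℂ) (M₁ : MobiusModule 𝕍 W₁) (M₂ : MobiusModule 𝕍 W₂)
    (L : SlOps (Module.Dual ℂ (W₁ ⊗[ℂ] W₂))) :
    Set (Module.End ℂ (Module.Dual ℂ (W₁ ⊗[ℂ] W₂))) :=
  {f | ∃ (v : V) (m : ℤ), f = tauMode z M₁ M₂ v m} ∪ {L.Lm1, L.L0, L.L1}

/-- `LGR_{[ℂ];P(z)}((W₁ ⊗ W₂)*)`: the elements satisfying the `P(z)`-local grading restriction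
condition. -/
def LGRgen (z : ℂ) (M₁ : MobiusModule 𝕍 W₁) (M₂ : MobiusModule 𝕍 W₂)
    (L : SlOps (Module.Dual ℂ (W₁ ⊗[ℂ] W₂))) : Submodule ℂ (Module.Dual ℂ (W₁ ⊗[ℂ] W₂)) :=
  lgr (genHomogeneous M₁ M₂ L.L0) (iSupIndep_genHomogeneous M₁ M₂ L.L0) (pzOperators z M₁ M₂ L)

/-- `LGR_{(ℂ);P(z)}((W₁ ⊗ W₂)*)`: the elements satisfying the `L(0)`-semisimple `P(z)`-local
grading restriction condition. -/
def LGRss (z : ℂ) (M₁ : MobiusModule 𝕍 W₁) (M₂ : MobiusModule 𝕍 W₂)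
    (L : SlOps (Module.Dual ℂ (W₁ ⊗[ℂ] W₂))) : Submodule ℂ (Module.Dual ℂ (W₁ ⊗[ℂ] W₂)) :=
  lgr (homogeneous M₁ M₂ L.L0) (iSupIndep_homogeneous M₁ M₂ L.L0) (pzOperators z M₁ M₂ L)

/-- Stability of a subspace of `(W₁ ⊗ W₂)*` under all the operators `τ_{P(z)}(v ⊗ tⁿ)`. -/
def TauStable (z : ℂ) (M₁ : MobiusModule 𝕍 W₁) (M₂ : MobiusModule 𝕍 W₂)
    (S : Submodule ℂ (Module.Dual ℂ (W₁ ⊗[ℂ] W₂))) : Prop :=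
  ∀ lam ∈ S, ∀ (v : V) (n : ℤ), tauMode z M₁ M₂ v n lam ∈ S

end Pz

/-- Stability of a subspace under `L'_{P(z)}(-1)`, `L'_{P(z)}(0)` and `L'_{P(z)}(1)`. -/
def SlOps.Stable {D : Type*} [AddCommGroup D] [Module ℂ D] (L : SlOps D) (S : Submodule ℂ D) :
    Prop :=
  ∀ lam ∈ S, L.Lm1 lam ∈ S ∧ L.L0 lam ∈ S ∧ L.L1 lam ∈ S

end

end PzTensor

open PzTensor

/-! Every operator in question is the transpose of some `S₁ ⊗ 1 + 1 ⊗ S₂` (`dualAction`). For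
`τ_{P(z)}(ξ)` the pair is `(oppTau z M₁ ξ, oppTau 0 M₂ ξ)`, and for `L'_{P(z)}(j)` it consists of
`L(-j)` shifted by `z` on `W₁` and by `0` on `W₂`. Both factors are therefore instances of one
situation with a translation parameter `c`, and everything follows from commutators computed there.

The central formula is `⁅τ(u ⊗ tᵐ), τ(v ⊗ f)⁆ = ∑ᵢ (m choose i) τ(uᵢv ⊗ t^{m-i} f)`
(`lie_tauMode_tauP`). It is the usual commutator formula because two signs cancel: opposite vertex
operators satisfy it with a minus sign (`lie_oppTau`), and transposition reverses commutators
(`lie_dualAction`). For `lie_oppTau`, the ordinary commutator is written as `∑ᵢ (uᵢv) ⊗ f^{(i)}/i! ·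
g`, which is compatible with translation. The descendants `L(1)^q(u_j v)` are expanded by
conjugating `u_j` with `exp(xL(1))` (`L1_pow_mode_apply`), and the coefficients are matched by
Chu–Vandermonde (`zchoose_sub`). The same bookkeeping gives the commutators of `L'_{P(z)}(j)` with
`τ_{P(z)}`, with `L(1)` and `L(-1)` exchanging roles.

Compatibility is preserved because each commutator with `τ(v ⊗ f)` is a finite sum of `τ(v' ⊗ tᵏf)`.
Multiplying `(t⁻¹ - z)ⁿ tᵐ` by `tᵏ` only changes `m`, so the required identity for `Oλ` is a
combination of identities known for `λ` (`COMP_stable_of_lie`).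

For the local grading restriction, `W_{Oλ} ⊆ W_λ` holds by minimality, so the finiteness conditions
pass to `Oλ`. What remains is that `Oλ` lies in the sum of the homogeneous subspaces
(`pzOperators_mem_iSup`). On doubly homogeneous `v` the operators are eigenvectors of `ad
L'_{P(z)}(0)` and have a definite `Ã`-degree, hence they map homogeneous subspaces to homogeneous
subspaces, for ordinary and generalized eigenspaces alike.

The conformal case reduces to the Möbius case: `L(1)ω = 0` gives `ωᵒ = ω ⊗ t²`, and expanding `(t +
z)^{1-j}` turns `τ_{P(z)}(ω ⊗ t^{j+1})` into the Möbius formula (`conformalOps_eq_mobiusOps`). -/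

open scoped TensorProduct

namespace PzTensor

noncomputable section

/-! ### Binomial coefficients with integral upper entry -/

section Binomial

/-- The binomial coefficient `(m choose i)`, `m ∈ ℤ`, as a complex number. -/
def zchoose (m : ℤ) (i : ℕ) : ℂ := ((Ring.choose m i : ℤ) : ℂ)

@[simp] theorem zchoose_zero (m : ℤ) : zchoose m 0 = 1 := by
  simp [zchoose]

@[simp] theorem zchoose_one (m : ℤ) : zchoose m 1 = m := by
  simp [zchoose]

theorem zchoose_zero_succ (i : ℕ) : zchoose 0 (i + 1) = 0 := by
  simp [zchoose]

theorem zchoose_succ_succ (m : ℤ) (i : ℕ) :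
    zchoose (m + 1) (i + 1) = zchoose m i + zchoose m (i + 1) := by
  simp [zchoose, Ring.choose_succ_succ]

/-- Comes from the recursion of falling factorials, after cancelling `i!` in `ℤ`. -/
theorem succ_mul_zchoose (m : ℤ) (i : ℕ) :
    ((i : ℂ) + 1) * zchoose m (i + 1) = (m - i) * zchoose m i := by
  have h1 := Ring.descPochhammer_eq_factorial_smul_choose m i
  have h2 := Ring.descPochhammer_eq_factorial_smul_choose m (i + 1)
  rw [descPochhammer_succ_right, Polynomial.smeval_mul, h1] at h2
  simp only [Polynomial.smeval_sub, Polynomial.smeval_X, Polynomial.smeval_natCast,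
    nsmul_eq_mul, pow_one, pow_zero, mul_one, Nat.factorial_succ] at h2
  have h3 : (i.factorial : ℤ) * ((m - i) * Ring.choose m i) =
      i.factorial * ((i + 1) * Ring.choose m (i + 1)) := by
    push_cast at h2
    linear_combination h2
  have h4 := mul_left_cancel₀ (by exact_mod_cast i.factorial_ne_zero) h3
  rw [zchoose, zchoose]
  exact_mod_cast h4.symm

/-- The recursion satisfied by the coefficients of a conjugation by `exp(x L(1))`. -/
theorem zchoose_recursion (a : ℂ) (x : ℤ) (r : ℕ) :
    a * zchoose (x + 1) (r + 1) + (x - a - r) * zchoose x r =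
      (a + (r + 1)) * zchoose x (r + 1) := by
  rw [zchoose_succ_succ]
  linear_combination (-1 : ℂ) * succ_mul_zchoose x r

/-- Chu–Vandermonde after upper negation: `n - k = -(k - n)` makes the left side a signed binomial
with upper entry `k + (i - 1 - n)`. Splitting it and negating the second factor back leaves only the
sign `(-1)^{p.1}`. -/
theorem zchoose_sub (n k : ℤ) (i : ℕ) :
    zchoose (n - k) i = ∑ p ∈ Finset.HasAntidiagonal.antidiagonal i,
      (-1 : ℂ) ^ p.1 * zchoose k p.1 * zchoose (n - p.1) p.2 := by
  have key : Ring.choose (n - k) i = ∑ p ∈ Finset.HasAntidiagonal.antidiagonal i,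
      (-1 : ℤ) ^ p.1 * Ring.choose k p.1 * Ring.choose (n - p.1) p.2 := by
    have h := Ring.add_choose_eq i (Commute.all k (i - 1 - n))
    have e : n - k = -(k - n) := by ring
    rw [e, Ring.choose_neg, show k - n + (i : ℤ) - 1 = k + (i - 1 - n) by ring, h,
      Finset.smul_sum]
    refine Finset.sum_congr rfl fun p hp => ?_
    rw [Finset.HasAntidiagonal.mem_antidiagonal] at hp
    have e2 : (i : ℤ) - 1 - n = -(n + 1 - i) := by ring
    rw [e2, Ring.choose_neg, show n + 1 - (i : ℤ) + p.2 - 1 = n - p.1 by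
      rw [← hp]; push_cast; ring]
    rw [← hp]
    simp only [Units.smul_def, Int.negOnePow, smul_eq_mul]
    simp only [zpow_natCast, Units.val_pow_eq_pow_val, Units.val_neg, Units.val_one]
    rw [pow_add]
    have : ((-1 : ℤ) ^ p.2) * (-1) ^ p.2 = 1 := by
      rw [← mul_pow]; simp
    linear_combination ((-1) ^ p.1 * Ring.choose k p.1 * Ring.choose (n - p.1) p.2) * this
  rw [zchoose, key]
  simp [zchoose]

end Binomial

/-! ### Linear functionals on Laurent series -/

section Laurent

variable {X : Type*} [AddCommGroup X] [Module ℂ X]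

/-- A linear map on `ℂ((t))` that kills all monomials and all series of sufficiently high order
vanishes. -/
theorem laurent_eq_zero_of_monomials (Φ : LaurentSeries ℂ →ₗ[ℂ] X)
    (htail : ∃ B : ℤ, ∀ f : LaurentSeries ℂ, (∀ n < B, f.coeff n = 0) → Φ f = 0)
    (hmon : ∀ n : ℤ, Φ (HahnSeries.single n 1) = 0) (f : LaurentSeries ℂ) : Φ f = 0 := by
  obtain ⟨B, hB⟩ := htail
  -- The Laurent polynomial part of `f` below degree `B`; the remainder falls under the tail
  -- hypothesis.
  set p : LaurentSeries ℂ :=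
    ∑ n ∈ Finset.Ico f.order B, f.coeff n • HahnSeries.single n (1 : ℂ) with hp
  have hΦp : Φ p = 0 := by
    rw [hp, map_sum]
    exact Finset.sum_eq_zero fun n _ => by rw [map_smul, hmon, smul_zero]
  have htl : Φ (f - p) = 0 := by
    refine hB _ fun n hn => ?_
    have hc : p.coeff n = ∑ k ∈ Finset.Ico f.order B, if n = k then f.coeff k else 0 := by
      rw [hp, HahnSeries.coeff_sum]
      refine Finset.sum_congr rfl fun k _ => ?_
      rw [HahnSeries.coeff_smul, HahnSeries.coeff_single]
      split_ifs <;> simp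
    rw [HahnSeries.coeff_sub, hc, Finset.sum_ite_eq]
    split_ifs with h
    · exact sub_self _
    · rw [sub_zero]
      refine HahnSeries.coeff_eq_zero_of_lt_order ?_
      by_contra hlt
      exact h (Finset.mem_Ico.mpr ⟨not_lt.mp hlt, hn⟩)
  rw [map_sub, hΦp, sub_zero] at htl
  exact htl

theorem laurent_coeff_mul_eq_zero {f g : LaurentSeries ℂ} {a b : ℤ}
    (hf : ∀ n < a, f.coeff n = 0) (hg : ∀ n < b, g.coeff n = 0) (n : ℤ) (hn : n < a + b) :
    (f * g).coeff n = 0 := by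
  rw [HahnSeries.coeff_mul]
  refine Finset.sum_eq_zero fun p hp => ?_
  rw [Finset.mem_antidiagonal] at hp
  by_cases h : p.1 < a
  · rw [hf _ h, zero_mul]
  · rw [hg p.2 (by have := hp.2.2; omega), mul_zero]

/-- The Leibniz rule for divided derivatives; a linear factor contributes only in orders `0` and
`1`. On coefficients it is Pascal's rule. -/
theorem hasseDeriv_X_add_C_mul (c : ℂ) (i : ℕ) (f : LaurentSeries ℂ) :
    LaurentSeries.hasseDeriv ℂ (i + 1)
        ((HahnSeries.single 1 1 + HahnSeries.C c) * f) =
      (HahnSeries.single 1 1 + HahnSeries.C c) * LaurentSeries.hasseDeriv ℂ (i + 1) f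
        + LaurentSeries.hasseDeriv ℂ i f := by
  ext n
  have hs : ∀ (g : LaurentSeries ℂ) (n : ℤ),
      ((HahnSeries.single 1 1 : LaurentSeries ℂ) * g).coeff n = g.coeff (n - 1) := by
    intro g n
    have := HahnSeries.coeff_single_mul_add (r := (1 : ℂ)) (x := g) (a := n - 1) (b := 1)
    rwa [sub_add_cancel, one_mul] at this
  have hC : ∀ (g : LaurentSeries ℂ) (n : ℤ),
      ((HahnSeries.C c : LaurentSeries ℂ) * g).coeff n = c * g.coeff n := by
    intro g n
    rw [HahnSeries.C_mul_eq_smul, HahnSeries.coeff_smul, smul_eq_mul]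
  simp only [add_mul, map_add, HahnSeries.coeff_add, hs, hC, LaurentSeries.hasseDeriv_coeff,
    zsmul_eq_mul]
  have h := Ring.choose_succ_succ (n + i) i
  have e1 : n + ((i + 1 : ℕ) : ℤ) - 1 = n + i := by push_cast; ring
  have e2 : n - 1 + ((i + 1 : ℕ) : ℤ) = n + i := by push_cast; ring
  have e3 : n + ((i + 1 : ℕ) : ℤ) = n + i + 1 := by push_cast; ring
  rw [e1, e2, e3, h]
  push_cast
  ring

theorem iotaPlus_X : iotaPlus RatFunc.X = HahnSeries.single 1 1 := by
  rw [← RatFunc.algebraMap_X, iotaPlus, RatFunc.liftRingHom_algebraMap]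
  simp [polyExpand]

theorem iotaPlus_C (c : ℂ) : iotaPlus (RatFunc.C c) = HahnSeries.C c := by
  rw [← RatFunc.algebraMap_C, iotaPlus, RatFunc.liftRingHom_algebraMap]
  simp [polyExpand]

theorem substitute_X (a : RatFunc ℂ) (ha : ¬∃ c, a = RatFunc.C c) :
    substitute a ha RatFunc.X = a := by
  rw [substitute, RatFunc.liftAlgHom_apply, RatFunc.num_X, RatFunc.denom_X]
  simp

theorem translate_X_zpow (c : ℂ) (n : ℤ) :
    translate c (RatFunc.X ^ n) = (RatFunc.X + RatFunc.C c) ^ n := by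
  rw [map_zpow₀, translate, substitute_X]

theorem invert_X_zpow (n : ℤ) : invert (RatFunc.X ^ n) = RatFunc.X ^ (-n) := by
  rw [map_zpow₀, invert, substitute_X, inv_zpow, zpow_neg]

theorem translate_zero (f : RatFunc ℂ) : translate 0 f = f := by
  rw [translate, substitute, RatFunc.liftAlgHom_apply]
  have h : ∀ p : Polynomial ℂ, Polynomial.aeval (RatFunc.X + RatFunc.C 0 : RatFunc ℂ) p =
      algebraMap (Polynomial ℂ) (RatFunc ℂ) p := by
    intro p
    rw [map_zero, add_zero, ← RatFunc.algebraMap_X, Polynomial.aeval_algebraMap_apply,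
      Polynomial.aeval_X_left_apply]
  rw [h, h, RatFunc.num_div_denom]

theorem X_add_C_ne_zero (c : ℂ) : (RatFunc.X + RatFunc.C c : RatFunc ℂ) ≠ 0 := fun h =>
  X_ne_C (-c) (by rw [map_neg]; exact eq_neg_of_add_eq_zero_left h)

/-- For negative `a` and `c ≠ 0` the expansion is an infinite series, so no coefficients are
compared. The Leibniz rule for multiplication by `t + c`, which is invertible, drives an induction
on `a` in both directions. -/
theorem hasseDeriv_zpow (c : ℂ) (a : ℤ) (i : ℕ) :
    LaurentSeries.hasseDeriv ℂ i (iotaPlus ((RatFunc.X + RatFunc.C c) ^ a)) =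
      HahnSeries.C (zchoose a i) * iotaPlus ((RatFunc.X + RatFunc.C c) ^ (a - i)) := by
  set y : LaurentSeries ℂ := iotaPlus (RatFunc.X + RatFunc.C c) with hy
  have hy' : y = HahnSeries.single 1 1 + HahnSeries.C c := by
    rw [hy, map_add, iotaPlus_X, iotaPlus_C]
  have hy0 : y ≠ 0 := (map_ne_zero iotaPlus).mpr (X_add_C_ne_zero c)
  have hstep : ∀ (i : ℕ) (f : LaurentSeries ℂ), LaurentSeries.hasseDeriv ℂ (i + 1) (y * f) =
      y * LaurentSeries.hasseDeriv ℂ (i + 1) f + LaurentSeries.hasseDeriv ℂ i f := by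
    intro i f
    rw [hy']
    exact hasseDeriv_X_add_C_mul c i f
  simp only [map_zpow₀, ← hy]
  have hmul : ∀ b : ℤ, y * y ^ b = y ^ (b + 1) := fun b => by
    rw [zpow_add_one₀ hy0, mul_comm]
  induction a using Int.induction_on generalizing i with
  | zero =>
    cases i with
    | zero => simp
    | succ i =>
      rw [zpow_zero, zchoose_zero_succ, map_zero, zero_mul]
      have : (1 : LaurentSeries ℂ) = HahnSeries.single 0 1 := rfl
      rw [this, LaurentSeries.hasseDeriv_single]
      simp
  | succ n ih =>
    cases i with
    | zero => simp
    | succ i =>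
      rw [← hmul, hstep, ih, ih, zchoose_succ_succ, mul_left_comm, hmul, map_add, add_mul, add_comm]
      congr 3 <;> push_cast <;> ring
  | pred n ih =>
    induction i with
    | zero => simp
    | succ i ihi =>
      -- Going down, the Leibniz rule is solved for the derivative of the lower power: it appears
      -- multiplied by `y`, which can be cancelled.
      have h := hstep i (y ^ (-(n : ℤ) - 1))
      rw [hmul, sub_add_cancel, ih, ihi] at h
      refine mul_left_cancel₀ hy0 ?_
      rw [mul_left_comm, hmul]
      have hp := zchoose_succ_succ (-(n : ℤ) - 1) i
      rw [sub_add_cancel] at hp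
      rw [hp, map_add, add_mul] at h
      have e1 : -(n : ℤ) - ((i + 1 : ℕ) : ℤ) = -(n : ℤ) - 1 - i := by push_cast; ring
      have e2 : -(n : ℤ) - 1 - ((i + 1 : ℕ) : ℤ) + 1 = -(n : ℤ) - 1 - i := by push_cast; ring
      rw [e1, add_comm] at h
      rw [e2]
      exact (add_right_cancel h).symm

end Laurent

/-! ### The action of `V ⊗ ℂ((t))` on a module -/

section LaurentAction

variable {V W : Type*} [AddCommGroup V] [Module ℂ V] [AddCommGroup W] [Module ℂ W]

theorem laurentTau_support {Y : VertexMap V W} (hY : LowerTruncated Y) (v : V)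
    (f : LaurentSeries ℂ) (w : W) :
    (Function.support fun n : ℤ => f.coeff n • Y v n w).Finite := by
  obtain ⟨N, hN⟩ := hY v w
  refine (Set.finite_Ico f.order N).subset fun n hn => ?_
  rw [Function.mem_support] at hn
  refine ⟨?_, ?_⟩
  · by_contra h
    exact hn (by rw [HahnSeries.coeff_eq_zero_of_lt_order (not_le.mp h), zero_smul])
  · by_contra h
    exact hn (by rw [hN n (not_lt.mp h), smul_zero])

/-- The operator `∑ aₙvₙ` attached to `v ⊗ ∑ aₙtⁿ`. -/
def laurentTau (Y : VertexMap V W) (hY : LowerTruncated Y) (v : V) :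
    LaurentSeries ℂ →ₗ[ℂ] Module.End ℂ W where
  toFun f :=
    { toFun := fun w => ∑ᶠ n : ℤ, f.coeff n • Y v n w
      map_add' := fun w w' => by
        rw [← finsum_add_distrib (laurentTau_support hY v f w) (laurentTau_support hY v f w')]
        simp only [map_add, smul_add]
      map_smul' := fun c w => by
        rw [RingHom.id_apply, smul_finsum]
        refine finsum_congr fun n => ?_
        rw [map_smul, smul_comm] }
  map_add' f f' := by
    ext w
    simp only [LinearMap.coe_mk, AddHom.coe_mk, LinearMap.add_apply]
    rw [← finsum_add_distrib (laurentTau_support hY v f w) (laurentTau_support hY v f' w)]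
    simp only [HahnSeries.coeff_add, add_smul]
  map_smul' c f := by
    ext w
    simp only [LinearMap.coe_mk, AddHom.coe_mk, LinearMap.smul_apply, RingHom.id_apply]
    rw [smul_finsum]
    refine finsum_congr fun n => ?_
    rw [HahnSeries.coeff_smul, smul_assoc]

theorem laurentTau_apply (Y : VertexMap V W) (hY : LowerTruncated Y) (v : V)
    (f : LaurentSeries ℂ) (w : W) :
    laurentTau Y hY v f w = ∑ᶠ n : ℤ, f.coeff n • Y v n w := rfl

theorem tauW_tmul (Y : VertexMap V W) (hY : LowerTruncated Y) (v : V) (f : RatFunc ℂ) :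
    tauW Y hY (v ⊗ₜ[ℂ] f) = laurentTau Y hY v (iotaPlus f) := rfl

theorem laurentTau_single (Y : VertexMap V W) (hY : LowerTruncated Y) (v : V) (n : ℤ) :
    laurentTau Y hY v (HahnSeries.single n 1) = Y v n := by
  ext w
  rw [laurentTau_apply, finsum_eq_single _ n]
  · simp
  · intro m hm
    rw [HahnSeries.coeff_single_of_ne hm, zero_smul]

theorem laurentTau_tail (Y : VertexMap V W) (hY : LowerTruncated Y) (v : V) (w : W) :
    ∃ N : ℤ, ∀ f : LaurentSeries ℂ, (∀ n < N, f.coeff n = 0) → laurentTau Y hY v f w = 0 := by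
  obtain ⟨N, hN⟩ := hY v w
  refine ⟨N, fun f hf => ?_⟩
  rw [laurentTau_apply]
  refine finsum_eq_zero_of_forall_eq_zero fun n => ?_
  by_cases h : n < N
  · rw [hf n h, zero_smul]
  · rw [hN n (not_lt.mp h), smul_zero]

theorem smul_laurent_mul (c : ℂ) (f g : LaurentSeries ℂ) : (c • f) * g = c • (f * g) := by
  rw [← HahnSeries.C_mul_eq_smul, ← HahnSeries.C_mul_eq_smul, mul_assoc]

theorem laurent_mul_smul (c : ℂ) (f g : LaurentSeries ℂ) : f * (c • g) = c • (f * g) := by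
  rw [mul_comm, smul_laurent_mul, mul_comm]

/-- Multiplication of Laurent series as a linear map in the right factor. -/
def laurentMul (f : LaurentSeries ℂ) : LaurentSeries ℂ →ₗ[ℂ] LaurentSeries ℂ where
  toFun g := f * g
  map_add' := mul_add f
  map_smul' c g := laurent_mul_smul c f g

theorem laurentMul_apply (f g : LaurentSeries ℂ) : laurentMul f g = f * g := rfl

theorem laurent_coeff_of_lt_order (f : LaurentSeries ℂ) : ∀ n < f.order, f.coeff n = 0 :=
  fun _ hn => HahnSeries.coeff_eq_zero_of_lt_order hn

/-- Two linear maps from `ℂ((t))` to operators that agree on monomials and both kill, on each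
vector, the series of high order, are equal. -/
theorem laurent_ext {Φ Ψ : LaurentSeries ℂ →ₗ[ℂ] Module.End ℂ W}
    (hΦ : ∀ w, ∃ B : ℤ, ∀ f : LaurentSeries ℂ, (∀ n < B, f.coeff n = 0) → Φ f w = 0)
    (hΨ : ∀ w, ∃ B : ℤ, ∀ f : LaurentSeries ℂ, (∀ n < B, f.coeff n = 0) → Ψ f w = 0)
    (h : ∀ n : ℤ, Φ (HahnSeries.single n 1) = Ψ (HahnSeries.single n 1)) : Φ = Ψ := by
  refine LinearMap.ext fun f => LinearMap.ext fun w => sub_eq_zero.mp ?_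
  refine laurent_eq_zero_of_monomials ((LinearMap.applyₗ w).comp (Φ - Ψ)) ?_ (fun n => ?_) f
  · obtain ⟨B, hB⟩ := hΦ w
    obtain ⟨B', hB'⟩ := hΨ w
    refine ⟨max B B', fun f hf => ?_⟩
    simp [hB f fun n hn => hf n (lt_max_of_lt_left hn), hB' f fun n hn =>
      hf n (lt_max_of_lt_right hn)]
  · simp [h n]

/-- `Φ` kills, on each vector, the series of high order. -/
def IsContinuousAction (Φ : LaurentSeries ℂ →ₗ[ℂ] Module.End ℂ W) : Prop :=
  ∀ w, ∃ B : ℤ, ∀ f : LaurentSeries ℂ, (∀ n < B, f.coeff n = 0) → Φ f w = 0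

theorem IsContinuousAction.add {Φ Ψ : LaurentSeries ℂ →ₗ[ℂ] Module.End ℂ W}
    (hΦ : IsContinuousAction Φ) (hΨ : IsContinuousAction Ψ) : IsContinuousAction (Φ + Ψ) := by
  intro w
  obtain ⟨B, hB⟩ := hΦ w
  obtain ⟨B', hB'⟩ := hΨ w
  refine ⟨max B B', fun f hf => ?_⟩
  simp [hB f fun n hn => hf n (lt_max_of_lt_left hn), hB' f fun n hn =>
    hf n (lt_max_of_lt_right hn)]

theorem IsContinuousAction.smul {Φ : LaurentSeries ℂ →ₗ[ℂ] Module.End ℂ W}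
    (hΦ : IsContinuousAction Φ) (c : ℂ) : IsContinuousAction (c • Φ) := by
  intro w
  obtain ⟨B, hB⟩ := hΦ w
  exact ⟨B, fun f hf => by simp [hB f hf]⟩

theorem IsContinuousAction.sum {ι : Type*} (s : Finset ι)
    {Φ : ι → LaurentSeries ℂ →ₗ[ℂ] Module.End ℂ W} (hΦ : ∀ i ∈ s, IsContinuousAction (Φ i)) :
    IsContinuousAction (∑ i ∈ s, Φ i) := by
  classical
  induction s using Finset.induction_on with
  | empty => exact fun w => ⟨0, fun f _ => by simp⟩
  | insert a s ha ih =>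
    rw [Finset.sum_insert ha]
    exact (hΦ a (Finset.mem_insert_self a s)).add
      (ih fun i hi => hΦ i (Finset.mem_insert_of_mem hi))

theorem isContinuousAction_laurentTau (Y : VertexMap V W) (hY : LowerTruncated Y) (v : V) :
    IsContinuousAction (laurentTau Y hY v) := laurentTau_tail Y hY v

/-- Precomposition with an operator shifting orders by a bounded amount. -/
theorem IsContinuousAction.comp {Φ : LaurentSeries ℂ →ₗ[ℂ] Module.End ℂ W}
    (hΦ : IsContinuousAction Φ) {S : LaurentSeries ℂ →ₗ[ℂ] LaurentSeries ℂ}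
    (hS : ∃ k : ℤ, ∀ (B : ℤ) (f : LaurentSeries ℂ), (∀ n < B, f.coeff n = 0) →
      ∀ n < B + k, (S f).coeff n = 0) : IsContinuousAction (Φ ∘ₗ S) := by
  intro w
  obtain ⟨B, hB⟩ := hΦ w
  obtain ⟨k, hk⟩ := hS
  refine ⟨B - k, fun f hf => hB _ fun n hn => hk _ f hf n ?_⟩
  rwa [sub_add_cancel]

theorem laurentMul_shift (f : LaurentSeries ℂ) :
    ∃ k : ℤ, ∀ (B : ℤ) (g : LaurentSeries ℂ), (∀ n < B, g.coeff n = 0) →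
      ∀ n < B + k, (laurentMul f g).coeff n = 0 :=
  ⟨f.order, fun _ _ hg n hn =>
    laurent_coeff_mul_eq_zero (laurent_coeff_of_lt_order f) hg n (by rwa [add_comm])⟩

theorem hasseDeriv_shift (i : ℕ) :
    ∃ k : ℤ, ∀ (B : ℤ) (g : LaurentSeries ℂ), (∀ n < B, g.coeff n = 0) →
      ∀ n < B + k, (LaurentSeries.hasseDeriv ℂ i g).coeff n = 0 :=
  ⟨-i, fun _ _ hg n hn => by
    rw [LaurentSeries.hasseDeriv_coeff, hg _ (by omega), smul_zero]⟩

theorem IsContinuousAction.lie_left {Φ : LaurentSeries ℂ →ₗ[ℂ] Module.End ℂ W}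
    (hΦ : IsContinuousAction Φ) (T : Module.End ℂ W) :
    IsContinuousAction (LinearMap.mulLeft ℂ T ∘ₗ Φ - LinearMap.mulRight ℂ T ∘ₗ Φ) := by
  intro w
  obtain ⟨B, hB⟩ := hΦ w
  obtain ⟨B', hB'⟩ := hΦ (T w)
  refine ⟨max B B', fun f hf => ?_⟩
  simp [hB f fun n hn => hf n (lt_max_of_lt_left hn), hB' f fun n hn =>
    hf n (lt_max_of_lt_right hn)]

/-- A formula for `⁅T, Φ(f)⁆` may be checked on monomials. -/
theorem lie_laurent_ext {Φ Ψ : LaurentSeries ℂ →ₗ[ℂ] Module.End ℂ W} {T : Module.End ℂ W}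
    (hΦ : IsContinuousAction Φ) (hΨ : IsContinuousAction Ψ)
    (h : ∀ n : ℤ, ⁅T, Φ (HahnSeries.single n 1)⁆ = Ψ (HahnSeries.single n 1))
    (f : LaurentSeries ℂ) : ⁅T, Φ f⁆ = Ψ f := by
  have := laurent_ext (hΦ.lie_left T) hΨ (fun n => by
    rw [← h n, Ring.lie_def]; rfl)
  rw [← this, Ring.lie_def]
  rfl

/-- The case `l = 0` of the Jacobi identity. For negative `m` the binomials do not terminate, so
finiteness comes from the truncation bound `I`. -/
theorem lie_mode_mode {Y : VertexMap V V} {YW : VertexMap V W} (hJ : JacobiIdentity Y YW)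
    (u v : V) (I : ℕ) (hI : ∀ i : ℕ, I ≤ i → Y u i v = 0) (m n : ℤ) :
    ⁅YW u m, YW v n⁆ = ∑ i ∈ Finset.range I, zchoose m i • YW (Y u i v) (m + n - i) := by
  ext w
  have key := hJ u v w 0 m n
  have e1 : ∀ (a b : ℤ) (p q : V), (∑ᶠ i : ℕ, ((-1 : ℂ) ^ i * (Ring.choose (0 : ℤ) i : ℤ)) •
      YW p (a + 0 - i) (YW q (b + i) w)) = YW p a (YW q b w) := by
    intro a b p q
    rw [finsum_eq_single _ 0]
    · simp
    · intro i hi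
      rw [Ring.choose_zero_pos ℤ (Nat.pos_of_ne_zero hi)]; simp
  rw [e1, e1, finsum_eq_sum_of_support_subset (s := Finset.range I)] at key
  · simp only [zero_add, zpow_zero, one_smul] at key
    simpa [Ring.lie_def, LinearMap.sum_apply, zchoose] using key
  · intro i hi
    by_contra hc
    simp only [Finset.coe_range, Set.mem_Iio, not_lt] at hc
    exact hi (by simp [hI i hc])

theorem end_lie_skew (S T : Module.End ℂ W) : ⁅S, T⁆ = -⁅T, S⁆ := by
  rw [Ring.lie_def, Ring.lie_def, neg_sub]

/-- On monomials, `(m choose i) t^{m-i}` is the `i`-th divided derivative of `tᵐ`. Continuity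
extends the formula first in `g` with `f` a monomial, then in `f`. This derivative form is the one
that survives translation of `t`. -/
theorem lie_laurentTau {Y : VertexMap V V} {YW : VertexMap V W} (hJ : JacobiIdentity Y YW)
    (hY : LowerTruncated YW) (u v : V) (I : ℕ) (hI : ∀ i : ℕ, I ≤ i → Y u i v = 0)
    (f g : LaurentSeries ℂ) :
    ⁅laurentTau YW hY u f, laurentTau YW hY v g⁆ = ∑ i ∈ Finset.range I,
      laurentTau YW hY (Y u i v) (LaurentSeries.hasseDeriv ℂ i f * g) := by
  have hmon : ∀ (m : ℤ) (g : LaurentSeries ℂ),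
      ⁅laurentTau YW hY u (HahnSeries.single m 1), laurentTau YW hY v g⁆ =
        (∑ i ∈ Finset.range I, laurentTau YW hY (Y u i v) ∘ₗ
          laurentMul (LaurentSeries.hasseDeriv ℂ i (HahnSeries.single m 1))) g := by
    intro m g
    refine lie_laurent_ext (isContinuousAction_laurentTau YW hY v)
      (IsContinuousAction.sum _ fun i _ =>
        (isContinuousAction_laurentTau YW hY _).comp (laurentMul_shift _)) (fun n => ?_) g
    rw [laurentTau_single, laurentTau_single, lie_mode_mode hJ u v I hI, LinearMap.sum_apply]
    refine Finset.sum_congr rfl fun i _ => ?_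
    rw [LinearMap.comp_apply, laurentMul_apply, LaurentSeries.hasseDeriv_single,
      HahnSeries.single_mul_single, ← laurentTau_single YW hY, ← map_smul,
      ← HahnSeries.C_mul_eq_smul, HahnSeries.C_apply, HahnSeries.single_mul_single]
    rw [show 0 + (m + n - (i : ℤ)) = m - i + n by ring, mul_one, mul_one, zsmul_one, zchoose]
  rw [end_lie_skew, neg_eq_iff_eq_neg, ← Finset.sum_neg_distrib]
  have hfin := lie_laurent_ext (T := laurentTau YW hY v g)
    (isContinuousAction_laurentTau YW hY u)
    (Ψ := (-1 : ℂ) • ∑ i ∈ Finset.range I, laurentTau YW hY (Y u i v) ∘ₗ laurentMul g ∘ₗ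
      LaurentSeries.hasseDeriv ℂ i)
    (IsContinuousAction.smul (IsContinuousAction.sum _ fun i _ => by
        rw [← LinearMap.comp_assoc]
        exact ((isContinuousAction_laurentTau YW hY _).comp (laurentMul_shift _)).comp
          (hasseDeriv_shift i)) _) (fun n => ?_) f
  · rw [hfin]
    simp [laurentMul_apply, mul_comm g]
  · rw [end_lie_skew, hmon]
    simp [laurentMul_apply, mul_comm g]

variable {ρV : Sl2Rep V} {ρW : Sl2Rep W} {Y : VertexMap V W}

theorem lie_Lm1_laurentTau (hc : Sl2Covariant ρV ρW Y) (hY : LowerTruncated Y) (v : V)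
    (f : LaurentSeries ℂ) : ⁅ρW.Lm1, laurentTau Y hY v f⁆ = laurentTau Y hY (ρV.Lm1 v) f :=
  lie_laurent_ext (isContinuousAction_laurentTau Y hY v) (isContinuousAction_laurentTau Y hY _)
    (fun n => by rw [laurentTau_single, laurentTau_single, (hc v n).1]) f

theorem lie_L0_laurentTau (hc : Sl2Covariant ρV ρW Y) (hY : LowerTruncated Y) (v : V)
    (f : LaurentSeries ℂ) : ⁅ρW.L0, laurentTau Y hY v f⁆ =
      laurentTau Y hY (ρV.L0 v) f + laurentTau Y hY (ρV.Lm1 v) (HahnSeries.single 1 1 * f) :=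
  lie_laurent_ext (Ψ := laurentTau Y hY (ρV.L0 v) + laurentTau Y hY (ρV.Lm1 v) ∘ₗ
      laurentMul (HahnSeries.single 1 1)) (isContinuousAction_laurentTau Y hY v)
    ((isContinuousAction_laurentTau Y hY _).add
      ((isContinuousAction_laurentTau Y hY _).comp (laurentMul_shift _)))
    (fun n => by
      rw [LinearMap.add_apply, LinearMap.comp_apply, laurentMul_apply,
        HahnSeries.single_mul_single, mul_one, laurentTau_single, laurentTau_single,
        laurentTau_single, (hc v n).2.1, add_comm 1 n]) f

theorem lie_L1_laurentTau (hc : Sl2Covariant ρV ρW Y) (hY : LowerTruncated Y) (v : V)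
    (f : LaurentSeries ℂ) : ⁅ρW.L1, laurentTau Y hY v f⁆ =
      laurentTau Y hY (ρV.L1 v) f +
        (2 : ℂ) • laurentTau Y hY (ρV.L0 v) (HahnSeries.single 1 1 * f) +
        laurentTau Y hY (ρV.Lm1 v) (HahnSeries.single 1 1 * (HahnSeries.single 1 1 * f)) :=
  lie_laurent_ext (Ψ := laurentTau Y hY (ρV.L1 v) + (2 : ℂ) • (laurentTau Y hY (ρV.L0 v) ∘ₗ
      laurentMul (HahnSeries.single 1 1)) + (laurentTau Y hY (ρV.Lm1 v) ∘ₗ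
      laurentMul (HahnSeries.single 1 1)) ∘ₗ laurentMul (HahnSeries.single 1 1))
    (isContinuousAction_laurentTau Y hY v)
    (((isContinuousAction_laurentTau Y hY _).add
      (((isContinuousAction_laurentTau Y hY _).comp (laurentMul_shift _)).smul _)).add
      (((isContinuousAction_laurentTau Y hY _).comp (laurentMul_shift _)).comp
        (laurentMul_shift _)))
    (fun n => by
      simp only [LinearMap.add_apply, LinearMap.smul_apply, LinearMap.comp_apply,
        laurentMul_apply, HahnSeries.single_mul_single, mul_one, laurentTau_single]
      rw [(hc v n).2.2, show (1 : ℤ) + (1 + n) = n + 2 by ring, add_comm 1 n]) f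

/-- Integration by parts under the residue pairing of `Y(v, t)` with `f`. -/
theorem laurentTau_derivative {D : Module.End ℂ V} (hD : DerivativeProperty D Y)
    (hY : LowerTruncated Y) (v : V) (f : LaurentSeries ℂ) :
    laurentTau Y hY (D v) f = -laurentTau Y hY v (LaurentSeries.hasseDeriv ℂ 1 f) := by
  have := laurent_ext (isContinuousAction_laurentTau Y hY (D v))
    (((isContinuousAction_laurentTau Y hY v).comp (hasseDeriv_shift 1)).smul (-1)) (fun n => by
      rw [laurentTau_single, hD, LinearMap.smul_apply, LinearMap.comp_apply,
        LaurentSeries.hasseDeriv_single, Ring.choose_one_right, neg_smul, neg_one_smul,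
        ← laurentTau_single Y hY, ← map_smul, ← HahnSeries.C_mul_eq_smul, HahnSeries.C_apply,
        HahnSeries.single_mul_single]
      simp)
  rw [this]
  simp

end LaurentAction

/-! ### The action shifted by a translation -/

section Shift

variable {V W : Type*} [AddCommGroup V] [Module ℂ V] [AddCommGroup W] [Module ℂ W]

/-- The operators `∑ᵢ (j+1 choose i) cⁱ L(j-i)`, `j = -1, 0, 1`. -/
def Sl2Rep.shift (ρ : Sl2Rep W) (c : ℂ) : Sl2Rep W where
  Lm1 := ρ.Lm1
  L0 := ρ.L0 + c • ρ.Lm1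
  L1 := ρ.L1 + (2 * c) • ρ.L0 + (c ^ 2) • ρ.Lm1
  -- Formally the shifted triple is `exp(-cL(-1)) L(j) exp(cL(-1))`, so the brackets must persist;
  -- they are verified by expansion.
  bracket_L0_Lm1 := by
    have h1 := ρ.bracket_L0_Lm1
    rw [Ring.lie_def] at h1 ⊢
    simp only [mul_add, add_mul, smul_mul_assoc, mul_smul_comm]
    linear_combination (norm := module) h1
  bracket_L0_L1 := by
    have h1 := ρ.bracket_L0_Lm1
    have h2 := ρ.bracket_L0_L1
    have h3 := ρ.bracket_Lm1_L1
    rw [Ring.lie_def] at h1 h2 h3 ⊢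
    simp only [mul_add, add_mul, smul_mul_assoc, mul_smul_comm]
    linear_combination (norm := module) h2 + c • h3 - (c ^ 2) • h1
  bracket_Lm1_L1 := by
    have h1 := ρ.bracket_L0_Lm1
    have h3 := ρ.bracket_Lm1_L1
    rw [Ring.lie_def] at h1 h3 ⊢
    simp only [mul_add, add_mul, smul_mul_assoc, mul_smul_comm]
    linear_combination (norm := module) h3 - (2 * c) • h1

/-- `v ⊗ f(t) ↦ τ_W(v ⊗ ι₊f(t + c))`. -/
def shiftedTau (c : ℂ) (Y : VertexMap V W) (hY : LowerTruncated Y) :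
    V ⊗[ℂ] RatFunc ℂ →ₗ[ℂ] Module.End ℂ W :=
  tauW Y hY ∘ₗ LinearMap.lTensor V (translate c).toLinearMap

theorem shiftedTau_tmul (c : ℂ) (Y : VertexMap V W) (hY : LowerTruncated Y) (v : V)
    (f : RatFunc ℂ) :
    shiftedTau c Y hY (v ⊗ₜ[ℂ] f) = laurentTau Y hY v (iotaPlus (translate c f)) := rfl

theorem shiftedTau_zero (Y : VertexMap V W) (hY : LowerTruncated Y) :
    shiftedTau 0 Y hY = tauW Y hY := by
  refine TensorProduct.ext' fun v f => ?_
  rw [shiftedTau_tmul, translate_zero, tauW_tmul]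

/-- Translation commutes with differentiation, so the formula does not depend on `c`: the divided
derivatives of `(t + c)^a` are again translates of multiples of `t^{a-i}`. -/
theorem lie_shiftedTau {Y : VertexMap V V} {YW : VertexMap V W} (hJ : JacobiIdentity Y YW)
    (hY : LowerTruncated YW) (c : ℂ) (u v : V) (I : ℕ) (hI : ∀ i : ℕ, I ≤ i → Y u i v = 0)
    (a : ℤ) (g : RatFunc ℂ) :
    ⁅shiftedTau c YW hY (u ⊗ₜ[ℂ] (RatFunc.X ^ a)), shiftedTau c YW hY (v ⊗ₜ[ℂ] g)⁆ =
      ∑ i ∈ Finset.range I, zchoose a i •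
        shiftedTau c YW hY (Y u i v ⊗ₜ[ℂ] (RatFunc.X ^ (a - i) * g)) := by
  rw [shiftedTau_tmul, shiftedTau_tmul, lie_laurentTau hJ hY u v I hI]
  refine Finset.sum_congr rfl fun i _ => ?_
  rw [translate_X_zpow, hasseDeriv_zpow, mul_assoc, HahnSeries.C_mul_eq_smul, map_smul,
    shiftedTau_tmul, map_mul (translate c), map_mul iotaPlus, translate_X_zpow]

variable {ρV : Sl2Rep V} {ρW : Sl2Rep W} {Y : VertexMap V W}

theorem iotaPlus_translate_X_mul (c : ℂ) (f : RatFunc ℂ) :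
    iotaPlus (translate c (RatFunc.X * f)) =
      HahnSeries.single 1 1 * iotaPlus (translate c f) + c • iotaPlus (translate c f) := by
  have := translate_X_zpow c 1
  rw [zpow_one, zpow_one] at this
  rw [map_mul, this, map_mul, map_add, iotaPlus_X, iotaPlus_C, add_mul,
    HahnSeries.C_mul_eq_smul]

theorem lie_Lm1_shiftedTau (hc : Sl2Covariant ρV ρW Y) (hY : LowerTruncated Y) (c : ℂ) (v : V)
    (f : RatFunc ℂ) : ⁅(ρW.shift c).Lm1, shiftedTau c Y hY (v ⊗ₜ[ℂ] f)⁆ =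
      shiftedTau c Y hY (ρV.Lm1 v ⊗ₜ[ℂ] f) :=
  lie_Lm1_laurentTau hc hY v _

/-- Multiplication by `t` becomes multiplication by `t + c` after translation, and the extra `c` is
exactly what the term `cL(-1)` of the shifted `L(0)` contributes. -/
theorem lie_L0_shiftedTau (hc : Sl2Covariant ρV ρW Y) (hY : LowerTruncated Y) (c : ℂ) (v : V)
    (f : RatFunc ℂ) : ⁅(ρW.shift c).L0, shiftedTau c Y hY (v ⊗ₜ[ℂ] f)⁆ =
      shiftedTau c Y hY (ρV.L0 v ⊗ₜ[ℂ] f) +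
        shiftedTau c Y hY (ρV.Lm1 v ⊗ₜ[ℂ] (RatFunc.X * f)) := by
  simp only [shiftedTau_tmul, iotaPlus_translate_X_mul]
  have h0 := lie_L0_laurentTau hc hY v (iotaPlus (translate c f))
  have hm := lie_Lm1_laurentTau hc hY v (iotaPlus (translate c f))
  rw [Ring.lie_def] at h0 hm ⊢
  simp only [Sl2Rep.shift, map_add, map_smul, add_mul, mul_add, smul_mul_assoc, mul_smul_comm]
  linear_combination (norm := module) h0 + c • hm

theorem lie_L1_shiftedTau (hc : Sl2Covariant ρV ρW Y) (hY : LowerTruncated Y) (c : ℂ) (v : V)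
    (f : RatFunc ℂ) : ⁅(ρW.shift c).L1, shiftedTau c Y hY (v ⊗ₜ[ℂ] f)⁆ =
      shiftedTau c Y hY (ρV.L1 v ⊗ₜ[ℂ] f) +
        (2 : ℂ) • shiftedTau c Y hY (ρV.L0 v ⊗ₜ[ℂ] (RatFunc.X * f)) +
        shiftedTau c Y hY (ρV.Lm1 v ⊗ₜ[ℂ] (RatFunc.X * (RatFunc.X * f))) := by
  simp only [shiftedTau_tmul, iotaPlus_translate_X_mul]
  have h0 := lie_L0_laurentTau hc hY v (iotaPlus (translate c f))
  have hm := lie_Lm1_laurentTau hc hY v (iotaPlus (translate c f))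
  have h1 := lie_L1_laurentTau hc hY v (iotaPlus (translate c f))
  rw [Ring.lie_def] at h0 hm h1 ⊢
  simp only [Sl2Rep.shift, map_add, map_smul, add_mul, mul_add, smul_mul_assoc, mul_smul_comm,
    laurent_mul_smul]
  linear_combination (norm := module) h1 + (2 * c) • h0 + (c ^ 2) • hm

theorem shiftedTau_Lm1_zpow {D : Module.End ℂ V} (hD : DerivativeProperty D Y)
    (hY : LowerTruncated Y) (c : ℂ) (v : V) (a : ℤ) :
    shiftedTau c Y hY (D v ⊗ₜ[ℂ] (RatFunc.X ^ a)) =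
      (-(a : ℂ)) • shiftedTau c Y hY (v ⊗ₜ[ℂ] (RatFunc.X ^ (a - 1))) := by
  rw [shiftedTau_tmul, laurentTau_derivative hD, translate_X_zpow, hasseDeriv_zpow,
    HahnSeries.C_mul_eq_smul, map_smul, shiftedTau_tmul, translate_X_zpow, zchoose_one, neg_smul]
  simp

/-- The `L(-1)`-term of the covariance formula is integrated by parts, which leaves a scalar. -/
theorem lie_L0_shiftedTau_zpow (hc : Sl2Covariant ρV ρW Y) (hD : DerivativeProperty ρV.Lm1 Y)
    (hY : LowerTruncated Y) (c : ℂ) {v : V} {h : ℂ} (hv : ρV.L0 v = h • v) (a : ℤ) :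
    ⁅(ρW.shift c).L0, shiftedTau c Y hY (v ⊗ₜ[ℂ] (RatFunc.X ^ a))⁆ =
      (h - a - 1) • shiftedTau c Y hY (v ⊗ₜ[ℂ] (RatFunc.X ^ a)) := by
  rw [lie_L0_shiftedTau hc, ← zpow_one_add₀ RatFunc.X_ne_zero, shiftedTau_Lm1_zpow hD, hv,
    ← TensorProduct.smul_tmul', map_smul, add_sub_cancel_left]
  push_cast
  module

end Shift

/-! ### The opposite-operator map on weight vectors -/

section Opp

variable {A V : Type*} [AddCommGroup A] [AddCommGroup V] [Module ℂ V]

theorem oppVec_of_mem_eigenspace (𝕍 : MobiusVertexAlgebra A V) {h : ℤ} {v : V}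
    (hv : v ∈ 𝕍.sl2.L0.eigenspace (h : ℂ)) : oppVec 𝕍 v = oppHom 𝕍 h v := by
  have e : (LinearEquiv.ofBijective
      (DirectSum.coeLinearMap fun n : ℤ => 𝕍.sl2.L0.eigenspace (n : ℂ))
      (weight_isInternal 𝕍)).symm v = DirectSum.lof ℂ ℤ
        (fun n : ℤ => 𝕍.sl2.L0.eigenspace (n : ℂ)) h ⟨v, hv⟩ := by
    rw [LinearEquiv.symm_apply_eq]
    exact (DirectSum.coeLinearMap_lof (fun n : ℤ => 𝕍.sl2.L0.eigenspace (n : ℂ)) h ⟨v, hv⟩).symm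
  rw [oppVec, LinearMap.comp_apply, LinearEquiv.coe_coe, e, DirectSum.toModule_lof]
  rfl

theorem oppHom_eq_sum (𝕍 : MobiusVertexAlgebra A V) (h : ℤ) {v : V} {K : ℕ}
    (hK : ∀ k, K ≤ k → (𝕍.sl2.L1 ^ k) v = 0) : oppHom 𝕍 h v =
      ∑ k ∈ Finset.range K, ((-1 : ℂ) ^ h * (k.factorial : ℂ)⁻¹) •
        ((𝕍.sl2.L1 ^ k) v ⊗ₜ[ℂ] ((RatFunc.X : RatFunc ℂ) ^ (2 * h - 2 - (k : ℤ)))) := by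
  refine finsum_eq_sum_of_support_subset _ fun k hk => ?_
  by_contra hc
  simp only [Finset.coe_range, Set.mem_Iio, not_lt] at hc
  exact hk (by simp [hK k hc])

/-- `(v ⊗ tᵐf(t))ᵒ` for a vector `v` of weight `h`. -/
theorem opp_tmul (𝕍 : MobiusVertexAlgebra A V) {h : ℤ} {v : V}
    (hv : v ∈ 𝕍.sl2.L0.eigenspace (h : ℂ)) {K : ℕ}
    (hK : ∀ k, K ≤ k → (𝕍.sl2.L1 ^ k) v = 0) (m : ℤ) (f : RatFunc ℂ) :
    opp 𝕍 (v ⊗ₜ[ℂ] (RatFunc.X ^ m * f)) = (-1 : ℂ) ^ h • ∑ k ∈ Finset.range K,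
      (k.factorial : ℂ)⁻¹ • ((𝕍.sl2.L1 ^ k) v ⊗ₜ[ℂ]
        (RatFunc.X ^ (2 * h - 2 - (k : ℤ) - m) * invert f)) := by
  have e : opp 𝕍 (v ⊗ₜ[ℂ] (RatFunc.X ^ m * f)) = LinearMap.lTensor V
      (LinearMap.mul ℂ (RatFunc ℂ) (invert (RatFunc.X ^ m * f))) (oppVec 𝕍 v) := rfl
  rw [e, oppVec_of_mem_eigenspace 𝕍 hv, oppHom_eq_sum 𝕍 h hK, map_sum, Finset.smul_sum]
  refine Finset.sum_congr rfl fun k _ => ?_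
  rw [map_smul, LinearMap.lTensor_tmul, LinearMap.mul_apply', map_mul, invert_X_zpow, smul_smul,
    mul_right_comm, ← zpow_add₀ RatFunc.X_ne_zero, neg_add_eq_sub]

theorem L1_pow_mem_eigenspace (ρ : Sl2Rep V) {h : ℂ} {v : V} (hv : v ∈ ρ.L0.eigenspace h)
    (k : ℕ) : (ρ.L1 ^ k) v ∈ ρ.L0.eigenspace (h - k) := by
  induction k with
  | zero => simpa using hv
  | succ k ih =>
    rw [Module.End.mem_eigenspace_iff] at ih ⊢
    have h2 := LinearMap.congr_fun ρ.bracket_L0_L1 ((ρ.L1 ^ k) v)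
    rw [Ring.lie_def, LinearMap.sub_apply, Module.End.mul_apply, Module.End.mul_apply, ih,
      map_smul, LinearMap.neg_apply, sub_eq_iff_eq_add] at h2
    rw [pow_succ', Module.End.mul_apply, h2]
    push_cast
    module

theorem Lm1_mem_eigenspace (ρ : Sl2Rep V) {h : ℂ} {v : V} (hv : v ∈ ρ.L0.eigenspace h) :
    ρ.Lm1 v ∈ ρ.L0.eigenspace (h + 1) := by
  rw [Module.End.mem_eigenspace_iff] at hv ⊢
  have h2 := LinearMap.congr_fun ρ.bracket_L0_Lm1 v
  rw [Ring.lie_def, LinearMap.sub_apply, Module.End.mul_apply, Module.End.mul_apply, hv,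
    map_smul, sub_eq_iff_eq_add] at h2
  rw [h2]
  module

/-- The standard `𝔰𝔩(2)` computation: moving `L(-1)` past the `L(1)`'s collects `2(h - i)` for `0 ≤
i ≤ k`, with sum `(k + 1)(2h - k)`. -/
theorem L1_pow_Lm1 (ρ : Sl2Rep V) {h : ℂ} {v : V} (hv : v ∈ ρ.L0.eigenspace h) (k : ℕ) :
    (ρ.L1 ^ (k + 1)) (ρ.Lm1 v) = ρ.Lm1 ((ρ.L1 ^ (k + 1)) v) +
      (((k : ℂ) + 1) * (2 * h - k)) • (ρ.L1 ^ k) v := by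
  have comm : ∀ x, ρ.L1 (ρ.Lm1 x) = ρ.Lm1 (ρ.L1 x) + (2 : ℂ) • ρ.L0 x := by
    intro x
    have := LinearMap.congr_fun ρ.bracket_Lm1_L1 x
    rw [Ring.lie_def, LinearMap.sub_apply, Module.End.mul_apply, Module.End.mul_apply,
      LinearMap.smul_apply] at this
    linear_combination (norm := module) (-1 : ℂ) • this
  have hsucc : ∀ (k : ℕ) x, ρ.L1 ((ρ.L1 ^ k) x) = (ρ.L1 ^ (k + 1)) x := fun k x => by
    rw [pow_succ', Module.End.mul_apply]
  induction k with
  | zero =>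
    simp only [zero_add, pow_one, pow_zero, Module.End.one_apply]
    rw [comm, Module.End.mem_eigenspace_iff.mp hv]
    push_cast
    module
  | succ k ih =>
    rw [← hsucc (k + 1) (ρ.Lm1 v), ih, map_add, comm, map_smul, hsucc, hsucc,
      Module.End.mem_eigenspace_iff.mp (L1_pow_mem_eigenspace ρ hv (k + 1))]
    push_cast
    module

end Opp

/-! ### Finite sums over antidiagonals -/

section Antidiagonal

open Finset.HasAntidiagonal

/-- The vanishing hypothesis restricts both sums to the same finite set, fibred on the left by `p +
b`. -/
theorem sum_range_sum_antidiagonal {X : Type*} [AddCommMonoid X] {P Q M : ℕ}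
    {F : ℕ → ℕ → X} (hF : ∀ p b, ¬(p < P ∧ b < Q ∧ p + b < M) → F p b = 0) :
    ∑ q ∈ Finset.range M, ∑ x ∈ antidiagonal q, F x.1 x.2 =
      ∑ p ∈ Finset.range P, ∑ b ∈ Finset.range Q, F p b := by
  classical
  rw [← Finset.sum_product']
  set S := (Finset.range P ×ˢ Finset.range Q).filter fun x => x.1 + x.2 < M with hS
  have h1 : ∑ x ∈ Finset.range P ×ˢ Finset.range Q, F x.1 x.2 = ∑ x ∈ S, F x.1 x.2 := by
    refine (Finset.sum_subset (Finset.filter_subset _ _) fun x hx hx' => hF _ _ fun h => ?_).symm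
    exact hx' (Finset.mem_filter.mpr ⟨hx, h.2.2⟩)
  rw [h1, ← Finset.sum_fiberwise_of_maps_to (s := S) (t := Finset.range M) (g := fun x => x.1 + x.2)
    fun x hx => Finset.mem_range.mpr (Finset.mem_filter.mp hx).2]
  refine Finset.sum_congr rfl fun q hq => ?_
  refine (Finset.sum_subset (fun x hx => ?_) fun x hx hx' => hF _ _ fun h => ?_).symm
  · exact mem_antidiagonal.mpr (Finset.mem_filter.mp hx).2
  · rw [mem_antidiagonal] at hx
    refine hx' (Finset.mem_filter.mpr ⟨Finset.mem_filter.mpr ⟨?_, ?_⟩, hx⟩)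
    · exact Finset.mem_product.mpr ⟨Finset.mem_range.mpr h.1, Finset.mem_range.mpr h.2.1⟩
    · exact h.2.2

theorem sum_range_sum_antidiagonal_antidiagonal {X : Type*} [AddCommMonoid X] {N : ℕ}
    {F : ℕ → ℕ → ℕ → X} (hF : ∀ a r b, ¬(a < N ∧ r < N ∧ b < N) → F a r b = 0) :
    ∑ q ∈ Finset.range (3 * N), ∑ x ∈ antidiagonal q, ∑ y ∈ antidiagonal x.1, F y.1 y.2 x.2 =
      ∑ a ∈ Finset.range N, ∑ b ∈ Finset.range N, ∑ r ∈ Finset.range N, F a r b := by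
  rw [sum_range_sum_antidiagonal (P := 2 * N) (Q := N)
    (F := fun p b => ∑ y ∈ antidiagonal p, F y.1 y.2 b)]
  · rw [Finset.sum_comm]
    rw [Finset.sum_comm (s := Finset.range N) (t := Finset.range N)]
    refine Finset.sum_congr rfl fun b _ => ?_
    refine sum_range_sum_antidiagonal fun p r h => hF _ _ _ fun h' => h ⟨h'.1, h'.2.1, ?_⟩
    omega
  · intro p b h
    refine Finset.sum_eq_zero fun y hy => hF _ _ _ fun h' => h ?_
    rw [mem_antidiagonal] at hy
    omega

variable {X : Type*} [AddCommGroup X] [Module ℂ X]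

/-- On the antidiagonal, `q + 1 = x.1 + x.2`; each summand is then reindexed separately, its
boundary term having coefficient `0`. This is the product rule at the level of coefficients. -/
theorem succ_smul_sum_antidiagonal (F : ℕ × ℕ → X) (q : ℕ) :
    ((q : ℂ) + 1) • ∑ x ∈ antidiagonal (q + 1), F x =
      ∑ x ∈ antidiagonal q, (((x.1 : ℂ) + 1) • F (x.1 + 1, x.2) +
        ((x.2 : ℂ) + 1) • F (x.1, x.2 + 1)) := by
  have h1 : ∑ x ∈ antidiagonal (q + 1), (x.1 : ℂ) • F x =
      ∑ x ∈ antidiagonal q, ((x.1 : ℂ) + 1) • F (x.1 + 1, x.2) := by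
    rw [Finset.Nat.sum_antidiagonal_succ]
    simp
  have h2 : ∑ x ∈ antidiagonal (q + 1), (x.2 : ℂ) • F x =
      ∑ x ∈ antidiagonal q, ((x.2 : ℂ) + 1) • F (x.1, x.2 + 1) := by
    rw [Finset.Nat.sum_antidiagonal_succ']
    simp
  rw [Finset.sum_add_distrib, ← h1, ← h2, ← Finset.sum_add_distrib, Finset.smul_sum]
  refine Finset.sum_congr rfl fun x hx => ?_
  rw [mem_antidiagonal] at hx
  rw [← add_smul]
  congr 1
  have : ((x.1 + x.2 : ℕ) : ℂ) = ((q + 1 : ℕ) : ℂ) := by rw [hx]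
  push_cast at this
  exact this.symm

theorem inv_factorial_succ_mul (k : ℕ) :
    ((k + 1).factorial : ℂ)⁻¹ * ((k : ℂ) + 1) = (k.factorial : ℂ)⁻¹ := by
  have h1 : (k : ℂ) + 1 ≠ 0 := Nat.cast_add_one_ne_zero k
  rw [Nat.factorial_succ]
  push_cast
  field_simp

/-- Leibniz rule for divided powers. -/
theorem divided_pow_leibniz (L : Module.End ℂ X) (D : ℕ → Module.End ℂ X)
    (hD : ∀ p, ⁅L, D p⁆ = ((p : ℂ) + 1) • D (p + 1)) (x : X) (q : ℕ) :
    (q.factorial : ℂ)⁻¹ • (L ^ q) (D 0 x) =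
      ∑ y ∈ antidiagonal q, D y.1 ((y.2.factorial : ℂ)⁻¹ • (L ^ y.2) x) := by
  induction q with
  | zero => simp
  | succ q ih =>
    have hq : (q : ℂ) + 1 ≠ 0 := Nat.cast_add_one_ne_zero q
    refine smul_right_injective X hq ?_
    simp only
    rw [succ_smul_sum_antidiagonal, smul_smul, mul_comm, inv_factorial_succ_mul, pow_succ',
      Module.End.mul_apply, ← map_smul, ih, map_sum]
    refine Finset.sum_congr rfl fun y _ => ?_
    have h := LinearMap.congr_fun (hD y.1) ((y.2.factorial : ℂ)⁻¹ • (L ^ y.2) x)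
    rw [Ring.lie_def, LinearMap.sub_apply, Module.End.mul_apply, Module.End.mul_apply,
      LinearMap.smul_apply, sub_eq_iff_eq_add] at h
    rw [h]
    congr 1
    rw [map_smul L, ← Module.End.mul_apply L, ← pow_succ', ← map_smul (D y.1), smul_smul,
      mul_comm ((y.2 : ℂ) + 1), inv_factorial_succ_mul]

end Antidiagonal

/-! ### Opposite vertex operators -/

section OppTau

open Finset.HasAntidiagonal

variable {G V W : Type*} [AddCommGroup G] {A : AddSubgroup G} [AddCommGroup V] [Module ℂ V]
  [AddCommGroup W] [Module ℂ W] {𝕍 : MobiusVertexAlgebra A V}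

/-- For a weight vector, both the `L(0)` and `L(-1)` terms of the covariance formula become
multiples of the single mode `u_{n+1}`. -/
theorem L1_mode {A' : Type*} [AddCommGroup A'] (𝕌 : MobiusVertexAlgebra A' V) {h : ℂ} {u : V}
    (hu : u ∈ 𝕌.sl2.L0.eigenspace h) (n : ℤ) :
    ⁅𝕌.sl2.L1, 𝕌.Y u n⁆ = 𝕌.Y (𝕌.sl2.L1 u) n + (2 * h - 2 - n) • 𝕌.Y u (n + 1) := by
  rw [(𝕌.covariant u n).2.2, 𝕌.derivative, Module.End.mem_eigenspace_iff.mp hu, map_smul,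
    show n + 2 - 1 = n + 1 by ring, Pi.smul_apply]
  push_cast
  module

/-- The coefficients of `exp(xL(1)) Y(u, x₀) exp(-xL(1))`. -/
def conjMode (𝕍 : MobiusVertexAlgebra A V) (h : ℤ) (u : V) (j : ℤ) (p : ℕ) : Module.End ℂ V :=
  ∑ y ∈ antidiagonal p, ((y.1.factorial : ℂ)⁻¹ * zchoose (2 * h - 2 - y.1 - j) y.2) •
    𝕍.Y ((𝕍.sl2.L1 ^ y.1) u) (j + y.2)

/-- The differential equation `d/dx (e^{xL(1)} u_j e^{-xL(1)}) = ⁅L(1), ·⁆`, read off at `xᵖ`.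
Bracketing raises either the descendant index or the mode index; `h1` and `h2` reindex these
contributions, and `zchoose_recursion` makes their coefficients add up to `p + 1` times the next
ones. -/
theorem lie_L1_conjMode {h : ℤ} {u : V} (hu : u ∈ 𝕍.sl2.L0.eigenspace (h : ℂ)) (j : ℤ) (p : ℕ) :
    ⁅𝕍.sl2.L1, conjMode 𝕍 h u j p⁆ = ((p : ℂ) + 1) • conjMode 𝕍 h u j (p + 1) := by
  set Z : ℕ → ℕ → Module.End ℂ V := fun a r => 𝕍.Y ((𝕍.sl2.L1 ^ a) u) (j + r) with hZ
  have hlie : ∀ a r, ⁅𝕍.sl2.L1, Z a r⁆ =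
      Z (a + 1) r + ((2 * h - 2 - a - j : ℤ) - a - r : ℂ) • Z a (r + 1) := by
    intro a r
    simp only [hZ]
    rw [L1_mode 𝕍 (L1_pow_mem_eigenspace 𝕍.sl2 hu a), ← Module.End.mul_apply, ← pow_succ']
    congr 1
    push_cast
    rw [add_assoc]
    congr 1
    ring
  have h1 : ∑ y ∈ antidiagonal (p + 1),
      ((y.1 : ℂ) * ((y.1.factorial : ℂ)⁻¹ * zchoose (2 * h - 2 - y.1 - j + 1) y.2)) • Z y.1 y.2 =
      ∑ y ∈ antidiagonal p, ((y.1.factorial : ℂ)⁻¹ * zchoose (2 * h - 2 - y.1 - j) y.2) •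
        Z (y.1 + 1) y.2 := by
    rw [Finset.Nat.sum_antidiagonal_succ]
    simp only [Nat.cast_zero, zero_mul, zero_smul, zero_add]
    refine Finset.sum_congr rfl fun y _ => ?_
    rw [← inv_factorial_succ_mul y.1]
    congr 1
    rw [show 2 * h - 2 - ((y.1 + 1 : ℕ) : ℤ) - j + 1 = 2 * h - 2 - y.1 - j by push_cast; ring]
    push_cast
    ring
  have h2 : ∑ y ∈ antidiagonal (p + 1), ((y.1.factorial : ℂ)⁻¹ *
      (((y.1 : ℂ) + y.2) * zchoose (2 * h - 2 - y.1 - j) y.2 -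
        y.1 * zchoose (2 * h - 2 - y.1 - j + 1) y.2)) • Z y.1 y.2 =
      ∑ y ∈ antidiagonal p, ((y.1.factorial : ℂ)⁻¹ * zchoose (2 * h - 2 - y.1 - j) y.2) •
        ((2 * h - 2 - y.1 - j : ℤ) - y.1 - y.2 : ℂ) • Z y.1 (y.2 + 1) := by
    rw [Finset.Nat.sum_antidiagonal_succ']
    simp only [zchoose_zero, Nat.cast_zero, add_zero, sub_self, mul_zero, zero_smul]
    rw [zero_add]
    refine Finset.sum_congr rfl fun y _ => ?_
    rw [smul_smul]
    congr 1
    have := zchoose_recursion y.1 (2 * h - 2 - y.1 - j) y.2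
    push_cast at this ⊢
    linear_combination (-(y.1.factorial : ℂ)⁻¹) * this
  have hL : ⁅𝕍.sl2.L1, conjMode 𝕍 h u j p⁆ = ∑ y ∈ antidiagonal p,
      ((y.1.factorial : ℂ)⁻¹ * zchoose (2 * h - 2 - y.1 - j) y.2) • ⁅𝕍.sl2.L1, Z y.1 y.2⁆ := by
    simp only [conjMode, Ring.lie_def, Finset.mul_sum, Finset.sum_mul, ← Finset.sum_sub_distrib,
      smul_sub, mul_smul_comm, smul_mul_assoc, hZ]
  rw [hL]
  simp only [hlie, smul_add]
  rw [Finset.sum_add_distrib, ← h1, ← h2, ← Finset.sum_add_distrib, conjMode, Finset.smul_sum]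
  refine Finset.sum_congr rfl fun y hy => ?_
  rw [mem_antidiagonal] at hy
  have hc : ((y.1 + y.2 : ℕ) : ℂ) = ((p + 1 : ℕ) : ℂ) := by rw [hy]
  push_cast at hc
  rw [← add_smul, smul_smul, ← hc]
  congr 1
  ring

/-- `(1/q!) L(1)^q (u_j v)` in terms of the `L(1)`-descendants of `u` and `v`. -/
theorem L1_pow_mode_apply {h : ℤ} {u : V} (hu : u ∈ 𝕍.sl2.L0.eigenspace (h : ℂ)) (j : ℤ) (v : V)
    (q : ℕ) : (q.factorial : ℂ)⁻¹ • (𝕍.sl2.L1 ^ q) (𝕍.Y u j v) =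
      ∑ x ∈ antidiagonal q, ∑ y ∈ antidiagonal x.1,
        ((y.1.factorial : ℂ)⁻¹ * (x.2.factorial : ℂ)⁻¹ * zchoose (2 * h - 2 - y.1 - j) y.2) •
          𝕍.Y ((𝕍.sl2.L1 ^ y.1) u) (j + y.2) ((𝕍.sl2.L1 ^ x.2) v) := by
  have h0 : conjMode 𝕍 h u j 0 = 𝕍.Y u j := by simp [conjMode]
  have := divided_pow_leibniz 𝕍.sl2.L1 (conjMode 𝕍 h u j) (lie_L1_conjMode hu j) v q
  rw [h0] at this
  rw [this]
  refine Finset.sum_congr rfl fun x _ => ?_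
  rw [conjMode, LinearMap.sum_apply]
  refine Finset.sum_congr rfl fun y _ => ?_
  rw [LinearMap.smul_apply, map_smul, smul_smul]
  congr 1
  ring

/-- `v ⊗ f ↦ τ_W(ι₊T_c(v ⊗ f)ᵒ)`. -/
def oppTau (c : ℂ) (M : MobiusModule 𝕍 W) : V ⊗[ℂ] RatFunc ℂ →ₗ[ℂ] Module.End ℂ W :=
  shiftedTau c M.Y M.truncated ∘ₗ opp 𝕍

/-- `x ↦ τ_W(ι₊T_c(x ⊗ tᴺf(t⁻¹)))`. -/
def oppTerm (c : ℂ) (M : MobiusModule 𝕍 W) (f : RatFunc ℂ) (N : ℤ) : V →ₗ[ℂ] Module.End ℂ W :=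
  shiftedTau c M.Y M.truncated ∘ₗ
    (TensorProduct.mk ℂ V (RatFunc ℂ)).flip (RatFunc.X ^ N * invert f)

theorem oppTerm_apply (c : ℂ) (M : MobiusModule 𝕍 W) (f : RatFunc ℂ) (N : ℤ) (x : V) :
    oppTerm c M f N x = shiftedTau c M.Y M.truncated (x ⊗ₜ[ℂ] (RatFunc.X ^ N * invert f)) := rfl

theorem oppTau_tmul (c : ℂ) (M : MobiusModule 𝕍 W) {h : ℤ} {v : V}
    (hv : v ∈ 𝕍.sl2.L0.eigenspace (h : ℂ)) {K : ℕ}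
    (hK : ∀ k, K ≤ k → (𝕍.sl2.L1 ^ k) v = 0) (m : ℤ) (f : RatFunc ℂ) :
    oppTau c M (v ⊗ₜ[ℂ] (RatFunc.X ^ m * f)) = (-1 : ℂ) ^ h • ∑ k ∈ Finset.range K,
      (k.factorial : ℂ)⁻¹ • oppTerm c M f (2 * h - 2 - k - m) ((𝕍.sl2.L1 ^ k) v) := by
  rw [oppTau, LinearMap.comp_apply, opp_tmul 𝕍 hv hK, map_smul, map_sum]
  simp only [map_smul, oppTerm_apply]

theorem end_lie_sum {ι κ : Type*} (s : Finset ι) (t : Finset κ) (a : ι → ℂ) (b : κ → ℂ)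
    (S : ι → Module.End ℂ W) (T : κ → Module.End ℂ W) (c d : ℂ) :
    ⁅c • ∑ i ∈ s, a i • S i, d • ∑ j ∈ t, b j • T j⁆ =
      (c * d) • ∑ i ∈ s, ∑ j ∈ t, (a i * b j) • ⁅S i, T j⁆ := by
  rw [Ring.lie_def]
  simp only [smul_mul_smul_comm, Finset.sum_mul_sum, Ring.lie_def, smul_sub,
    Finset.sum_sub_distrib]
  rw [mul_comm d c, Finset.sum_comm (s := t)]
  simp only [mul_comm (b _) (a _)]

theorem lie_oppTerm (c : ℂ) (M : MobiusModule 𝕍 W) (f : RatFunc ℂ) (a b : ℤ) (u v : V) (I : ℕ)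
    (hI : ∀ i : ℕ, I ≤ i → 𝕍.Y u i v = 0) :
    ⁅oppTerm c M 1 a u, oppTerm c M f b v⁆ =
      ∑ i ∈ Finset.range I, zchoose a i • oppTerm c M f (a - i + b) (𝕍.Y u i v) := by
  rw [oppTerm_apply, oppTerm_apply, map_one, mul_one, lie_shiftedTau M.jacobi _ c u v I hI]
  refine Finset.sum_congr rfl fun i _ => ?_
  rw [oppTerm_apply, ← mul_assoc, ← zpow_add₀ RatFunc.X_ne_zero]

end OppTau

/-! ### Commutators of opposite vertex operators -/

section OppCommutator

open Finset.HasAntidiagonal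

variable {G V W : Type*} [AddCommGroup G] {A : AddSubgroup G} [AddCommGroup V] [Module ℂ V]
  [AddCommGroup W] [Module ℂ W] {𝕍 : MobiusVertexAlgebra A V}

/-- Follows from the `L(0)`-covariance once the derivative property has replaced `L(-1)u`. -/
theorem mode_mem_eigenspace {A' : Type*} [AddCommGroup A'] (𝕌 : MobiusVertexAlgebra A' V)
    {h k : ℂ} {u v : V} (hu : u ∈ 𝕌.sl2.L0.eigenspace h) (hv : v ∈ 𝕌.sl2.L0.eigenspace k)
    (n : ℤ) : 𝕌.Y u n v ∈ 𝕌.sl2.L0.eigenspace (h + k - n - 1) := by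
  have h1 := LinearMap.congr_fun (𝕌.covariant u n).2.1 v
  rw [𝕌.derivative, Ring.lie_def, LinearMap.sub_apply, Module.End.mul_apply,
    Module.End.mul_apply, Module.End.mem_eigenspace_iff.mp hu,
    Module.End.mem_eigenspace_iff.mp hv, map_smul, map_smul, LinearMap.add_apply, Pi.smul_apply,
    LinearMap.smul_apply, LinearMap.smul_apply, sub_eq_iff_eq_add, add_sub_cancel_right] at h1
  rw [Module.End.mem_eigenspace_iff, h1]
  push_cast
  module

/-- Only finitely many pairs of descendants are nonzero, so their truncation bounds have a maximum.
The bound is stated for all larger `N` so that it can be enlarged later. -/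
theorem exists_descendant_bound (𝕍 : MobiusVertexAlgebra A V) (u v : V) :
    ∃ N₀ : ℕ, ∀ N, N₀ ≤ N → (∀ a, N ≤ a → (𝕍.sl2.L1 ^ a) u = 0) ∧
      (∀ b, N ≤ b → (𝕍.sl2.L1 ^ b) v = 0) ∧
      ∀ (a b i : ℕ), N ≤ i → 𝕍.Y ((𝕍.sl2.L1 ^ a) u) i ((𝕍.sl2.L1 ^ b) v) = 0 := by
  obtain ⟨K, hK⟩ := L1_locally_nilpotent 𝕍 u
  obtain ⟨K', hK'⟩ := L1_locally_nilpotent 𝕍 v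
  choose B hB using fun a b : ℕ => 𝕍.truncated ((𝕍.sl2.L1 ^ a) u) ((𝕍.sl2.L1 ^ b) v)
  set S := (Finset.range K ×ˢ Finset.range K').sup fun x => (B x.1 x.2).toNat with hS
  refine ⟨max (max K K') S, fun N hN => ⟨fun a ha => hK a (by omega), fun b hb => hK' b (by omega),
    fun a b i hi => ?_⟩⟩
  by_cases ha : K ≤ a
  · simp [hK a ha]
  by_cases hb : K' ≤ b
  · simp [hK' b hb]
  refine hB a b i ?_
  have : (B a b).toNat ≤ S := Finset.le_sup (f := fun x : ℕ × ℕ => (B x.1 x.2).toNat)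
    (b := (a, b)) (by simp; omega)
  have := Int.self_le_toNat (B a b)
  omega

/-- Expands `(u_j v)ᵒ` into descendants of `u` and `v`. The exponent of `t` depends on `j` and `r`
only through `j + r`, which later allows summation by the mode index. -/
theorem oppTau_mode_tmul (c : ℂ) (M : MobiusModule 𝕍 W) {h k : ℤ} {u v : V}
    (hu : u ∈ 𝕍.sl2.L0.eigenspace (h : ℂ)) (hv : v ∈ 𝕍.sl2.L0.eigenspace (k : ℂ)) {N : ℕ}
    (hNu : ∀ a, N ≤ a → (𝕍.sl2.L1 ^ a) u = 0) (hNv : ∀ b, N ≤ b → (𝕍.sl2.L1 ^ b) v = 0)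
    (hN : ∀ (a b i : ℕ), N ≤ i → 𝕍.Y ((𝕍.sl2.L1 ^ a) u) i ((𝕍.sl2.L1 ^ b) v) = 0)
    (m : ℤ) (j : ℕ) (f : RatFunc ℂ) :
    oppTau c M (𝕍.Y u j v ⊗ₜ[ℂ] (RatFunc.X ^ (m - j) * f)) =
      (-((-1 : ℂ) ^ h * (-1) ^ k * (-1) ^ j)) •
        ∑ a ∈ Finset.range N, ∑ b ∈ Finset.range N, ∑ r ∈ Finset.range N,
          ((a.factorial : ℂ)⁻¹ * (b.factorial : ℂ)⁻¹ * zchoose (2 * h - 2 - a - j) r) •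
            oppTerm c M f (2 * h + 2 * k - 4 - m - a - b - (j + r : ℕ))
              (𝕍.Y ((𝕍.sl2.L1 ^ a) u) (j + r : ℕ) ((𝕍.sl2.L1 ^ b) v)) := by
  have hw : 𝕍.Y u j v ∈ 𝕍.sl2.L0.eigenspace ((h + k - j - 1 : ℤ) : ℂ) := by
    have := mode_mem_eigenspace 𝕍 hu hv j
    push_cast
    exact_mod_cast this
  have hz : ∀ a r b : ℕ, ¬(a < N ∧ r < N ∧ b < N) →
      𝕍.Y ((𝕍.sl2.L1 ^ a) u) (j + r : ℕ) ((𝕍.sl2.L1 ^ b) v) = 0 := by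
    intro a r b hn
    by_cases ha : N ≤ a
    · simp [hNu a ha]
    by_cases hb : N ≤ b
    · simp [hNv b hb]
    exact hN a b _ (by omega)
  -- If `a + r + b = q ≥ 3N`, some index is at least `N`, and the corresponding term is zero.
  have hq : ∀ q, 3 * N ≤ q → (𝕍.sl2.L1 ^ q) (𝕍.Y u j v) = 0 := by
    intro q hq
    have h1 := L1_pow_mode_apply hu j v q
    rw [Finset.sum_eq_zero] at h1
    · exact (smul_eq_zero.mp h1).resolve_left
        (inv_ne_zero (Nat.cast_ne_zero.mpr q.factorial_ne_zero))
    · intro x hx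
      refine Finset.sum_eq_zero fun y hy => ?_
      rw [mem_antidiagonal] at hx hy
      have := hz y.1 y.2 x.2 (by omega)
      push_cast at this
      rw [this, smul_zero]
  -- The `-1` in the weight of `u_j v` is the source of the minus sign in the opposite commutator
  -- formula.
  have hsign : (-1 : ℂ) ^ (h + k - j - 1) = -((-1 : ℂ) ^ h * (-1) ^ k * (-1) ^ j) := by
    have h1 : (-1 : ℂ) ≠ 0 := by norm_num
    rw [zpow_sub₀ h1, zpow_sub₀ h1, zpow_add₀ h1, zpow_one, zpow_natCast]
    rcases neg_one_pow_eq_or ℂ j with e | e <;> rw [e] <;> ring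
  rw [oppTau_tmul c M hw hq, hsign,
    ← sum_range_sum_antidiagonal_antidiagonal (N := N) (F := fun a r b =>
      ((a.factorial : ℂ)⁻¹ * (b.factorial : ℂ)⁻¹ * zchoose (2 * h - 2 - a - j) r) •
        oppTerm c M f (2 * h + 2 * k - 4 - m - a - b - (j + r : ℕ))
          (𝕍.Y ((𝕍.sl2.L1 ^ a) u) (j + r : ℕ) ((𝕍.sl2.L1 ^ b) v)))
      (fun a r b hn => by rw [hz a r b hn, map_zero, smul_zero])]
  congr 1
  refine Finset.sum_congr rfl fun q _ => ?_
  rw [← map_smul, L1_pow_mode_apply hu j v q, map_sum]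
  refine Finset.sum_congr rfl fun x hx => ?_
  rw [map_sum]
  refine Finset.sum_congr rfl fun y hy => ?_
  rw [mem_antidiagonal] at hx hy
  rw [map_smul]
  congr 2
  congr 1
  rw [← hx, ← hy]
  push_cast
  ring

/-- The commutator formula for opposite vertex operators on weight vectors. -/
theorem lie_oppTau_of_mem_eigenspace (c : ℂ) (M : MobiusModule 𝕍 W) {h k : ℤ} {u v : V}
    (hu : u ∈ 𝕍.sl2.L0.eigenspace (h : ℂ)) (hv : v ∈ 𝕍.sl2.L0.eigenspace (k : ℂ)) {N : ℕ}
    (hNu : ∀ a, N ≤ a → (𝕍.sl2.L1 ^ a) u = 0) (hNv : ∀ b, N ≤ b → (𝕍.sl2.L1 ^ b) v = 0)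
    (hN : ∀ (a b i : ℕ), N ≤ i → 𝕍.Y ((𝕍.sl2.L1 ^ a) u) i ((𝕍.sl2.L1 ^ b) v) = 0)
    (m : ℤ) (f : RatFunc ℂ) :
    ⁅oppTau c M (u ⊗ₜ[ℂ] (RatFunc.X ^ m)), oppTau c M (v ⊗ₜ[ℂ] f)⁆ =
      -∑ i ∈ Finset.range N, zchoose m i •
        oppTau c M (𝕍.Y u i v ⊗ₜ[ℂ] (RatFunc.X ^ (m - i) * f)) := by
  have e1 := oppTau_tmul c M hu hNu m 1
  have e2 := oppTau_tmul c M hv hNv 0 f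
  rw [mul_one] at e1
  rw [zpow_zero, one_mul] at e2
  rw [e1, e2, end_lie_sum]
  simp only [oppTau_mode_tmul c M hu hv hNu hNv hN]
  -- Rearranged so that each pair `(a, b)` of descendants can be compared with one commutator on the
  -- left.
  have hR : -∑ j ∈ Finset.range N, zchoose m j • (-((-1 : ℂ) ^ h * (-1) ^ k * (-1) ^ j)) •
        ∑ a ∈ Finset.range N, ∑ b ∈ Finset.range N, ∑ r ∈ Finset.range N,
          ((a.factorial : ℂ)⁻¹ * (b.factorial : ℂ)⁻¹ * zchoose (2 * h - 2 - a - j) r) •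
            oppTerm c M f (2 * h + 2 * k - 4 - m - a - b - (j + r : ℕ))
              (𝕍.Y ((𝕍.sl2.L1 ^ a) u) (j + r : ℕ) ((𝕍.sl2.L1 ^ b) v)) =
      ((-1 : ℂ) ^ h * (-1) ^ k) • ∑ a ∈ Finset.range N, ∑ b ∈ Finset.range N,
        ((a.factorial : ℂ)⁻¹ * (b.factorial : ℂ)⁻¹) •
          ∑ j ∈ Finset.range N, ∑ r ∈ Finset.range N,
            ((-1) ^ j * zchoose m j * zchoose (2 * h - 2 - a - j) r) •
              oppTerm c M f (2 * h + 2 * k - 4 - m - a - b - (j + r : ℕ))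
                (𝕍.Y ((𝕍.sl2.L1 ^ a) u) (j + r : ℕ) ((𝕍.sl2.L1 ^ b) v)) := by
    simp only [Finset.smul_sum, smul_smul]
    rw [← Finset.sum_neg_distrib, Finset.sum_comm]
    rw [Finset.sum_comm]
    simp only [← Finset.sum_neg_distrib, ← neg_smul]
    rw [Finset.sum_comm]
    refine Finset.sum_congr rfl fun a _ => ?_
    rw [Finset.sum_comm]
    refine Finset.sum_congr rfl fun b _ => ?_
    refine Finset.sum_congr rfl fun j _ => ?_
    refine Finset.sum_congr rfl fun r _ => ?_
    congr 1
    ring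
  rw [hR]
  congr 1
  refine Finset.sum_congr rfl fun a _ => Finset.sum_congr rfl fun b _ => ?_
  congr 1
  rw [lie_oppTerm c M f _ _ _ _ N (hN a b),
    ← sum_range_sum_antidiagonal (P := N) (Q := N) (M := N) (F := fun j r =>
      ((-1) ^ j * zchoose m j * zchoose (2 * h - 2 - a - j) r) •
        oppTerm c M f (2 * h + 2 * k - 4 - m - a - b - (j + r : ℕ))
          (𝕍.Y ((𝕍.sl2.L1 ^ a) u) (j + r : ℕ) ((𝕍.sl2.L1 ^ b) v)))
      (fun j r hn => by rw [hN a b _ (by omega), map_zero, smul_zero])]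
  refine Finset.sum_congr rfl fun i _ => ?_
  -- The left side has the single binomial `(2h - 2 - a - m choose i)`; Vandermonde splits it over
  -- `j + r = i` into the coefficients on the right.
  rw [show 2 * h - 2 - (a : ℤ) - m = (2 * h - 2 - a) - m by ring, zchoose_sub, Finset.sum_smul]
  refine Finset.sum_congr rfl fun y hy => ?_
  rw [mem_antidiagonal] at hy
  rw [hy]
  congr 2
  ring_nf

theorem mem_iSup_eigenspace (𝕍 : MobiusVertexAlgebra A V) (v : V) :
    v ∈ ⨆ n : ℤ, 𝕍.sl2.L0.eigenspace (n : ℂ) := by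
  rw [𝕍.graded.weight_span]
  exact Submodule.mem_top

/-- The commutator formula for opposite vertex operators. -/
theorem lie_oppTau (c : ℂ) (M : MobiusModule 𝕍 W) (u v : V) :
    ∃ I₀ : ℕ, ∀ I, I₀ ≤ I → ∀ (m : ℤ) (f : RatFunc ℂ),
      ⁅oppTau c M (u ⊗ₜ[ℂ] (RatFunc.X ^ m)), oppTau c M (v ⊗ₜ[ℂ] f)⁆ =
        -∑ i ∈ Finset.range I, zchoose m i •
          oppTau c M (𝕍.Y u i v ⊗ₜ[ℂ] (RatFunc.X ^ (m - i) * f)) := by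
  -- Having the formula for every `I ≥ I₀` lets the bounds for two summands be replaced by their
  -- maximum.
  induction mem_iSup_eigenspace 𝕍 u using Submodule.iSup_induction' with
  | zero => exact ⟨0, fun I _ m f => by simp [Ring.lie_def]⟩
  | add x y _ _ hx hy =>
    obtain ⟨I, hI⟩ := hx
    obtain ⟨I', hI'⟩ := hy
    refine ⟨max I I', fun J hJ m f => ?_⟩
    have h1 := hI J (by omega) m f
    have h2 := hI' J (by omega) m f
    rw [Ring.lie_def] at h1 h2 ⊢
    simp only [TensorProduct.add_tmul, map_add, add_mul, mul_add, Pi.add_apply,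
      LinearMap.add_apply, smul_add, Finset.sum_add_distrib]
    linear_combination (norm := module) h1 + h2
  | mem h u hu =>
    induction mem_iSup_eigenspace 𝕍 v using Submodule.iSup_induction' with
    | zero => exact ⟨0, fun I _ m f => by simp [Ring.lie_def]⟩
    | add x y _ _ hx hy =>
      obtain ⟨I, hI⟩ := hx
      obtain ⟨I', hI'⟩ := hy
      refine ⟨max I I', fun J hJ m f => ?_⟩
      have h1 := hI J (by omega) m f
      have h2 := hI' J (by omega) m f
      rw [Ring.lie_def] at h1 h2 ⊢
      simp only [TensorProduct.add_tmul, map_add, add_mul, mul_add, smul_add,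
        Finset.sum_add_distrib]
      linear_combination (norm := module) h1 + h2
    | mem k v hv =>
      obtain ⟨N₀, hN₀⟩ := exists_descendant_bound 𝕍 u v
      refine ⟨N₀, fun N hN m f => ?_⟩
      obtain ⟨h1, h2, h3⟩ := hN₀ N hN
      exact lie_oppTau_of_mem_eigenspace c M hu hv h1 h2 h3 m f

end OppCommutator

/-! ### Commutators of `L(-1)`, `L(0)`, `L(1)` with opposite vertex operators -/

section OppSl2

variable {G V W : Type*} [AddCommGroup G] {A : AddSubgroup G} [AddCommGroup V] [Module ℂ V]
  [AddCommGroup W] [Module ℂ W] {𝕍 : MobiusVertexAlgebra A V}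

theorem lie_Lm1_oppTerm (c : ℂ) (M : MobiusModule 𝕍 W) (f : RatFunc ℂ) (N : ℤ) (x : V) :
    ⁅(M.sl2.shift c).Lm1, oppTerm c M f N x⁆ = oppTerm c M f N (𝕍.sl2.Lm1 x) :=
  lie_Lm1_shiftedTau M.covariant M.truncated c x _

theorem lie_L0_oppTerm (c : ℂ) (M : MobiusModule 𝕍 W) (f : RatFunc ℂ) (N : ℤ) (x : V) :
    ⁅(M.sl2.shift c).L0, oppTerm c M f N x⁆ =
      oppTerm c M f N (𝕍.sl2.L0 x) + oppTerm c M f (N + 1) (𝕍.sl2.Lm1 x) := by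
  rw [oppTerm_apply, lie_L0_shiftedTau M.covariant, ← mul_assoc,
    ← zpow_one_add₀ RatFunc.X_ne_zero, add_comm 1 N]
  rfl

theorem lie_L1_oppTerm (c : ℂ) (M : MobiusModule 𝕍 W) (f : RatFunc ℂ) (N : ℤ) (x : V) :
    ⁅(M.sl2.shift c).L1, oppTerm c M f N x⁆ = oppTerm c M f N (𝕍.sl2.L1 x) +
      (2 : ℂ) • oppTerm c M f (N + 1) (𝕍.sl2.L0 x) + oppTerm c M f (N + 2) (𝕍.sl2.Lm1 x) := by
  rw [oppTerm_apply, lie_L1_shiftedTau M.covariant, ← mul_assoc,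
    ← zpow_one_add₀ RatFunc.X_ne_zero, ← mul_assoc, ← zpow_one_add₀ RatFunc.X_ne_zero,
    show 1 + (1 + N) = N + 2 by ring, add_comm 1 N]
  rfl

theorem oppTau_Lm1_tmul (c : ℂ) (M : MobiusModule 𝕍 W) {h : ℤ} {v : V}
    (hv : v ∈ 𝕍.sl2.L0.eigenspace (h : ℂ)) {K : ℕ}
    (hK : ∀ k, K ≤ k → (𝕍.sl2.L1 ^ k) v = 0) (m : ℤ) (f : RatFunc ℂ) :
    oppTau c M (𝕍.sl2.Lm1 v ⊗ₜ[ℂ] (RatFunc.X ^ m * f)) =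
      (-(-1 : ℂ) ^ h) • ∑ q ∈ Finset.range K, (q.factorial : ℂ)⁻¹ •
        (oppTerm c M f (2 * h - q - m) (𝕍.sl2.Lm1 ((𝕍.sl2.L1 ^ q) v)) +
          (2 * (h : ℂ) - q) • oppTerm c M f (2 * h - q - 1 - m) ((𝕍.sl2.L1 ^ q) v)) := by
  have hw : 𝕍.sl2.Lm1 v ∈ 𝕍.sl2.L0.eigenspace ((h + 1 : ℤ) : ℂ) := by
    have := Lm1_mem_eigenspace 𝕍.sl2 hv
    exact_mod_cast this
  -- One more than `K`: the power `L(1)^{k+1}` of `L(-1)v` still involves `L(1)ᵏv`.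
  have hK' : ∀ k, K + 1 ≤ k → (𝕍.sl2.L1 ^ k) (𝕍.sl2.Lm1 v) = 0 := by
    intro k hk
    obtain ⟨k, rfl⟩ : ∃ l, k = l + 1 := ⟨k - 1, by omega⟩
    rw [L1_pow_Lm1 𝕍.sl2 hv, hK _ (by omega), hK _ (by omega), map_zero, smul_zero, add_zero]
  have hsign : (-1 : ℂ) ^ (h + 1) = -(-1 : ℂ) ^ h := by
    rw [zpow_add_one₀ (by norm_num)]; ring
  rw [oppTau_tmul c M hw hK', hsign]
  congr 1
  simp only [smul_add, Finset.sum_add_distrib]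
  have hT : ∑ q ∈ Finset.range K, (q.factorial : ℂ)⁻¹ •
      oppTerm c M f (2 * h - q - m) (𝕍.sl2.Lm1 ((𝕍.sl2.L1 ^ q) v)) =
      ∑ q ∈ Finset.range (K + 1), (q.factorial : ℂ)⁻¹ •
        oppTerm c M f (2 * h - q - m) (𝕍.sl2.Lm1 ((𝕍.sl2.L1 ^ q) v)) := by
    rw [Finset.sum_range_succ, hK K le_rfl]
    simp
  rw [hT, Finset.sum_range_succ', Finset.sum_range_succ', add_right_comm,
    ← Finset.sum_add_distrib]
  congr 1
  · refine Finset.sum_congr rfl fun k _ => ?_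
    rw [L1_pow_Lm1 𝕍.sl2 hv, map_add, map_smul, smul_add, smul_smul, smul_smul, ← mul_assoc,
      inv_factorial_succ_mul, show 2 * (h + 1) - 2 - ((k + 1 : ℕ) : ℤ) - m =
        2 * h - ((k + 1 : ℕ) : ℤ) - m by ring]
    congr 3
    push_cast
    ring_nf
  · rw [show 2 * (h + 1) - 2 - ((0 : ℕ) : ℤ) - m = 2 * h - ((0 : ℕ) : ℤ) - m by ring]
    simp

/-- An index shift using `1/k! = (k + 1)/(k + 1)!`; both ranges can be `K` because `g K = 0`. -/
theorem sum_inv_factorial_smul_succ {X : Type*} [AddCommGroup X] [Module ℂ X] {g : ℕ → X} {K : ℕ}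
    (hg : g K = 0) : ∑ k ∈ Finset.range K, (k.factorial : ℂ)⁻¹ • g (k + 1) =
      ∑ q ∈ Finset.range K, (q.factorial : ℂ)⁻¹ • (q : ℂ) • g q := by
  have hT : ∑ q ∈ Finset.range K, (q.factorial : ℂ)⁻¹ • (q : ℂ) • g q =
      ∑ q ∈ Finset.range (K + 1), (q.factorial : ℂ)⁻¹ • (q : ℂ) • g q := by
    rw [Finset.sum_range_succ, hg]
    simp
  rw [hT, Finset.sum_range_succ']
  simp only [Nat.cast_zero, zero_smul, smul_zero, add_zero]
  refine Finset.sum_congr rfl fun k _ => ?_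
  rw [smul_smul, Nat.cast_add_one, inv_factorial_succ_mul]

theorem oppTau_L1_tmul (c : ℂ) (M : MobiusModule 𝕍 W) {h : ℤ} {v : V}
    (hv : v ∈ 𝕍.sl2.L0.eigenspace (h : ℂ)) {K : ℕ}
    (hK : ∀ k, K ≤ k → (𝕍.sl2.L1 ^ k) v = 0) (m : ℤ) (f : RatFunc ℂ) :
    oppTau c M (𝕍.sl2.L1 v ⊗ₜ[ℂ] (RatFunc.X ^ m * f)) =
      (-(-1 : ℂ) ^ h) • ∑ q ∈ Finset.range K, (q.factorial : ℂ)⁻¹ •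
        (q : ℂ) • oppTerm c M f (2 * h - 3 - q - m) ((𝕍.sl2.L1 ^ q) v) := by
  have hw : 𝕍.sl2.L1 v ∈ 𝕍.sl2.L0.eigenspace ((h - 1 : ℤ) : ℂ) := by
    have := L1_pow_mem_eigenspace 𝕍.sl2 hv 1
    rw [pow_one] at this
    exact_mod_cast this
  have hs : ∀ k, (𝕍.sl2.L1 ^ k) (𝕍.sl2.L1 v) = (𝕍.sl2.L1 ^ (k + 1)) v := fun k => by
    rw [pow_succ, Module.End.mul_apply]
  have hK' : ∀ k, K ≤ k → (𝕍.sl2.L1 ^ k) (𝕍.sl2.L1 v) = 0 := fun k hk => by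
    rw [hs, hK _ (by omega)]
  have hsign : (-1 : ℂ) ^ (h - 1) = -(-1 : ℂ) ^ h := by
    rw [zpow_sub_one₀ (by norm_num)]; norm_num
  rw [oppTau_tmul c M hw hK', hsign]
  congr 1
  rw [← sum_inv_factorial_smul_succ (g := fun q => oppTerm c M f (2 * h - 3 - q - m)
    ((𝕍.sl2.L1 ^ q) v)) (by simp [hK K le_rfl])]
  refine Finset.sum_congr rfl fun k _ => ?_
  rw [hs, show 2 * (h - 1) - 2 - (k : ℤ) - m = 2 * h - 3 - (k + 1 : ℕ) - m by push_cast; ring]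

theorem end_lie_smul_sum {ι : Type*} (s : Finset ι) (a : ι → ℂ) (S : Module.End ℂ W)
    (T : ι → Module.End ℂ W) (c : ℂ) :
    ⁅S, c • ∑ i ∈ s, a i • T i⁆ = c • ∑ i ∈ s, a i • ⁅S, T i⁆ := by
  simp only [Ring.lie_def, mul_smul_comm, smul_mul_assoc, Finset.mul_sum, Finset.sum_mul,
    smul_sub, Finset.sum_sub_distrib]

variable (c : ℂ) (M : MobiusModule 𝕍 W)

/-- Linear identities in `v` need only be checked on weight vectors. -/
theorem weight_ext {X : Type*} [AddCommGroup X] [Module ℂ X] {Φ Ψ : V →ₗ[ℂ] X}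
    (𝕍 : MobiusVertexAlgebra A V)
    (h : ∀ (n : ℤ), ∀ v ∈ 𝕍.sl2.L0.eigenspace (n : ℂ), Φ v = Ψ v) : Φ = Ψ := by
  refine LinearMap.ext fun v => ?_
  have hle : (⨆ n : ℤ, 𝕍.sl2.L0.eigenspace (n : ℂ)) ≤ LinearMap.eqLocus Φ Ψ :=
    iSup_le fun n v hv => h n v hv
  exact hle (mem_iSup_eigenspace 𝕍 v)

/-- `v ↦ ⁅S, θ(v ⊗ f)⁆`. -/
def lieOppTau (S : Module.End ℂ W) (f : RatFunc ℂ) : V →ₗ[ℂ] Module.End ℂ W :=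
  (LinearMap.mulLeft ℂ S - LinearMap.mulRight ℂ S) ∘ₗ oppTau c M ∘ₗ
    (TensorProduct.mk ℂ V (RatFunc ℂ)).flip f

theorem lieOppTau_apply (S : Module.End ℂ W) (f : RatFunc ℂ) (v : V) :
    lieOppTau c M S f v = ⁅S, oppTau c M (v ⊗ₜ[ℂ] f)⁆ := by
  rw [Ring.lie_def]
  rfl

/-- `v ↦ θ(v ⊗ f)`. -/
def oppTauAt (f : RatFunc ℂ) : V →ₗ[ℂ] Module.End ℂ W :=
  oppTau c M ∘ₗ (TensorProduct.mk ℂ V (RatFunc ℂ)).flip f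

theorem oppTauAt_apply (f : RatFunc ℂ) (v : V) :
    oppTauAt c M f v = oppTau c M (v ⊗ₜ[ℂ] f) := rfl

theorem oppTau_tmul_zero {h : ℤ} {v : V} (hv : v ∈ 𝕍.sl2.L0.eigenspace (h : ℂ)) {K : ℕ}
    (hK : ∀ k, K ≤ k → (𝕍.sl2.L1 ^ k) v = 0) (f : RatFunc ℂ) :
    oppTau c M (v ⊗ₜ[ℂ] f) = (-1 : ℂ) ^ h • ∑ k ∈ Finset.range K,
      (k.factorial : ℂ)⁻¹ • oppTerm c M f (2 * h - 2 - k) ((𝕍.sl2.L1 ^ k) v) := by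
  have := oppTau_tmul c M hv hK 0 f
  simpa only [zpow_zero, one_mul, sub_zero] using this

/-- Passing to opposite operators replaces `t` by `t⁻¹` and exchanges `L(1)` with `L(-1)`: here
`L(1)` obeys, up to sign, the simple formula that `L(-1)` obeys for ordinary vertex operators. By
linearity in `v` a weight vector suffices, and the two expansions agree term by term after shifting
the `L(1)`-descendants. -/
theorem lie_L1_oppTau (v : V) (f : RatFunc ℂ) :
    ⁅(M.sl2.shift c).L1, oppTau c M (v ⊗ₜ[ℂ] f)⁆ = -oppTau c M (𝕍.sl2.Lm1 v ⊗ₜ[ℂ] f) := by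
  have key : lieOppTau c M (M.sl2.shift c).L1 f = -(oppTauAt c M f ∘ₗ 𝕍.sl2.Lm1) := by
    refine weight_ext 𝕍 fun h v hv => ?_
    obtain ⟨K, hK⟩ := L1_locally_nilpotent 𝕍 v
    have e := oppTau_Lm1_tmul c M hv hK 0 f
    rw [zpow_zero, one_mul] at e
    rw [lieOppTau_apply, oppTau_tmul_zero c M hv hK, end_lie_smul_sum, LinearMap.neg_apply,
      LinearMap.comp_apply, oppTauAt_apply, e, neg_smul, neg_neg]
    congr 1
    simp only [lie_L1_oppTerm, smul_add, Finset.sum_add_distrib]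
    have hT := sum_inv_factorial_smul_succ (K := K)
      (g := fun q => oppTerm c M f (2 * h - 1 - q) ((𝕍.sl2.L1 ^ q) v)) (by simp [hK K le_rfl])
    have hT' : ∑ q ∈ Finset.range K, (q.factorial : ℂ)⁻¹ •
        oppTerm c M f (2 * h - 2 - q) (𝕍.sl2.L1 ((𝕍.sl2.L1 ^ q) v)) =
        ∑ q ∈ Finset.range K, (q.factorial : ℂ)⁻¹ •
          (q : ℂ) • oppTerm c M f (2 * h - 1 - q) ((𝕍.sl2.L1 ^ q) v) := by
      rw [← hT]
      refine Finset.sum_congr rfl fun q _ => ?_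
      rw [← Module.End.mul_apply, ← pow_succ',
        show 2 * h - 2 - (q : ℤ) = 2 * h - 1 - (q + 1 : ℕ) by push_cast; ring]
    rw [hT']
    simp only [← Finset.sum_add_distrib]
    refine Finset.sum_congr rfl fun q _ => ?_
    rw [Module.End.mem_eigenspace_iff.mp (L1_pow_mem_eigenspace 𝕍.sl2 hv q), map_smul,
      show 2 * h - 2 - (q : ℤ) + 1 = 2 * h - 1 - q by ring,
      show 2 * h - 2 - (q : ℤ) + 2 = 2 * h - q by ring, sub_zero, sub_zero,
      show 2 * h - (q : ℤ) - 1 = 2 * h - 1 - q by ring]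
    module
  have := LinearMap.congr_fun key v
  rwa [lieOppTau_apply] at this

theorem lie_L0_oppTau (v : V) (f : RatFunc ℂ) :
    ⁅(M.sl2.shift c).L0, oppTau c M (v ⊗ₜ[ℂ] f)⁆ = -(oppTau c M (𝕍.sl2.L0 v ⊗ₜ[ℂ] f) +
      oppTau c M (𝕍.sl2.Lm1 v ⊗ₜ[ℂ] (RatFunc.X ^ (1 : ℤ) * f))) := by
  have key : lieOppTau c M (M.sl2.shift c).L0 f = -(oppTauAt c M f ∘ₗ 𝕍.sl2.L0 +
      oppTauAt c M (RatFunc.X ^ (1 : ℤ) * f) ∘ₗ 𝕍.sl2.Lm1) := by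
    refine weight_ext 𝕍 fun h v hv => ?_
    obtain ⟨K, hK⟩ := L1_locally_nilpotent 𝕍 v
    rw [lieOppTau_apply, oppTau_tmul_zero c M hv hK, end_lie_smul_sum, LinearMap.neg_apply,
      LinearMap.add_apply, LinearMap.comp_apply, LinearMap.comp_apply, oppTauAt_apply,
      oppTauAt_apply, oppTau_Lm1_tmul c M hv hK 1 f, Module.End.mem_eigenspace_iff.mp hv,
      ← TensorProduct.smul_tmul', map_smul, oppTau_tmul_zero c M hv hK, smul_comm (h : ℂ),
      neg_smul, ← sub_eq_add_neg, neg_sub, ← smul_sub]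
    congr 1
    rw [Finset.smul_sum, ← Finset.sum_sub_distrib]
    refine Finset.sum_congr rfl fun q _ => ?_
    rw [lie_L0_oppTerm, Module.End.mem_eigenspace_iff.mp (L1_pow_mem_eigenspace 𝕍.sl2 hv q),
      map_smul, show 2 * h - 2 - (q : ℤ) + 1 = 2 * h - q - 1 by ring,
      show 2 * h - (q : ℤ) - 1 - 1 = 2 * h - 2 - q by ring]
    module
  have := LinearMap.congr_fun key v
  rwa [lieOppTau_apply] at this

theorem lie_Lm1_oppTau (v : V) (f : RatFunc ℂ) :
    ⁅(M.sl2.shift c).Lm1, oppTau c M (v ⊗ₜ[ℂ] f)⁆ = -(oppTau c M (𝕍.sl2.L1 v ⊗ₜ[ℂ] f) +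
      (2 : ℂ) • oppTau c M (𝕍.sl2.L0 v ⊗ₜ[ℂ] (RatFunc.X ^ (1 : ℤ) * f)) +
      oppTau c M (𝕍.sl2.Lm1 v ⊗ₜ[ℂ] (RatFunc.X ^ (2 : ℤ) * f))) := by
  have key : lieOppTau c M (M.sl2.shift c).Lm1 f = -(oppTauAt c M f ∘ₗ 𝕍.sl2.L1 +
      (2 : ℂ) • (oppTauAt c M (RatFunc.X ^ (1 : ℤ) * f) ∘ₗ 𝕍.sl2.L0) +
      oppTauAt c M (RatFunc.X ^ (2 : ℤ) * f) ∘ₗ 𝕍.sl2.Lm1) := by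
    refine weight_ext 𝕍 fun h v hv => ?_
    obtain ⟨K, hK⟩ := L1_locally_nilpotent 𝕍 v
    have e := oppTau_L1_tmul c M hv hK 0 f
    rw [zpow_zero, one_mul] at e
    rw [lieOppTau_apply, oppTau_tmul_zero c M hv hK, end_lie_smul_sum, LinearMap.neg_apply,
      LinearMap.add_apply, LinearMap.add_apply, LinearMap.smul_apply, LinearMap.comp_apply,
      LinearMap.comp_apply, LinearMap.comp_apply, oppTauAt_apply, oppTauAt_apply,
      oppTauAt_apply, oppTau_Lm1_tmul c M hv hK 2 f, e, Module.End.mem_eigenspace_iff.mp hv,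
      ← TensorProduct.smul_tmul', map_smul, oppTau_tmul c M hv hK 1 f]
    -- Removes the common sign `(-1)^h`, leaving an identity of sums over the same descendants.
    have hsum : ∀ S₁ S₂ S₃ S₄ : Module.End ℂ W, S₁ = S₂ - (2 * (h : ℂ)) • S₃ + S₄ →
        (-1 : ℂ) ^ h • S₁ = -((-(-1 : ℂ) ^ h) • S₂ +
          (2 : ℂ) • (h : ℂ) • (-1 : ℂ) ^ h • S₃ + (-(-1 : ℂ) ^ h) • S₄) := by
      rintro S₁ S₂ S₃ S₄ rfl
      module
    refine hsum _ _ _ _ ?_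
    rw [Finset.smul_sum, ← Finset.sum_sub_distrib, ← Finset.sum_add_distrib]
    refine Finset.sum_congr rfl fun q _ => ?_
    rw [lie_Lm1_oppTerm, show 2 * h - 3 - (q : ℤ) - 0 = 2 * h - 3 - q by ring,
      show 2 * h - 2 - (q : ℤ) - 1 = 2 * h - 3 - q by ring,
      show 2 * h - (q : ℤ) - 2 = 2 * h - 2 - q by ring,
      show 2 * h - (q : ℤ) - 1 - 2 = 2 * h - 3 - q by ring]
    module
  have := LinearMap.congr_fun key v
  rwa [lieOppTau_apply] at this

/-- All terms of `(v ⊗ tᵐ)ᵒ` have the same `ad L(0)`-eigenvalue: for `L(1)^q v ⊗ t^{2h-2-q-m}` it is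
`(h - q) - (2h - 2 - q - m) - 1`, in which `q` cancels. -/
theorem lie_L0_oppTau_zpow {h : ℤ} {v : V} (hv : v ∈ 𝕍.sl2.L0.eigenspace (h : ℂ)) (m : ℤ) :
    ⁅(M.sl2.shift c).L0, oppTau c M (v ⊗ₜ[ℂ] (RatFunc.X ^ m))⁆ =
      (-((h : ℂ) - m - 1)) • oppTau c M (v ⊗ₜ[ℂ] (RatFunc.X ^ m)) := by
  obtain ⟨K, hK⟩ := L1_locally_nilpotent 𝕍 v
  have e := oppTau_tmul c M hv hK m 1
  rw [mul_one] at e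
  rw [e, end_lie_smul_sum, smul_comm]
  congr 1
  rw [Finset.smul_sum]
  refine Finset.sum_congr rfl fun q _ => ?_
  rw [oppTerm_apply, map_one, mul_one, lie_L0_shiftedTau_zpow M.covariant M.derivative _ c
    (Module.End.mem_eigenspace_iff.mp (L1_pow_mem_eigenspace 𝕍.sl2 hv q))]
  push_cast
  module

theorem L1_pow_mem_gr {α : A} {v : V} (hv : v ∈ 𝕍.gr α) (k : ℕ) :
    (𝕍.sl2.L1 ^ k) v ∈ 𝕍.gr α := by
  induction k with
  | zero => simpa using hv
  | succ k ih =>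
    rw [pow_succ', Module.End.mul_apply]
    exact 𝕍.L1_mem α _ ih

/-- `L(1)` preserves the degree in `A`, so every descendant, and hence every mode occurring, shifts
the degree by the same `α`. -/
theorem oppTau_mem_gr {h : ℤ} {α : A} {v : V} (hv : v ∈ 𝕍.sl2.L0.eigenspace (h : ℂ))
    (hα : v ∈ 𝕍.gr α) (f : RatFunc ℂ) {β : G} {w : W} (hw : w ∈ M.gr β) :
    oppTau c M (v ⊗ₜ[ℂ] f) w ∈ M.gr (α + β) := by
  obtain ⟨K, hK⟩ := L1_locally_nilpotent 𝕍 v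
  rw [oppTau_tmul_zero c M hv hK, LinearMap.smul_apply, LinearMap.sum_apply]
  refine Submodule.smul_mem _ _ (Submodule.sum_mem _ fun k _ => ?_)
  rw [LinearMap.smul_apply, oppTerm_apply, shiftedTau_tmul, laurentTau_apply]
  refine Submodule.smul_mem _ _ (finsum_induction (· ∈ M.gr (α + β)) (Submodule.zero_mem _)
    (fun _ _ => Submodule.add_mem _) fun n => ?_)
  exact Submodule.smul_mem _ _ (M.graded.mode_mem α β _ (L1_pow_mem_gr hα k) w hw n)

end OppSl2

/-! ### Operators on `(W₁ ⊗ W₂)*` induced by operators on the factors -/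

section DualAction

variable {W₁ W₂ : Type*} [AddCommGroup W₁] [Module ℂ W₁] [AddCommGroup W₂] [Module ℂ W₂]

/-- `(S₁, S₂) ↦ (S₁ ⊗ 1 + 1 ⊗ S₂)*`. -/
def dualAction : Module.End ℂ W₁ × Module.End ℂ W₂ →ₗ[ℂ]
    Module.End ℂ (Module.Dual ℂ (W₁ ⊗[ℂ] W₂)) :=
  Module.Dual.transpose ∘ₗ (LinearMap.rTensorHom W₂ ∘ₗ LinearMap.fst ℂ _ _ +
    LinearMap.lTensorHom W₁ ∘ₗ LinearMap.snd ℂ _ _)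

theorem dualAction_apply_tmul (S : Module.End ℂ W₁ × Module.End ℂ W₂)
    (lam : Module.Dual ℂ (W₁ ⊗[ℂ] W₂)) (w₁ : W₁) (w₂ : W₂) :
    dualAction S lam (w₁ ⊗ₜ[ℂ] w₂) = lam (S.1 w₁ ⊗ₜ[ℂ] w₂) + lam (w₁ ⊗ₜ[ℂ] S.2 w₂) := by
  simp [dualAction, Module.Dual.transpose_apply]

/-- Operators on different tensor factors commute, so the cross terms cancel; transposition produces
the minus signs. -/
theorem lie_dualAction (S T : Module.End ℂ W₁ × Module.End ℂ W₂) :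
    ⁅dualAction S, dualAction T⁆ = dualAction (-⁅S.1, T.1⁆, -⁅S.2, T.2⁆) := by
  refine LinearMap.ext fun lam => TensorProduct.ext' fun w₁ w₂ => ?_
  rw [Ring.lie_def, Ring.lie_def, Ring.lie_def]
  simp only [LinearMap.sub_apply, Module.End.mul_apply, dualAction_apply_tmul,
    LinearMap.neg_apply, TensorProduct.neg_tmul, TensorProduct.tmul_neg, TensorProduct.sub_tmul,
    TensorProduct.tmul_sub, map_neg, map_sub]
  ring

end DualAction

/-! ### The operators `τ_{P(z)}` and `L'_{P(z)}(j)` as dual actions -/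

section Pz

variable {G V W₁ W₂ : Type*} [AddCommGroup G] {A : AddSubgroup G}
  [AddCommGroup V] [Module ℂ V] [AddCommGroup W₁] [Module ℂ W₁] [AddCommGroup W₂] [Module ℂ W₂]
  {𝕍 : MobiusVertexAlgebra A V} (z : ℂ) (M₁ : MobiusModule 𝕍 W₁) (M₂ : MobiusModule 𝕍 W₂)

/-- The untranslated action on `W₂` is the shift by `0`, so both factors are covered by the same
lemmas. -/
theorem tauP_eq_dualAction (ξ : V ⊗[ℂ] RatFunc ℂ) :
    tauP z M₁ M₂ ξ = dualAction (oppTau z M₁ ξ, oppTau 0 M₂ ξ) := by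
  rw [oppTau, oppTau, shiftedTau_zero]
  rfl

theorem mobiusOps_Lm1 : (mobiusOps z M₁ M₂).Lm1 =
    dualAction ((M₁.sl2.shift z).L1, (M₂.sl2.shift 0).L1) := by
  refine LinearMap.ext fun lam => TensorProduct.ext' fun w₁ w₂ => ?_
  simp [mobiusOps, dualAction_apply_tmul, Sl2Rep.shift, Module.Dual.transpose_apply,
    TensorProduct.add_tmul, ← TensorProduct.smul_tmul']
  ring

theorem mobiusOps_L0 : (mobiusOps z M₁ M₂).L0 =
    dualAction ((M₁.sl2.shift z).L0, (M₂.sl2.shift 0).L0) := by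
  refine LinearMap.ext fun lam => TensorProduct.ext' fun w₁ w₂ => ?_
  simp [mobiusOps, dualAction_apply_tmul, Sl2Rep.shift, Module.Dual.transpose_apply,
    TensorProduct.add_tmul, ← TensorProduct.smul_tmul']
  ring

theorem mobiusOps_L1 : (mobiusOps z M₁ M₂).L1 =
    dualAction ((M₁.sl2.shift z).Lm1, (M₂.sl2.shift 0).Lm1) := by
  refine LinearMap.ext fun lam => TensorProduct.ext' fun w₁ w₂ => ?_
  simp [mobiusOps, dualAction_apply_tmul, Sl2Rep.shift, Module.Dual.transpose_apply]
  ring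

/-! ### Commutators with `τ_{P(z)}` -/

/-- The minus sign of `lie_oppTau` cancels that of `lie_dualAction`. A common bound for the two
factors makes their sums match, and it depends neither on `m` nor on `f`. -/
theorem lie_tauMode_tauP (u v : V) : ∃ I : ℕ, ∀ (m : ℤ) (f : RatFunc ℂ),
    ⁅tauMode z M₁ M₂ u m, tauP z M₁ M₂ (v ⊗ₜ[ℂ] f)⁆ = ∑ i ∈ Finset.range I, zchoose m i •
      tauP z M₁ M₂ (𝕍.Y u i v ⊗ₜ[ℂ] (RatFunc.X ^ (m - i) * f)) := by
  obtain ⟨I, hI⟩ := lie_oppTau z M₁ u v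
  obtain ⟨I', hI'⟩ := lie_oppTau 0 M₂ u v
  refine ⟨max I I', fun m f => ?_⟩
  rw [tauMode, tauP_eq_dualAction, tauP_eq_dualAction, lie_dualAction,
    hI _ (le_max_left I I'), hI' _ (le_max_right I I'), neg_neg, neg_neg]
  simp only [tauP_eq_dualAction, ← map_smul, ← map_sum]
  congr 1
  ext1 <;> simp [Prod.fst_sum, Prod.snd_sum]

theorem lie_Lm1_tauP (v : V) (f : RatFunc ℂ) :
    ⁅(mobiusOps z M₁ M₂).Lm1, tauP z M₁ M₂ (v ⊗ₜ[ℂ] f)⁆ =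
      tauP z M₁ M₂ (𝕍.sl2.Lm1 v ⊗ₜ[ℂ] f) := by
  rw [mobiusOps_Lm1, tauP_eq_dualAction, tauP_eq_dualAction, lie_dualAction, lie_L1_oppTau,
    lie_L1_oppTau, neg_neg, neg_neg]

theorem lie_L0_tauP (v : V) (f : RatFunc ℂ) :
    ⁅(mobiusOps z M₁ M₂).L0, tauP z M₁ M₂ (v ⊗ₜ[ℂ] f)⁆ = tauP z M₁ M₂ (𝕍.sl2.L0 v ⊗ₜ[ℂ] f) +
      tauP z M₁ M₂ (𝕍.sl2.Lm1 v ⊗ₜ[ℂ] (RatFunc.X ^ (1 : ℤ) * f)) := by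
  simp only [mobiusOps_L0, tauP_eq_dualAction, lie_dualAction, lie_L0_oppTau, neg_neg,
    ← map_add dualAction]
  rfl

theorem lie_L1_tauP (v : V) (f : RatFunc ℂ) :
    ⁅(mobiusOps z M₁ M₂).L1, tauP z M₁ M₂ (v ⊗ₜ[ℂ] f)⁆ = tauP z M₁ M₂ (𝕍.sl2.L1 v ⊗ₜ[ℂ] f) +
      (2 : ℂ) • tauP z M₁ M₂ (𝕍.sl2.L0 v ⊗ₜ[ℂ] (RatFunc.X ^ (1 : ℤ) * f)) +
      tauP z M₁ M₂ (𝕍.sl2.Lm1 v ⊗ₜ[ℂ] (RatFunc.X ^ (2 : ℤ) * f)) := by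
  simp only [mobiusOps_L1, tauP_eq_dualAction, lie_dualAction, lie_Lm1_oppTau, neg_neg,
    ← map_add dualAction, ← map_smul dualAction]
  rfl

theorem lie_L0_tauMode {h : ℤ} {v : V} (hv : v ∈ 𝕍.sl2.L0.eigenspace (h : ℂ)) (m : ℤ) :
    ⁅(mobiusOps z M₁ M₂).L0, tauMode z M₁ M₂ v m⁆ =
      ((h : ℂ) - m - 1) • tauMode z M₁ M₂ v m := by
  rw [mobiusOps_L0, tauMode, tauP_eq_dualAction, lie_dualAction, lie_L0_oppTau_zpow _ _ hv,
    lie_L0_oppTau_zpow _ _ hv, ← neg_smul, ← neg_smul, neg_neg, ← map_smul dualAction]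
  rfl

theorem lie_L0_Lm1 :
    ⁅(mobiusOps z M₁ M₂).L0, (mobiusOps z M₁ M₂).Lm1⁆ = (1 : ℂ) • (mobiusOps z M₁ M₂).Lm1 := by
  rw [mobiusOps_L0, mobiusOps_Lm1, lie_dualAction, Sl2Rep.bracket_L0_L1, Sl2Rep.bracket_L0_L1,
    neg_neg, neg_neg, one_smul]

theorem lie_L0_L1 :
    ⁅(mobiusOps z M₁ M₂).L0, (mobiusOps z M₁ M₂).L1⁆ = (-1 : ℂ) • (mobiusOps z M₁ M₂).L1 := by
  rw [mobiusOps_L0, mobiusOps_L1, lie_dualAction, Sl2Rep.bracket_L0_Lm1, Sl2Rep.bracket_L0_Lm1,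
    ← map_smul dualAction]
  simp

theorem lie_L0_L0 :
    ⁅(mobiusOps z M₁ M₂).L0, (mobiusOps z M₁ M₂).L0⁆ = (0 : ℂ) • (mobiusOps z M₁ M₂).L0 := by
  rw [Ring.lie_def, sub_self, zero_smul]

/-! ### Stability of the space of compatible functionals -/

/-- An operator whose commutators with the `τ_{P(z)}(v ⊗ f)` are finite sums of operators
`τ_{P(z)}(v' ⊗ tᵏf)` preserves the compatibility condition. -/
theorem COMP_stable_of_lie (O : Module.End ℂ (Module.Dual ℂ (W₁ ⊗[ℂ] W₂)))
    (hO : ∀ v : V, ∃ (I : ℕ) (a : Fin I → ℂ) (x : Fin I → V) (k : Fin I → ℤ), ∀ f : RatFunc ℂ,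
      ⁅O, tauP z M₁ M₂ (v ⊗ₜ[ℂ] f)⁆ =
        ∑ i, a i • tauP z M₁ M₂ (x i ⊗ₜ[ℂ] (RatFunc.X ^ k i * f)))
    (lam : Module.Dual ℂ (W₁ ⊗[ℂ] W₂)) (hlam : lam ∈ COMP z M₁ M₂) : O lam ∈ COMP z M₁ M₂ := by
  obtain ⟨htr, hcomp⟩ := hlam
  have htr' : ∀ (v : V) (k : ℤ), ∀ᶠ n : ℤ in Filter.atTop,
      tauMode z M₁ M₂ v (k + n) lam = 0 := by
    intro v k
    have := Filter.eventually_atTop.mpr (htr v)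
    exact (Filter.tendsto_atTop_add_const_left _ k Filter.tendsto_id).eventually this
  choose I a x k hO using hO
  have hcomm : ∀ (v : V) (f : RatFunc ℂ), tauP z M₁ M₂ (v ⊗ₜ[ℂ] f) (O lam) =
      O (tauP z M₁ M₂ (v ⊗ₜ[ℂ] f) lam) - ∑ i, a v i •
        tauP z M₁ M₂ (x v i ⊗ₜ[ℂ] (RatFunc.X ^ k v i * f)) lam := by
    intro v f
    have := LinearMap.congr_fun (hO v f) lam
    rw [Ring.lie_def, LinearMap.sub_apply, Module.End.mul_apply, Module.End.mul_apply,
      LinearMap.sum_apply] at this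
    simp only [LinearMap.smul_apply] at this
    rw [← this, sub_sub_cancel]
  have hmode : ∀ (v : V) (n : ℤ), tauMode z M₁ M₂ v n (O lam) =
      O (tauMode z M₁ M₂ v n lam) - ∑ i, a v i • tauMode z M₁ M₂ (x v i) (k v i + n) lam := by
    intro v n
    rw [tauMode, hcomm]
    simp only [← zpow_add₀ (RatFunc.X_ne_zero (K := ℂ))]
    rfl
  refine ⟨fun v => Filter.eventually_atTop.mp ?_, fun v m n => ?_⟩
  · filter_upwards [htr' v 0, Filter.eventually_all.mpr fun i => htr' (x v i) (k v i)] with n h1 h2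
    rw [zero_add] at h1
    rw [hmode, h1, map_zero, zero_sub, neg_eq_zero]
    exact Finset.sum_eq_zero fun i _ => by rw [h2 i, smul_zero]
  -- One cutoff for `v` and all the finitely many `x v i` turns every sum in the compatibility
  -- identity into a sum over the same finite range.
  · obtain ⟨S, hS⟩ : ∃ S : ℕ, ∀ s : ℕ, S ≤ s → tauMode z M₁ M₂ v (m - n + s) lam = 0 ∧
        ∀ i, tauMode z M₁ M₂ (x v i) (k v i + (m - n + s)) lam = 0 := by
      have h1 := htr' v (m - n)
      have h2 : ∀ᶠ s : ℤ in Filter.atTop, ∀ i,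
          tauMode z M₁ M₂ (x v i) (k v i + (m - n) + s) lam = 0 :=
        Filter.eventually_all.mpr fun i => htr' (x v i) (k v i + (m - n))
      obtain ⟨S, hS⟩ := Filter.eventually_atTop.mp
        (tendsto_natCast_atTop_atTop.eventually (h1.and h2))
      refine ⟨S, fun s hs => ⟨(hS s hs).1, fun i => ?_⟩⟩
      rw [← add_assoc]
      exact (hS s hs).2 i
    have hsum : ∀ (b : ℕ → ℂ) (g : ℕ → Module.Dual ℂ (W₁ ⊗[ℂ] W₂)), (∀ s, S ≤ s → g s = 0) →
        ∑ᶠ s : ℕ, b s • g s = ∑ s ∈ Finset.range S, b s • g s := by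
      intro b g hg
      refine finsum_eq_sum_of_support_subset _ fun s hs => ?_
      by_contra hc
      simp only [Finset.coe_range, Set.mem_Iio, not_lt] at hc
      exact hs (by simp [hg s hc])
    -- The extra power of `t` is absorbed into `m`, so compatibility of `lam` applies to each
    -- commutator term.
    have hX : ∀ i, (RatFunc.X : RatFunc ℂ) ^ k v i * ((RatFunc.X⁻¹ - RatFunc.C z) ^ n *
        RatFunc.X ^ m) = (RatFunc.X⁻¹ - RatFunc.C z) ^ n * RatFunc.X ^ (k v i + m) := by
      intro i
      rw [zpow_add₀ RatFunc.X_ne_zero]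
      ring
    have hidx : ∀ i (s : ℕ), k v i + m - n + (s : ℤ) = k v i + (m - n + s) := fun i s => by ring
    rw [hcomm, hcomp]
    simp only [hX, hcomp, hidx]
    rw [hsum _ _ fun s hs => (hS s hs).1, hsum _ _ fun s hs => by
      rw [hmode, (hS s hs).1, map_zero, zero_sub, neg_eq_zero]
      exact Finset.sum_eq_zero fun i _ => by rw [(hS s hs).2 i, smul_zero]]
    have h3 : ∀ i, ∑ᶠ s : ℕ, (((Ring.choose n s : ℤ) : ℂ) * (-z) ^ s) •
        tauMode z M₁ M₂ (x v i) (k v i + (m - n + s)) lam =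
        ∑ s ∈ Finset.range S, (((Ring.choose n s : ℤ) : ℂ) * (-z) ^ s) •
          tauMode z M₁ M₂ (x v i) (k v i + (m - n + s)) lam := fun i =>
      hsum _ _ fun s hs => (hS s hs).2 i
    simp only [h3, hmode, smul_sub, Finset.sum_sub_distrib, map_sum, map_smul, Finset.smul_sum]
    congr 1
    rw [Finset.sum_comm]
    exact Finset.sum_congr rfl fun s _ => Finset.sum_congr rfl fun i _ => smul_comm _ _ _

theorem tauStable_COMP : TauStable z M₁ M₂ (COMP z M₁ M₂) := by
  intro lam hlam u m
  refine COMP_stable_of_lie z M₁ M₂ _ (fun v => ?_) lam hlam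
  obtain ⟨I, hI⟩ := lie_tauMode_tauP z M₁ M₂ u v
  exact ⟨I, fun i => zchoose m i, fun i => 𝕍.Y u (i : ℕ) v, fun i => m - (i : ℕ), fun f => by
    rw [hI, Finset.sum_range]⟩

theorem mobiusOps_stable_COMP : (mobiusOps z M₁ M₂).Stable (COMP z M₁ M₂) := by
  intro lam hlam
  refine ⟨COMP_stable_of_lie z M₁ M₂ _ (fun v => ?_) lam hlam,
    COMP_stable_of_lie z M₁ M₂ _ (fun v => ?_) lam hlam,
    COMP_stable_of_lie z M₁ M₂ _ (fun v => ?_) lam hlam⟩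
  · exact ⟨1, ![1], ![𝕍.sl2.Lm1 v], ![0], fun f => by simp [lie_Lm1_tauP]⟩
  · exact ⟨2, ![1, 1], ![𝕍.sl2.L0 v, 𝕍.sl2.Lm1 v], ![0, 1], fun f => by simp [lie_L0_tauP]⟩
  · exact ⟨3, ![1, 2, 1], ![𝕍.sl2.L1 v, 𝕍.sl2.L0 v, 𝕍.sl2.Lm1 v], ![0, 1, 2], fun f => by
      rw [lie_L1_tauP]; simp [Fin.sum_univ_three]⟩

end Pz

/-! ### Stability of the local grading restriction -/

section Lgr

variable {D : Type*} [AddCommGroup D] [Module ℂ D]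

/-- If the sum of the homogeneous subspaces is stable under the operators in `T`, then so is the
space of elements satisfying the local grading restriction. -/
theorem lgr_stable {G : Type*} {E : ℂ × G → Submodule ℂ D} (hE : iSupIndep E)
    {T : Set (Module.End ℂ D)} (hT : ∀ f ∈ T, ∀ p, ∀ x ∈ E p, f x ∈ ⨆ i, E i)
    {f : Module.End ℂ D} (hf : f ∈ T) {lam : D} (hlam : lam ∈ lgr E hE T) :
    f lam ∈ lgr E hE T := by
  obtain ⟨hmem, hfin⟩ := hlam
  have hstab : ∀ f ∈ T, ∀ x ∈ ⨆ i, E i, f x ∈ ⨆ i, E i := by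
    intro f hf x hx
    have hle : (⨆ i, E i) ≤ (⨆ i, E i).comap f := iSup_le fun p x hx => hT f hf p x hx
    exact hle hx
  -- Every subspace admissible for `lam` contains `f lam` and is admissible for it, so the minimal
  -- subspace can only shrink.
  have hle : gradedSpan E T (f lam) ≤ gradedSpan E T lam :=
    sInf_le_sInf fun P hP => ⟨hP.1, hP.2.2 f hf lam hP.2.1, hP.2.2⟩
  refine ⟨hstab f hf lam hmem, fun n β => ⟨?_, ?_⟩⟩
  · have := (hfin n β).1
    exact Submodule.finiteDimensional_of_le (inf_le_inf_right _ hle)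
  · obtain ⟨K, hK⟩ := (hfin n β).2
    exact ⟨K, fun k hk => le_bot_iff.mp (le_trans (inf_le_inf_right _ hle) (hK k hk).le)⟩

/-- Semiconjugacy passes to powers, which is what generalized eigenvectors require. -/
theorem semiconj_of_lie {L T : Module.End ℂ D} {c : ℂ} (h : ⁅L, T⁆ = c • T) (n : ℂ) :
    SemiconjBy T (L - n • (1 : Module.End ℂ D)) (L - (n + c) • (1 : Module.End ℂ D)) := by
  rw [Ring.lie_def] at h
  rw [SemiconjBy]
  simp only [mul_sub, sub_mul, mul_smul_comm, smul_mul_assoc, mul_one, one_mul]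
  linear_combination (norm := module) (-1 : ℂ) • h

theorem mem_eigenspace_of_lie {L T : Module.End ℂ D} {c : ℂ} (h : ⁅L, T⁆ = c • T) {n : ℂ} {x : D}
    (hx : x ∈ L.eigenspace n) : T x ∈ L.eigenspace (n + c) := by
  rw [Module.End.mem_eigenspace_iff] at hx ⊢
  have := LinearMap.congr_fun h x
  rw [Ring.lie_def, LinearMap.sub_apply, Module.End.mul_apply, Module.End.mul_apply, hx,
    map_smul, LinearMap.smul_apply, sub_eq_iff_eq_add] at this
  rw [this]
  module

theorem mem_maxGenEigenspace_of_lie {L T : Module.End ℂ D} {c : ℂ} (h : ⁅L, T⁆ = c • T) {n : ℂ}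
    {x : D} (hx : x ∈ L.maxGenEigenspace n) : T x ∈ L.maxGenEigenspace (n + c) := by
  rw [Module.End.mem_maxGenEigenspace] at hx ⊢
  obtain ⟨k, hk⟩ := hx
  refine ⟨k, ?_⟩
  have := LinearMap.congr_fun ((semiconj_of_lie h n).pow_right k).eq x
  rw [Module.End.mul_apply, Module.End.mul_apply, hk, map_zero] at this
  exact this.symm

end Lgr

/-! ### Effect of the operators on weights and on `Ã`-degrees -/

section PzLgr

variable {G V W₁ W₂ : Type*} [AddCommGroup G] {A : AddSubgroup G}
  [AddCommGroup V] [Module ℂ V] [AddCommGroup W₁] [Module ℂ W₁] [AddCommGroup W₂] [Module ℂ W₂]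
  {𝕍 : MobiusVertexAlgebra A V} (z : ℂ) (M₁ : MobiusModule 𝕍 W₁) (M₂ : MobiusModule 𝕍 W₂)

/-- A functional of degree `β` sees only degree `-β`. Both terms evaluate `lam` in degree `α + γ`,
so they vanish unless `γ = -(α + β)`. -/
theorem dualAction_mem_dualGr {S : Module.End ℂ W₁ × Module.End ℂ W₂} {α : G}
    (h₁ : ∀ β, ∀ w ∈ M₁.gr β, S.1 w ∈ M₁.gr (α + β))
    (h₂ : ∀ β, ∀ w ∈ M₂.gr β, S.2 w ∈ M₂.gr (α + β)) {β : G}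
    {lam : Module.Dual ℂ (W₁ ⊗[ℂ] W₂)} (hlam : lam ∈ dualGr M₁ M₂ β) :
    dualAction S lam ∈ dualGr M₁ M₂ (α + β) := by
  intro γ hγ t ht
  have hγ' : α + γ ≠ -β := fun e => hγ (by rw [neg_add, ← e]; abel)
  have hle : tensorGr M₁ M₂ γ ≤ LinearMap.ker (dualAction S lam) := by
    refine Submodule.span_le.mpr ?_
    rintro _ ⟨β₁, β₂, rfl, w₁, hw₁, w₂, hw₂, rfl⟩
    rw [SetLike.mem_coe, LinearMap.mem_ker, dualAction_apply_tmul,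
      hlam _ hγ' _ (Submodule.subset_span
        ⟨α + β₁, β₂, add_assoc _ _ _, _, h₁ β₁ w₁ hw₁, _, hw₂, rfl⟩),
      hlam _ hγ' _ (Submodule.subset_span
        ⟨β₁, α + β₂, add_left_comm _ _ _, _, hw₁, _, h₂ β₂ w₂ hw₂, rfl⟩), add_zero]
  exact hle ht

theorem tauMode_mem_dualGr {h : ℤ} {α : A} {v : V} (hv : v ∈ 𝕍.sl2.L0.eigenspace (h : ℂ))
    (hα : v ∈ 𝕍.gr α) (m : ℤ) {β : G} {lam : Module.Dual ℂ (W₁ ⊗[ℂ] W₂)}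
    (hlam : lam ∈ dualGr M₁ M₂ β) : tauMode z M₁ M₂ v m lam ∈ dualGr M₁ M₂ (α + β) := by
  rw [tauMode, tauP_eq_dualAction]
  exact dualAction_mem_dualGr M₁ M₂ (fun _ _ hw => oppTau_mem_gr z M₁ hv hα _ hw)
    (fun _ _ hw => oppTau_mem_gr 0 M₂ hv hα _ hw) hlam

theorem shift_mem_gr {W : Type*} [AddCommGroup W] [Module ℂ W] (M : MobiusModule 𝕍 W) (c : ℂ)
    (β : G) (w : W) (hw : w ∈ M.gr β) : (M.sl2.shift c).Lm1 w ∈ M.gr (0 + β) ∧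
      (M.sl2.shift c).L0 w ∈ M.gr (0 + β) ∧ (M.sl2.shift c).L1 w ∈ M.gr (0 + β) := by
  rw [zero_add]
  have h0 := M.L0_mem β w hw
  have hm := M.Lm1_mem β w hw
  have h1 := M.L1_mem β w hw
  exact ⟨hm, Submodule.add_mem _ h0 (Submodule.smul_mem _ _ hm),
    Submodule.add_mem _ (Submodule.add_mem _ h1 (Submodule.smul_mem _ _ h0))
      (Submodule.smul_mem _ _ hm)⟩

theorem mobiusOps_mem_dualGr {β : G} {lam : Module.Dual ℂ (W₁ ⊗[ℂ] W₂)}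
    (hlam : lam ∈ dualGr M₁ M₂ β) : (mobiusOps z M₁ M₂).Lm1 lam ∈ dualGr M₁ M₂ (0 + β) ∧
      (mobiusOps z M₁ M₂).L0 lam ∈ dualGr M₁ M₂ (0 + β) ∧
      (mobiusOps z M₁ M₂).L1 lam ∈ dualGr M₁ M₂ (0 + β) := by
  rw [mobiusOps_Lm1, mobiusOps_L0, mobiusOps_L1]
  refine ⟨dualAction_mem_dualGr M₁ M₂ (fun β w hw => ?_) (fun β w hw => ?_) hlam,
    dualAction_mem_dualGr M₁ M₂ (fun β w hw => ?_) (fun β w hw => ?_) hlam,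
    dualAction_mem_dualGr M₁ M₂ (fun β w hw => ?_) (fun β w hw => ?_) hlam⟩
  · exact (shift_mem_gr M₁ z β w hw).2.2
  · exact (shift_mem_gr M₂ 0 β w hw).2.2
  · exact (shift_mem_gr M₁ z β w hw).2.1
  · exact (shift_mem_gr M₂ 0 β w hw).2.1
  · exact (shift_mem_gr M₁ z β w hw).1
  · exact (shift_mem_gr M₂ 0 β w hw).1

theorem iSup_gr_inf_eigenspace (𝕍 : MobiusVertexAlgebra A V) :
    ⨆ (α : A) (n : ℤ), 𝕍.gr α ⊓ 𝕍.sl2.L0.eigenspace (n : ℂ) = ⊤ := by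
  simp only [← 𝕍.graded.compatible, 𝕍.graded.span]

/-- The sum of the homogeneous subspaces of `(W₁ ⊗ W₂)*` is stable under the operators
`τ_{P(z)}(v ⊗ tᵐ)` and `L'_{P(z)}(j)`; here the homogeneous subspaces are cut out by any family
`F` of subspaces shifted by eigenoperators of `ad L'_{P(z)}(0)`. -/
theorem pzOperators_mem_iSup {F : ℂ → Submodule ℂ (Module.Dual ℂ (W₁ ⊗[ℂ] W₂))}
    (hF : ∀ (T : Module.End ℂ (Module.Dual ℂ (W₁ ⊗[ℂ] W₂))) (c : ℂ),
      ⁅(mobiusOps z M₁ M₂).L0, T⁆ = c • T → ∀ n, ∀ x ∈ F n, T x ∈ F (n + c))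
    (f : Module.End ℂ (Module.Dual ℂ (W₁ ⊗[ℂ] W₂)))
    (hf : f ∈ pzOperators z M₁ M₂ (mobiusOps z M₁ M₂)) (p : ℂ × G)
    (x : Module.Dual ℂ (W₁ ⊗[ℂ] W₂)) (hx : x ∈ F p.1 ⊓ dualGr M₁ M₂ p.2) :
    f x ∈ ⨆ q : ℂ × G, F q.1 ⊓ dualGr M₁ M₂ q.2 := by
  have hd := mobiusOps_mem_dualGr z M₁ M₂ hx.2
  rcases hf with ⟨v, m, rfl⟩ | rfl | rfl | rfl
  -- A general `v` is not homogeneous, so its image may have many components; linearity in `v`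
  -- reduces to `v` homogeneous for both gradings.
  · let ev : V →ₗ[ℂ] Module.Dual ℂ (W₁ ⊗[ℂ] W₂) :=
      LinearMap.applyₗ x ∘ₗ tauP z M₁ M₂ ∘ₗ
        (TensorProduct.mk ℂ V (RatFunc ℂ)).flip (RatFunc.X ^ m)
    have hle : (⨆ (α : A) (n : ℤ), 𝕍.gr α ⊓ 𝕍.sl2.L0.eigenspace (n : ℂ)) ≤
        (⨆ q : ℂ × G, F q.1 ⊓ dualGr M₁ M₂ q.2).comap ev := by
      refine iSup_le fun α => iSup_le fun h v hv => ?_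
      exact Submodule.mem_iSup_of_mem (p := fun q : ℂ × G => F q.1 ⊓ dualGr M₁ M₂ q.2)
        (p.1 + ((h : ℂ) - m - 1), (α : G) + p.2)
        ⟨hF _ _ (lie_L0_tauMode z M₁ M₂ hv.2 m) _ x hx.1,
          tauMode_mem_dualGr z M₁ M₂ hv.2 hv.1 m hx.2⟩
    rw [iSup_gr_inf_eigenspace] at hle
    exact hle (Submodule.mem_top (x := v))
  · exact Submodule.mem_iSup_of_mem (p := fun q : ℂ × G => F q.1 ⊓ dualGr M₁ M₂ q.2)
      (p.1 + 1, 0 + p.2) ⟨hF _ _ (lie_L0_Lm1 z M₁ M₂) _ x hx.1, hd.1⟩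
  · exact Submodule.mem_iSup_of_mem (p := fun q : ℂ × G => F q.1 ⊓ dualGr M₁ M₂ q.2)
      (p.1 + 0, 0 + p.2) ⟨hF _ _ (lie_L0_L0 z M₁ M₂) _ x hx.1, hd.2.1⟩
  · exact Submodule.mem_iSup_of_mem (p := fun q : ℂ × G => F q.1 ⊓ dualGr M₁ M₂ q.2)
      (p.1 + -1, 0 + p.2) ⟨hF _ _ (lie_L0_L1 z M₁ M₂) _ x hx.1, hd.2.2⟩

theorem mem_LGRgen_of_mem_pzOperators {f : Module.End ℂ (Module.Dual ℂ (W₁ ⊗[ℂ] W₂))}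
    (hf : f ∈ pzOperators z M₁ M₂ (mobiusOps z M₁ M₂)) {lam : Module.Dual ℂ (W₁ ⊗[ℂ] W₂)}
    (hlam : lam ∈ LGRgen z M₁ M₂ (mobiusOps z M₁ M₂)) :
    f lam ∈ LGRgen z M₁ M₂ (mobiusOps z M₁ M₂) :=
  lgr_stable _ (pzOperators_mem_iSup z M₁ M₂
    (F := fun n => (mobiusOps z M₁ M₂).L0.maxGenEigenspace n)
    fun _ _ h _ _ hx => mem_maxGenEigenspace_of_lie h hx) hf hlam

theorem mem_LGRss_of_mem_pzOperators {f : Module.End ℂ (Module.Dual ℂ (W₁ ⊗[ℂ] W₂))}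
    (hf : f ∈ pzOperators z M₁ M₂ (mobiusOps z M₁ M₂)) {lam : Module.Dual ℂ (W₁ ⊗[ℂ] W₂)}
    (hlam : lam ∈ LGRss z M₁ M₂ (mobiusOps z M₁ M₂)) :
    f lam ∈ LGRss z M₁ M₂ (mobiusOps z M₁ M₂) :=
  lgr_stable _ (pzOperators_mem_iSup z M₁ M₂
    (F := fun n => (mobiusOps z M₁ M₂).L0.eigenspace n)
    fun _ _ h _ _ hx => mem_eigenspace_of_lie h hx) hf hlam

theorem stable_of_mem_pzOperators {L : SlOps (Module.Dual ℂ (W₁ ⊗[ℂ] W₂))}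
    {S : Submodule ℂ (Module.Dual ℂ (W₁ ⊗[ℂ] W₂))}
    (h : ∀ f ∈ pzOperators z M₁ M₂ L, ∀ lam ∈ S, f lam ∈ S) :
    TauStable z M₁ M₂ S ∧ L.Stable S :=
  ⟨fun lam hlam v n => h _ (Or.inl ⟨v, n, rfl⟩) lam hlam, fun lam hlam =>
    ⟨h _ (Or.inr (Or.inl rfl)) lam hlam, h _ (Or.inr (Or.inr (Or.inl rfl))) lam hlam,
      h _ (Or.inr (Or.inr (Or.inr rfl))) lam hlam⟩⟩

/-- The three stability statements in the Möbius case. -/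
theorem mobius_stable :
    (TauStable z M₁ M₂ (COMP z M₁ M₂) ∧ (mobiusOps z M₁ M₂).Stable (COMP z M₁ M₂)) ∧
    (TauStable z M₁ M₂ (LGRgen z M₁ M₂ (mobiusOps z M₁ M₂)) ∧
      (mobiusOps z M₁ M₂).Stable (LGRgen z M₁ M₂ (mobiusOps z M₁ M₂))) ∧
    (TauStable z M₁ M₂ (LGRss z M₁ M₂ (mobiusOps z M₁ M₂)) ∧
      (mobiusOps z M₁ M₂).Stable (LGRss z M₁ M₂ (mobiusOps z M₁ M₂))) :=
  ⟨⟨tauStable_COMP z M₁ M₂, mobiusOps_stable_COMP z M₁ M₂⟩,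
    stable_of_mem_pzOperators z M₁ M₂ fun _ hf _ h => mem_LGRgen_of_mem_pzOperators z M₁ M₂ hf h,
    stable_of_mem_pzOperators z M₁ M₂ fun _ hf _ h => mem_LGRss_of_mem_pzOperators z M₁ M₂ hf h⟩

end PzLgr

/-! ### The conformal case -/

section Conformal

variable {G V W W₁ W₂ : Type*} [AddCommGroup G] {A : AddSubgroup G}
  [AddCommGroup V] [Module ℂ V] [AddCommGroup W] [Module ℂ W] [AddCommGroup W₁] [Module ℂ W₁]
  [AddCommGroup W₂] [Module ℂ W₂] {𝕌 : ConformalVertexAlgebra A V}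

/-- `L(1)ω = 0`. -/
theorem L1_omega (𝕌 : ConformalVertexAlgebra A V) : 𝕌.Y 𝕌.ω 2 𝕌.ω = 0 := by
  -- `⁅L(1), L(-2)⁆ = 3L(-1)` applied to the vacuum: `L(-2)𝟏 = ω`, while `L(1)` and `L(-1)` kill
  -- `𝟏`. No central term occurs, since `1 + (-2) ≠ 0`.
  have h := LinearMap.congr_fun (𝕌.virasoro 1 (-2)) 𝕌.vac
  norm_num [Ring.lie_def, 𝕌.creation, 𝕌.creation_regular] at h
  exact h

/-- Since `L(1)ω = 0` and `ω` has weight `2`, only the term `k = 0` of `ωᵒ` survives, with sign `+1`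
and exponent `2·2 - 2`. -/
theorem oppTau_omega (c : ℂ) (M : ConformalModule 𝕌 W) (m : ℤ) :
    oppTau c M.toMobius (𝕌.ω ⊗ₜ[ℂ] (RatFunc.X ^ m)) =
      shiftedTau c M.Y M.truncated (𝕌.ω ⊗ₜ[ℂ] (RatFunc.X ^ (2 - m))) := by
  have hω : 𝕌.ω ∈ 𝕌.toMobius.sl2.L0.eigenspace ((2 : ℤ) : ℂ) := by
    have := 𝕌.ω_mem.2
    exact_mod_cast this
  have hK : ∀ k, 1 ≤ k → (𝕌.toMobius.sl2.L1 ^ k) 𝕌.ω = 0 := by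
    intro k hk
    obtain ⟨k, rfl⟩ : ∃ l, k = l + 1 := ⟨k - 1, by omega⟩
    have : 𝕌.toMobius.sl2.L1 𝕌.ω = 0 := L1_omega 𝕌
    rw [pow_succ, Module.End.mul_apply, this, map_zero]
  have e := oppTau_tmul c M.toMobius hω hK m 1
  rw [mul_one] at e
  rw [e, Finset.sum_range_one, oppTerm_apply, map_one, mul_one]
  norm_num
  rfl

/-- The coefficients defining the shifted operators are those of `(t + c)²`, `t + c` and `1`. -/
theorem oppTau_omega_eq_shift (c : ℂ) (M : ConformalModule 𝕌 W) :
    oppTau c M.toMobius (𝕌.ω ⊗ₜ[ℂ] (RatFunc.X ^ (0 : ℤ))) = (M.toMobius.sl2.shift c).L1 ∧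
    oppTau c M.toMobius (𝕌.ω ⊗ₜ[ℂ] (RatFunc.X ^ (1 : ℤ))) = (M.toMobius.sl2.shift c).L0 ∧
    oppTau c M.toMobius (𝕌.ω ⊗ₜ[ℂ] (RatFunc.X ^ (2 : ℤ))) = (M.toMobius.sl2.shift c).Lm1 := by
  have one_eq : (1 : LaurentSeries ℂ) = HahnSeries.single 0 1 := rfl
  have e0 : laurentTau M.Y M.truncated 𝕌.ω (iotaPlus (translate c 1)) = M.Y 𝕌.ω 0 := by
    rw [map_one, map_one, one_eq, laurentTau_single]
  have e1 : iotaPlus (translate c (RatFunc.X * 1)) =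
      HahnSeries.single 1 1 + c • HahnSeries.single 0 1 := by
    rw [iotaPlus_translate_X_mul, map_one (translate c), map_one iotaPlus, mul_one, one_eq]
  refine ⟨?_, ?_, ?_⟩
  · rw [oppTau_omega, shiftedTau_tmul,
      show (RatFunc.X : RatFunc ℂ) ^ ((2 : ℤ) - 0) = RatFunc.X * (RatFunc.X * 1) by
        rw [sub_zero, mul_one, zpow_ofNat, sq],
      iotaPlus_translate_X_mul, e1, mul_add, laurent_mul_smul, HahnSeries.single_mul_single,
      HahnSeries.single_mul_single]
    simp only [map_add, map_smul, smul_add, smul_smul, mul_one, laurentTau_single]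
    change M.Y 𝕌.ω (1 + 1) + c • M.Y 𝕌.ω (1 + 0) + (c • M.Y 𝕌.ω 1 + (c * c) • M.Y 𝕌.ω 0) =
      M.Y 𝕌.ω 2 + (2 * c) • M.Y 𝕌.ω 1 + (c ^ 2) • M.Y 𝕌.ω 0
    rw [show (1 : ℤ) + 1 = 2 by rfl, add_zero]
    module
  · rw [oppTau_omega, shiftedTau_tmul,
      show (RatFunc.X : RatFunc ℂ) ^ ((2 : ℤ) - 1) = RatFunc.X * 1 by norm_num, e1, map_add,
      map_smul, laurentTau_single, laurentTau_single]
    rfl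
  · rw [oppTau_omega, shiftedTau_tmul, sub_self, zpow_zero, e0]
    rfl

/-- In the conformal case `L'_{P(z)}(j)` is given by the same formula as in the Möbius case. -/
theorem conformalOps_eq_mobiusOps (z : ℂ) (M₁ : ConformalModule 𝕌 W₁)
    (M₂ : ConformalModule 𝕌 W₂) :
    conformalOps z M₁ M₂ = mobiusOps z M₁.toMobius M₂.toMobius := by
  have h₁ := oppTau_omega_eq_shift z M₁
  have h₂ := oppTau_omega_eq_shift 0 M₂
  have hm : (conformalOps z M₁ M₂).Lm1 = (mobiusOps z M₁.toMobius M₂.toMobius).Lm1 := by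
    rw [mobiusOps_Lm1, ← h₁.1, ← h₂.1, ← tauP_eq_dualAction]
    rfl
  have h0 : (conformalOps z M₁ M₂).L0 = (mobiusOps z M₁.toMobius M₂.toMobius).L0 := by
    rw [mobiusOps_L0, ← h₁.2.1, ← h₂.2.1, ← tauP_eq_dualAction]
    rfl
  have h1 : (conformalOps z M₁ M₂).L1 = (mobiusOps z M₁.toMobius M₂.toMobius).L1 := by
    rw [mobiusOps_L1, ← h₁.2.2, ← h₂.2.2, ← tauP_eq_dualAction]
    rfl
  exact congr (congr (congrArg SlOps.mk hm) h0) h1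

end Conformal

end

end PzTensor

open PzTensor
theorem mainTheorem2 {G V W₁ W₂ : Type*} [AddCommGroup G] (A : AddSubgroup G)
    [AddCommGroup V] [Module ℂ V] [AddCommGroup W₁] [Module ℂ W₁] [AddCommGroup W₂] [Module ℂ W₂]
    (z : ℂ) (hz : z ≠ 0) :
    (∀ (𝕍 : MobiusVertexAlgebra A V) (M₁ : MobiusModule 𝕍 W₁) (M₂ : MobiusModule 𝕍 W₂),
      (TauStable z M₁ M₂ (COMP z M₁ M₂) ∧ (mobiusOps z M₁ M₂).Stable (COMP z M₁ M₂)) ∧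
      (TauStable z M₁ M₂ (LGRgen z M₁ M₂ (mobiusOps z M₁ M₂)) ∧
        (mobiusOps z M₁ M₂).Stable (LGRgen z M₁ M₂ (mobiusOps z M₁ M₂))) ∧
      (TauStable z M₁ M₂ (LGRss z M₁ M₂ (mobiusOps z M₁ M₂)) ∧
        (mobiusOps z M₁ M₂).Stable (LGRss z M₁ M₂ (mobiusOps z M₁ M₂)))) ∧
    (∀ (𝕍 : ConformalVertexAlgebra A V) (M₁ : ConformalModule 𝕍 W₁) (M₂ : ConformalModule 𝕍 W₂),
      (TauStable z M₁.toMobius M₂.toMobius (COMP z M₁.toMobius M₂.toMobius) ∧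
        (conformalOps z M₁ M₂).Stable (COMP z M₁.toMobius M₂.toMobius)) ∧
      (TauStable z M₁.toMobius M₂.toMobius
          (LGRgen z M₁.toMobius M₂.toMobius (conformalOps z M₁ M₂)) ∧
        (conformalOps z M₁ M₂).Stable
          (LGRgen z M₁.toMobius M₂.toMobius (conformalOps z M₁ M₂))) ∧
      (TauStable z M₁.toMobius M₂.toMobius
          (LGRss z M₁.toMobius M₂.toMobius (conformalOps z M₁ M₂)) ∧
        (conformalOps z M₁ M₂).Stable
          (LGRss z M₁.toMobius M₂.toMobius (conformalOps z M₁ M₂)))) := by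
  refine ⟨fun 𝕍 M₁ M₂ => mobius_stable z M₁ M₂, fun 𝕍 M₁ M₂ => ?_⟩
  -- The rewrite also reaches the operators inside the local grading conditions, so these become
  -- literally the Möbius ones.
  rw [conformalOps_eq_mobiusOps]
  exact mobius_stable z M₁.toMobius M₂.toMobius
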